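/- **Setting.** Let $W,P_1,P_2,N_1,N_2,h_{11},h_{12},h_{21},h_{22}>0$. Two users share the spectrum $[0,W]$. A solution is a pair of integrable functions $p_1,p_2\ge 0$ on $[0,W]$ (power spectral densities, PSDs) with $\int_0^W p_i\le P_i$; its capacity is $$C(p_1,p_2)=\int_0^W\log\Bigl(1+\frac{p_1h_{11}}{p_2h_{21}+N_1}\Bigr)dx+\int_0^W\log\Bigl(1+\frac{p_2h_{22}}{p_1h_{12}+N_2}\Bigr)dx .$$ The spectrum used by user $i$ is $\{x: p_i(x)>0\}$; sets of frequencies are compared up to null sets. The two spectra are disjoint, equal (fully overlapping), or partially overlapping (neither disjoint nor equal). Optimal means of maximal capacity. **Band parameters.** For $t=(S_1,S_2,S_{12},\sigma_1,c_1,\sigma_2,c_2)$, the *layout* of $t$ consists of three contiguous bands of sizes $S_1,S_{12},S_2$: on the first only user 1 is active, with PSD $\sigma_1+c_1$; on the second both are active, with PSDs $\sigma_1,\sigma_2$; on the third only user 2 is active, with PSD $\sigma_2+c_2$. Put $$B(t)=S_1\log\Bigl(1+\tfrac{(\sigma_1+c_1)h_{11}}{N_1}\Bigr)+S_2\log\Bigl(1+\tfrac{(\sigma_2+c_2)h_{22}}{N_2}\Bigr)+S_{12}\Bigl[\log\Bigl(1+\tfrac{\sigma_1h_{11}}{\sigma_2h_{21}+N_1}\Bigr)+\log\Bigl(1+\tfrac{\sigma_2h_{22}}{\sigma_1h_{12}+N_2}\Bigr)\Bigr],$$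 $$\Gamma_1=h_{11}(h_{21}\sigma_2-c_1h_{11})(N_2+h_{12}\sigma_1)(N_2+h_{12}\sigma_1+h_{22}\sigma_2)+h_{12}h_{22}\sigma_2\bigl(N_1+h_{11}(\sigma_1+c_1)\bigr)(N_1+h_{11}\sigma_1+h_{21}\sigma_2),$$ and let $\Gamma_2$ be obtained from $\Gamma_1$ by exchanging the users. The *six equations* are $$W=S_1+S_2+S_{12},\quad P_1=S_1(\sigma_1+c_1)+S_{12}\sigma_1,\quad P_2=S_2(\sigma_2+c_2)+S_{12}\sigma_2,$$ $$\frac{S_1}{S_2}=\frac{N_2\,[S_1(\sigma_1+c_1)]\,h_{11}}{N_1\,[S_2(\sigma_2+c_2)]\,h_{22}},\qquad \Gamma_1=0,\qquad \Gamma_2=0 .$$ Let $\mathcal T$ be the set of solutions of the six equations with all seven variables positive, and $\mathcal T^{*}=\{t\in\mathcal T: c_1c_2\ne\sigma_1\sigma_2\}$. Let $\mathcal T_1$ be the set of solutions for $S_1=0$: $S_1$ and $c_1$ disappear (are set to $0$), the ratio equation and $\Gamma_1=0$ are dropped, and the other variables are positive; let $\mathcal T_2$ be the same for $S_2=0$.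 Put $\mathcal S=\mathcal T^{*}\cup\mathcal T_1\cup\mathcal T_2$, $P=P_1+P_2$, $\gamma=\max\bigl(1,\frac{N_2h_{11}}{N_1h_{22}}\bigr)$, $$D=\{s\in(0,\gamma P/W):\ \text{some } t\in\mathcal S \text{ has } \sigma_2=s\},\qquad \hat B(s)=\sup\{B(t): t\in\mathcal S,\ \sigma_2=s\}.$$ **Theorem.** 1. An optimal solution exists, and one can be chosen among: the disjoint layout, in which the spectrum is divided in the ratio $N_2P_1h_{11}:N_1P_2h_{22}$ and user $i$ spreads power $P_i$ uniformly over its part; the fully overlapping one $p_1=P_1/W$, $p_2=P_2/W$; and the partially overlapping layouts of $t\in\mathcal S$ with $\sigma_2<\gamma P/W$. The optimal capacity is the greatest element of $\{C_{\rm dis},C_{\rm full}\}\cup\{\hat B(s):s\in D\}$, where $$C_{\rm dis}=W\log\Bigl(1+\tfrac{P_1h_{11}}{WN_1}+\tfrac{P_2h_{22}}{WN_2}\Bigr),\quad C_{\rm full}=W\log\Bigl(1+\tfrac{P_1h_{11}}{P_2h_{21}+WN_1}\Bigr)+W\log\Bigl(1+\tfrac{P_2h_{22}}{P_1h_{12}+WN_2}\Bigr).$$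 2. The disjoint layout is optimal among solutions with disjoint spectra, with capacity $C_{\rm dis}$. The constant PSDs $P_i/W$ form a solution with equal spectra and capacity $C_{\rm full}$, and every solution that is optimal among those with equal spectra has capacity $C_{\rm full}$. 3. Let $(p_1,p_2)$ be optimal among the partially overlapping solutions. If the parts of the spectrum used by user 1 only and by user 2 only both have positive measure, there is $t\in\mathcal T$ with $\sigma_2<\gamma P/W$ such that: $S_1,S_2,S_{12}$ are the sizes of the parts used by user 1 only, by user 2 only, and by both; $p_i=\sigma_i+c_i$ a.e. on the part exclusive to user $i$; user $i$ spends the power $S_{12}\sigma_i$ on the shared part; and the layout of $t$ is also optimal among the partially overlapping solutions, with capacity $B(t)=C(p_1,p_2)$. If the part exclusive to user 1 (resp. user 2) is null, the same holds with $t\in\mathcal T_1$ (resp. $\mathcal T_2$). Moreover either $C(p_1,p_2)=C_{\rm dis}$ or $C(p_1,p_2)=\max_{s\in D}\hat B(s)$. 4. Every $t\in\mathcal T$ satisfies $\sigma_2<\gamma P/W$. For every $t\in\mathcal T\cup\mathcal T_1\cup\mathcal T_2$ the layout of $t$ is a partially overlapping solution of capacity $B(t)$. 5. In each of $\mathcal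 T^{*},\mathcal T_1,\mathcal T_2$ all variables except $\sigma_2$ can be eliminated: $\sigma_1$ is a root of an equation of degree at most four whose coefficients are polynomials in $\sigma_2$, not all zero at any given $\sigma_2>0$, and $(\sigma_1,\sigma_2)$ determines the other variables. For each $s>0$ at most $16$ elements of $\mathcal S$ have $\sigma_2=s$. -/

import Mathlib

open MeasureTheory

namespace TwoUserSAPD

noncomputable section

/-- Data of the two-user problem in flat channels: the spectrum is `[0, W]`, user `i` has maximum
total power `Pᵢ` and noise density `Nᵢ`, and `hᵢⱼ` is the gain from sender `i` to receiver `j`. -/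
structure FlatChannel where
  (W P₁ P₂ N₁ N₂ h₁₁ h₁₂ h₂₁ h₂₂ : ℝ)
  W_pos : 0 < W
  P₁_pos : 0 < P₁
  P₂_pos : 0 < P₂
  N₁_pos : 0 < N₁
  N₂_pos : 0 < N₂
  h₁₁_pos : 0 < h₁₁
  h₁₂_pos : 0 < h₁₂
  h₂₁_pos : 0 < h₂₁
  h₂₂_pos : 0 < h₂₂

/-- A pair of power spectral densities; only the values on `[0, W]` matter. -/
structure PSDPair where
  (p₁ p₂ : ℝ → ℝ)

/-- The (unknown) parameters of a three-band solution: band sizes `S₁, S₂, S₁₂`, the densities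
`σ₁, σ₂` in the shared band, and the densities `σ₁ + c₁`, `σ₂ + c₂` in the exclusive bands. -/
structure BandParams where
  (S₁ S₂ S₁₂ σ₁ c₁ σ₂ c₂ : ℝ)

/-- One power spectral density with total power at most `P` on `[0, W]`. -/
def IsPSD (W P : ℝ) (p : ℝ → ℝ) : Prop :=
  (∀ x ∈ Set.Icc 0 W, 0 ≤ p x) ∧ IntegrableOn p (Set.Icc 0 W) ∧ ∫ x in (0 : ℝ)..W, p x ≤ P

def Feasible (ch : FlatChannel) (p : PSDPair) : Prop :=
  IsPSD ch.W ch.P₁ p.p₁ ∧ IsPSD ch.W ch.P₂ p.p₂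

/-- Total capacity `C₁ + C₂`. -/
def capacity (ch : FlatChannel) (p : PSDPair) : ℝ :=
  (∫ x in (0 : ℝ)..ch.W, Real.log (1 + p.p₁ x * ch.h₁₁ / (p.p₂ x * ch.h₂₁ + ch.N₁))) +
  (∫ x in (0 : ℝ)..ch.W, Real.log (1 + p.p₂ x * ch.h₂₂ / (p.p₁ x * ch.h₁₂ + ch.N₂)))

/-- `p` is feasible, satisfies `Q`, and has the largest capacity among all such pairs. -/
def IsOptimalAmong (ch : FlatChannel) (Q : PSDPair → Prop) (p : PSDPair) : Prop :=
  (Feasible ch p ∧ Q p) ∧ ∀ q, Feasible ch q → Q q → capacity ch q ≤ capacity ch p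

/-- An optimal solution of the problem. -/
def IsOptimal (ch : FlatChannel) (p : PSDPair) : Prop :=
  IsOptimalAmong ch (fun _ => True) p

/-- Spectrum used by a density. -/
def usedSpectrum (ch : FlatChannel) (p : ℝ → ℝ) : Set ℝ := {x ∈ Set.Icc 0 ch.W | 0 < p x}

/-- Frequencies used by user 1 only. -/
def excl₁ (ch : FlatChannel) (p : PSDPair) : Set ℝ :=
  usedSpectrum ch p.p₁ \ usedSpectrum ch p.p₂

/-- Frequencies used by user 2 only. -/
def excl₂ (ch : FlatChannel) (p : PSDPair) : Set ℝ :=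
  usedSpectrum ch p.p₂ \ usedSpectrum ch p.p₁

/-- Frequencies used by both users. -/
def shared (ch : FlatChannel) (p : PSDPair) : Set ℝ :=
  usedSpectrum ch p.p₁ ∩ usedSpectrum ch p.p₂

/-! As usual, sets of frequencies are compared up to null sets. -/

def DisjointSpectra (ch : FlatChannel) (p : PSDPair) : Prop :=
  volume (shared ch p) = 0

def EqualSpectra (ch : FlatChannel) (p : PSDPair) : Prop :=
  volume (excl₁ ch p) = 0 ∧ volume (excl₂ ch p) = 0

def PartiallyOverlapping (ch : FlatChannel) (p : PSDPair) : Prop :=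
  ¬ DisjointSpectra ch p ∧ ¬ EqualSpectra ch p

/-- The contiguous layout: user 1 alone on `[0, S₁)`, both users on `[S₁, S₁ + S₁₂)`, user 2 alone
from `S₁ + S₁₂` on. -/
def layout (t : BandParams) : PSDPair where
  p₁ x := if x < t.S₁ then t.σ₁ + t.c₁ else if x < t.S₁ + t.S₁₂ then t.σ₁ else 0
  p₂ x := if x < t.S₁ then 0 else if x < t.S₁ + t.S₁₂ then t.σ₂ else t.σ₂ + t.c₂

/-- The capacity `B` of a three-band solution as a function of its seven parameters. -/
def bandCapacity (ch : FlatChannel) (t : BandParams) : ℝ :=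
  t.S₁ * Real.log (1 + (t.σ₁ + t.c₁) * ch.h₁₁ / ch.N₁) +
  t.S₂ * Real.log (1 + (t.σ₂ + t.c₂) * ch.h₂₂ / ch.N₂) +
  t.S₁₂ * (Real.log (1 + t.σ₁ * ch.h₁₁ / (t.σ₂ * ch.h₂₁ + ch.N₁)) +
    Real.log (1 + t.σ₂ * ch.h₂₂ / (t.σ₁ * ch.h₁₂ + ch.N₂)))

/-- Best capacity with disjoint spectra. -/
def disjointCapacity (ch : FlatChannel) : ℝ :=
  ch.W * Real.log (1 + ch.P₁ * ch.h₁₁ / (ch.W * ch.N₁) + ch.P₂ * ch.h₂₂ / (ch.W * ch.N₂))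

/-- The spectrum is divided in the ratio `N₂P₁h₁₁ : N₁P₂h₂₂`, without a shared band. -/
def disjointBands (ch : FlatChannel) : BandParams :=
  let S₁ := ch.W * (ch.N₂ * ch.P₁ * ch.h₁₁) / (ch.N₂ * ch.P₁ * ch.h₁₁ + ch.N₁ * ch.P₂ * ch.h₂₂)
  let S₂ := ch.W * (ch.N₁ * ch.P₂ * ch.h₂₂) / (ch.N₂ * ch.P₁ * ch.h₁₁ + ch.N₁ * ch.P₂ * ch.h₂₂)
  { S₁ := S₁, S₂ := S₂, S₁₂ := 0, σ₁ := 0, c₁ := ch.P₁ / S₁, σ₂ := 0, c₂ := ch.P₂ / S₂ }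

/-- Capacity when both users spread their power uniformly over the whole spectrum. -/
def overlapCapacity (ch : FlatChannel) : ℝ :=
  ch.W * Real.log (1 + ch.P₁ * ch.h₁₁ / (ch.P₂ * ch.h₂₁ + ch.W * ch.N₁)) +
  ch.W * Real.log (1 + ch.P₂ * ch.h₂₂ / (ch.P₁ * ch.h₁₂ + ch.W * ch.N₂))

/-- Both users use the whole spectrum uniformly. -/
def overlapBands (ch : FlatChannel) : BandParams :=
  { S₁ := 0, S₂ := 0, S₁₂ := ch.W, σ₁ := ch.P₁ / ch.W, c₁ := 0, σ₂ := ch.P₂ / ch.W, c₂ := 0 }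

/-- `N`, `h` are noise and direct gain of the user considered, `N'`, `h'` those of the other user,
`g` is the gain from the user considered to the other receiver, `g'` the reverse cross gain,
`σ`, `σ + c` are the densities of the user considered in the shared and in its exclusive band, and
`σ'` is the density of the other user in the shared band. -/
def gam (N N' h h' g g' σ c σ' : ℝ) : ℝ :=
  h * (g' * σ' - c * h) * (N' + g * σ) * (N' + g * σ + h' * σ') +
  g * h' * σ' * (N + h * (σ + c)) * (N + h * σ + g' * σ')

/-- Expanded form of `gam` in the normalisation where the cross gains are `1`. -/
theorem gam_unit_cross_gains (N₁ N₂ h₁₁ h₂₂ σ₁ c₁ σ₂ : ℝ) :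
    gam N₁ N₂ h₁₁ h₂₂ 1 1 σ₁ c₁ σ₂ =
      h₂₂ * N₁ ^ 2 * σ₂ + 2 * (h₂₂ * h₁₁) * N₁ * σ₁ * σ₂ + (h₂₂ * h₁₁) * c₁ * N₁ * σ₂
      + h₂₂ * N₁ * σ₂ ^ 2 - c₁ * N₂ ^ 2 * h₁₁ ^ 2 + c₁ * h₁₁ * h₂₂ * σ₂ ^ 2
      - c₁ * h₂₂ * N₂ * h₁₁ ^ 2 * σ₂ + 2 * N₂ * h₁₁ * σ₁ * σ₂ + h₂₂ * N₂ * h₁₁ * σ₂ ^ 2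
      + (h₂₂ * h₁₁ ^ 2) * σ₁ ^ 2 * σ₂ - c₁ * h₁₁ ^ 2 * σ₁ ^ 2 + h₁₁ * σ₁ ^ 2 * σ₂
      + 2 * (h₂₂ * h₁₁) * σ₁ * σ₂ ^ 2 + N₂ ^ 2 * h₁₁ * σ₂ - 2 * c₁ * N₂ * h₁₁ ^ 2 * σ₁ := by
  unfold gam; ring

/-- `gam` is, up to a positive factor, the derivative of the total capacity when the user considered
moves power from a unit of the shared band to a part of width `w` of its exclusive band. -/
theorem hasDerivAt_power_exchange {N N' h h' g g' σ c σ' w : ℝ} (hN : 0 < N) (hN' : 0 < N')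
    (hh : 0 < h) (hh' : 0 < h') (hg : 0 < g) (hg' : 0 < g') (hσ : 0 < σ) (hc : 0 < c)
    (hσ' : 0 < σ') (hw : 0 < w) :
    HasDerivAt (fun e : ℝ => w * Real.log (1 + (σ + c + e / w) * h / N) +
        Real.log (1 + (σ - e) * h / (σ' * g' + N)) + Real.log (1 + σ' * h' / ((σ - e) * g + N')))
      (gam N N' h h' g g' σ c σ' / ((N + h * (σ + c)) * (N + h * σ + g' * σ') *
        (N' + g * σ) * (N' + g * σ + h' * σ'))) 0 := by
  have e1 : HasDerivAt (fun e : ℝ => 1 + (σ + c + e / w) * h / N) (1 / w * h / N) 0 :=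
    (((((hasDerivAt_id (0 : ℝ)).div_const w).const_add (σ + c)).mul_const h).div_const N).const_add 1
  have e2 : HasDerivAt (fun e : ℝ => 1 + (σ - e) * h / (σ' * g' + N))
      (-1 * h / (σ' * g' + N)) 0 :=
    ((((hasDerivAt_id (0 : ℝ)).const_sub σ).mul_const h).div_const _).const_add 1
  have e3 : HasDerivAt (fun e : ℝ => (σ - e) * g + N') (-1 * g) 0 :=
    (((hasDerivAt_id (0 : ℝ)).const_sub σ).mul_const g).add_const N'
  have n1 : 1 + (σ + c + 0 / w) * h / N ≠ 0 := by
    have : 0 < 1 + (σ + c + 0 / w) * h / N := by positivity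
    exact this.ne'
  have n2 : 1 + (σ - 0) * h / (σ' * g' + N) ≠ 0 := by
    rw [sub_zero]; positivity
  have n3 : (σ - 0) * g + N' ≠ 0 := by
    rw [sub_zero]; positivity
  have n4 : 1 + σ' * h' / ((σ - 0) * g + N') ≠ 0 := by
    rw [sub_zero]; positivity
  have e4 : HasDerivAt (fun e : ℝ => 1 + σ' * h' / ((σ - e) * g + N'))
      ((0 * ((σ - 0) * g + N') - σ' * h' * (-1 * g)) / ((σ - 0) * g + N') ^ 2) 0 :=
    ((hasDerivAt_const (0 : ℝ) (σ' * h')).div e3 n3).const_add 1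
  refine HasDerivAt.congr_deriv
    ((((e1.log n1).const_mul w).add (e2.log n2)).add (e4.log n4)) ?_
  unfold gam
  simp only [sub_zero, zero_div, add_zero]
  field_simp
  ring

/-- Stationarity expression of user 1. -/
def Γ₁ (ch : FlatChannel) (t : BandParams) : ℝ :=
  gam ch.N₁ ch.N₂ ch.h₁₁ ch.h₂₂ ch.h₁₂ ch.h₂₁ t.σ₁ t.c₁ t.σ₂

/-- Stationarity expression of user 2. -/
def Γ₂ (ch : FlatChannel) (t : BandParams) : ℝ :=
  gam ch.N₂ ch.N₁ ch.h₂₂ ch.h₁₁ ch.h₂₁ ch.h₁₂ t.σ₂ t.c₂ t.σ₁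

/-- The six equations: bandwidth, the two power equations, the ratio of the exclusive bands
(that of the disjoint problem on `S₁ ∪ S₂`, for the powers which are spent there), and the two
stationarity conditions. -/
def SixEquations (ch : FlatChannel) (t : BandParams) : Prop :=
  ch.W = t.S₁ + t.S₂ + t.S₁₂ ∧
  ch.P₁ = t.S₁ * (t.σ₁ + t.c₁) + t.S₁₂ * t.σ₁ ∧
  ch.P₂ = t.S₂ * (t.σ₂ + t.c₂) + t.S₁₂ * t.σ₂ ∧
  t.S₁ / t.S₂ =
    (ch.N₂ * (t.S₁ * (t.σ₁ + t.c₁)) * ch.h₁₁) / (ch.N₁ * (t.S₂ * (t.σ₂ + t.c₂)) * ch.h₂₂) ∧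
  Γ₁ ch t = 0 ∧
  Γ₂ ch t = 0

/-- Positive solutions of the six equations. -/
def ThreeBand (ch : FlatChannel) : Set BandParams :=
  {t | 0 < t.S₁ ∧ 0 < t.S₂ ∧ 0 < t.S₁₂ ∧ 0 < t.σ₁ ∧ 0 < t.c₁ ∧ 0 < t.σ₂ ∧ 0 < t.c₂ ∧
    SixEquations ch t}

/-- The solutions for which the linear system for the band sizes is regular. -/
def RegularThreeBand (ch : FlatChannel) : Set BandParams :=
  {t ∈ ThreeBand ch | t.c₁ * t.c₂ ≠ t.σ₁ * t.σ₂}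

/-- The system for `S₁ = 0`: the variables `S₁, c₁` (set to `0`) and two equations disappear. -/
def NoExclusive₁ (ch : FlatChannel) : Set BandParams :=
  {t | t.S₁ = 0 ∧ t.c₁ = 0 ∧ 0 < t.S₂ ∧ 0 < t.S₁₂ ∧ 0 < t.σ₁ ∧ 0 < t.σ₂ ∧ 0 < t.c₂ ∧
    ch.W = t.S₂ + t.S₁₂ ∧
    ch.P₁ = t.S₁₂ * t.σ₁ ∧
    ch.P₂ = t.S₂ * (t.σ₂ + t.c₂) + t.S₁₂ * t.σ₂ ∧
    Γ₂ ch t = 0}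

/-- The system for `S₂ = 0`: the variables `S₂, c₂` (set to `0`) and two equations disappear. -/
def NoExclusive₂ (ch : FlatChannel) : Set BandParams :=
  {t | t.S₂ = 0 ∧ t.c₂ = 0 ∧ 0 < t.S₁ ∧ 0 < t.S₁₂ ∧ 0 < t.σ₁ ∧ 0 < t.c₁ ∧ 0 < t.σ₂ ∧
    ch.W = t.S₁ + t.S₁₂ ∧
    ch.P₁ = t.S₁ * (t.σ₁ + t.c₁) + t.S₁₂ * t.σ₁ ∧
    ch.P₂ = t.S₁₂ * t.σ₂ ∧
    Γ₁ ch t = 0}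

/-- All parameter values for partially overlapping spectra. -/
def PartialSolutions (ch : FlatChannel) : Set BandParams :=
  RegularThreeBand ch ∪ NoExclusive₁ ch ∪ NoExclusive₂ ch

/-- The bound `γ P / W` on `σ₂`, where `γ = max (1, N₂h₁₁ / (N₁h₂₂))` and `P = P₁ + P₂`. -/
def sigmaBound (ch : FlatChannel) : ℝ :=
  max 1 (ch.N₂ * ch.h₁₁ / (ch.N₁ * ch.h₂₂)) * (ch.P₁ + ch.P₂) / ch.W

/-- All variables other than `σ₂` can be eliminated from the system with solution set `T`: `σ₁` is
a root of an equation of degree at most four whose coefficients are polynomials in `σ₂`, and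
`σ₁, σ₂` determine the remaining variables. -/
def EliminatesToσ₂ (T : Set BandParams) : Prop :=
  (∃ k : Fin 5 → Polynomial ℝ, ∀ s : ℝ, 0 < s →
    (∃ i, (k i).eval s ≠ 0) ∧
    ∀ t ∈ T, t.σ₂ = s → ∑ i : Fin 5, (k i).eval s * t.σ₁ ^ (i : ℕ) = 0) ∧
  ∀ t ∈ T, ∀ t' ∈ T, t.σ₁ = t'.σ₁ → t.σ₂ = t'.σ₂ → t = t'

/-- The values of `σ₂` in `(0, γP/W)` for which the equations have a solution. -/
def sigmaDomain (ch : FlatChannel) : Set ℝ :=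
  {s | 0 < s ∧ s < sigmaBound ch ∧ ∃ t ∈ PartialSolutions ch, t.σ₂ = s}

/-- The one-variable objective: the largest `B` over the parameter values with the given `σ₂`. -/
def reducedCapacity (ch : FlatChannel) (s : ℝ) : ℝ :=
  sSup (bandCapacity ch '' {t ∈ PartialSolutions ch | t.σ₂ = s})

/-- The solution `p` is described by `t`: the bands have the sizes of the three parts of the
spectrum, the densities on the exclusive parts are the given constants, each user spends on the
shared part the power `S₁₂ σᵢ`, and the contiguous layout of `t`, with constant density of each
user on each band, is a solution with the same used spectrum sizes and the same capacity
`B`. -/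
def DescribedBy (ch : FlatChannel) (p : PSDPair) (t : BandParams) : Prop :=
  t.S₁ = volume.real (excl₁ ch p) ∧
  t.S₂ = volume.real (excl₂ ch p) ∧
  t.S₁₂ = volume.real (shared ch p) ∧
  (∀ᵐ x, x ∈ excl₁ ch p → p.p₁ x = t.σ₁ + t.c₁) ∧
  (∀ᵐ x, x ∈ excl₂ ch p → p.p₂ x = t.σ₂ + t.c₂) ∧
  t.S₁₂ * t.σ₁ = ∫ x in shared ch p, p.p₁ x ∧
  t.S₁₂ * t.σ₂ = ∫ x in shared ch p, p.p₂ x ∧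
  bandCapacity ch t = capacity ch p ∧
  capacity ch (layout t) = capacity ch p ∧
  IsOptimalAmong ch (PartiallyOverlapping ch) (layout t)

end

end TwoUserSAPD

open TwoUserSAPD

/-! The capacity is the integral of a pointwise function `rate` of the two densities, under linear
constraints on power and bandwidth, so Lagrangian duality applies even though `rate` is not concave.
An affine majorant `l₁ a + l₂ b + c` of `rate` on the closed quadrant, with positive slopes, bounds
every capacity by `l₁ P₁ + l₂ P₂ + c W` (`capacity_le`), and equality forces both powers to be spent
and the densities to lie a.e. in the set where the majorant touches `rate` (`touch_of_le_capacity`).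
There is no duality gap: for the majorant that is least at the mean densities `(P₁/W, P₂/W)`, the
mean is a convex combination of touching points (`exists_affineMajorant_mem_convexHull`), and the
weights of this combination are the relative widths of bands.

The heart of the matter is that the touching set is tiny. It omits the origin and meets each axis in
at most one point, and it has at most one point in the open quadrant
(`AffineMajorant.touch_unique`). Hence every optimum consists of at most three bands with a.e.
constant densities. The equations are the first order conditions: `Γ₁ = 0` says that the slope `l₁`
is the same at the exclusive and at the shared point, `Γ₂ = 0` says this for `l₂`, and the ratio
equation says that the two exclusive points share the intercept `c`.

The three kinds of optimum correspond to the bands that are present (`OptimalBands.value_cases`). In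
the singular case `c₁ c₂ = σ₁ σ₂` the shared point lies on the line through the two exclusive
points, and the disjoint layout has the same value. An optimum among equal or among partially
overlapping spectra is a global optimum, because every feasible pair is approximated by such pairs
with convergence of capacities (`IsOptimalAmong_dense`), so the same dual analysis describes it. The
elimination is algebra: each stationarity equation is affine in the excess density `cᵢ`. -/

/-- `1 / (x v)` is strictly convex along a segment on which `x`, `v` are affine and positive and
`v` is not constant. -/
lemma one_div_affine_mul_affine_lt {x₀ x₁ v₀ v₁ s : ℝ} (hx₀ : 0 < x₀) (hx₁ : 0 < x₁)
    (hv₀ : 0 < v₀) (hv₁ : 0 < v₁) (hv : v₀ ≠ v₁) (hs : 0 < s) (hs' : s < 1) :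
    1 / (((1 - s) * x₀ + s * x₁) * ((1 - s) * v₀ + s * v₁)) <
      (1 - s) * (1 / (x₀ * v₀)) + s * (1 / (x₁ * v₁)) := by
  obtain ⟨t, ht⟩ : ∃ t, t = 1 - s := ⟨_, rfl⟩
  have ht0 : 0 < t := by linarith
  rw [← ht]
  -- Here `p`, `q` stand for the two endpoint products and `S` for the mixed term `x₀ v₁ + x₁ v₀`.
  -- The proof squares the negation and uses `4 q³ - p (3 q - p)² = (q - p)² (4 q - p)`.
  have key : ∀ p q S : ℝ, 0 < p → 0 < q → 0 < S → 4 * (p * q) ≤ S ^ 2 →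
      (4 * (p * q) < S ^ 2 ∨ p ≠ q) → 3 * (p * q) < q * S + p ^ 2 := by
    intro p q S hp hq hS h4 hst
    by_contra! hcon
    have h1 : q * S ≤ p * (3 * q - p) := by nlinarith
    have h2 : (q * S) ^ 2 ≤ (p * (3 * q - p)) ^ 2 :=
      pow_le_pow_left₀ (by positivity) h1 2
    have h3 : 0 < 3 * q - p := by
      by_contra! h
      have : 0 < q * S := by positivity
      nlinarith
    have h5 : 0 ≤ p * ((q - p) ^ 2 * (4 * q - p)) :=
      mul_nonneg hp.le (mul_nonneg (sq_nonneg _) (by linarith))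
    rcases hst with hst | hst
    · have : q ^ 2 * (4 * (p * q)) < q ^ 2 * S ^ 2 := by gcongr
      nlinarith
    · have h6 : 0 < p * ((q - p) ^ 2 * (4 * q - p)) := by
        have : q - p ≠ 0 := sub_ne_zero.2 (Ne.symm hst)
        have : 0 < 4 * q - p := by linarith
        positivity
      have : q ^ 2 * (4 * (p * q)) ≤ q ^ 2 * S ^ 2 := by gcongr
      nlinarith
  have hS4 : 4 * ((x₀ * v₀) * (x₁ * v₁)) ≤ (x₀ * v₁ + x₁ * v₀) ^ 2 := by
    nlinarith [sq_nonneg (x₀ * v₁ - x₁ * v₀)]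
  have hst : 4 * ((x₀ * v₀) * (x₁ * v₁)) < (x₀ * v₁ + x₁ * v₀) ^ 2 ∨ x₀ * v₀ ≠ x₁ * v₁ := by
    by_cases h : x₀ * v₁ = x₁ * v₀
    · right
      intro h'
      have h1 : x₀ * v₁ * v₁ = x₀ * v₀ * v₀ := by rw [h, h']; ring
      have h2 : x₀ * ((v₁ - v₀) * (v₁ + v₀)) = 0 := by linear_combination h1
      have h3 : v₁ + v₀ ≠ 0 := by positivity
      have h4 : v₁ - v₀ ≠ 0 := sub_ne_zero.2 (Ne.symm hv)
      exact (mul_ne_zero hx₀.ne' (mul_ne_zero h4 h3)) h2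
    · left
      have : 0 < (x₀ * v₁ - x₁ * v₀) ^ 2 := by
        have := sub_ne_zero.2 h
        positivity
      nlinarith
  have k1 := key (x₀ * v₀) (x₁ * v₁) (x₀ * v₁ + x₁ * v₀) (by positivity) (by positivity)
    (by positivity) hS4 hst
  have k2 := key (x₁ * v₁) (x₀ * v₀) (x₀ * v₁ + x₁ * v₀) (by positivity) (by positivity)
    (by positivity) (by linarith) (hst.imp (fun h => by linarith) Ne.symm)
  have e : t * (1 / (x₀ * v₀)) + s * (1 / (x₁ * v₁)) =
      (t * (x₁ * v₁) + s * (x₀ * v₀)) / ((x₀ * v₀) * (x₁ * v₁)) := by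
    field_simp
  rw [e, div_lt_div_iff₀ (by positivity) (by positivity)]
  have hts : t = 1 - s := ht
  -- After clearing denominators both sides are cubic forms in `t`, `s`, where the left one is
  -- multiplied by `(t + s)³ = 1`. They are compared coefficient by coefficient.
  have expand : (t * (x₁ * v₁) + s * (x₀ * v₀)) * ((t * x₀ + s * x₁) * (t * v₀ + s * v₁)) =
      (t ^ 3 + s ^ 3) * ((x₀ * v₀) * (x₁ * v₁))
      + t ^ 2 * s * ((x₁ * v₁) * (x₀ * v₁ + x₁ * v₀) + (x₀ * v₀) ^ 2)
      + t * s ^ 2 * ((x₀ * v₀) * (x₀ * v₁ + x₁ * v₀) + (x₁ * v₁) ^ 2) := by ring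
  have cube : 1 * ((x₀ * v₀) * (x₁ * v₁)) =
      (t ^ 3 + s ^ 3) * ((x₀ * v₀) * (x₁ * v₁))
      + t ^ 2 * s * (3 * ((x₀ * v₀) * (x₁ * v₁))) + t * s ^ 2 * (3 * ((x₁ * v₁) * (x₀ * v₀))) := by
    rw [hts]; ring
  rw [expand, cube]
  have m1 := mul_lt_mul_of_pos_left k1 (show 0 < t ^ 2 * s by positivity)
  have m2 := mul_lt_mul_of_pos_left k2 (show 0 < t * s ^ 2 by positivity)
  linarith

/-! ### Affine majorants of the rate in normalised units -/

/-- Total rate per unit of bandwidth in units in which both noises and both cross gains are `1`. -/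
noncomputable def unitRate (A B a b : ℝ) : ℝ :=
  Real.log (1 + A * a + b) - Real.log (1 + b) + Real.log (1 + a + B * b) - Real.log (1 + a)

/-- `l₁ a + l₂ b + c` is an affine majorant of `f` on the closed quadrant. -/
def AffineMajorant (f : ℝ → ℝ → ℝ) (l₁ l₂ c : ℝ) : Prop :=
  ∀ a b, 0 ≤ a → 0 ≤ b → f a b ≤ l₁ * a + l₂ * b + c

lemma unitRate_swap (A B a b : ℝ) : unitRate A B a b = unitRate B A b a := by
  unfold unitRate
  rw [add_right_comm 1 (A * a) b, add_right_comm 1 a (B * b)]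
  ring

lemma AffineMajorant.swap_unitRate {A B l₁ l₂ c : ℝ}
    (h : AffineMajorant (unitRate A B) l₁ l₂ c) : AffineMajorant (unitRate B A) l₂ l₁ c := by
  intro a b ha hb
  rw [unitRate_swap]
  linarith [h b a hb ha]

section UnitRate

variable {A B l₁ l₂ c a b : ℝ}

lemma hasDerivAt_unitRate_line (hA : 0 < A) (hB : 0 < B) {u v s : ℝ} (ha : 0 ≤ a + s * u)
    (hb : 0 ≤ b + s * v) :
    HasDerivAt (fun t => unitRate A B (a + t * u) (b + t * v))
      ((A * u + v) / (1 + A * (a + s * u) + (b + s * v)) - v / (1 + (b + s * v))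
        + (u + B * v) / (1 + (a + s * u) + B * (b + s * v)) - u / (1 + (a + s * u))) s := by
  have d1 : HasDerivAt (fun t : ℝ => a + t * u) u s := by
    simpa using ((hasDerivAt_id s).mul_const u).const_add a
  have d2 : HasDerivAt (fun t : ℝ => b + t * v) v s := by
    simpa using ((hasDerivAt_id s).mul_const v).const_add b
  have p1 : 0 < 1 + A * (a + s * u) + (b + s * v) := by
    have := mul_nonneg hA.le ha
    linarith
  have p3 : 0 < 1 + (a + s * u) + B * (b + s * v) := by
    have := mul_nonneg hB.le hb
    linarith
  have e1 := (((d1.const_mul A).const_add 1).add d2).log p1.ne'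
  have e2 := (d2.const_add 1).log (show 1 + (b + s * v) ≠ 0 by linarith)
  have e3 := ((d1.const_add 1).add (d2.const_mul B)).log p3.ne'
  have e4 := (d1.const_add 1).log (show 1 + (a + s * u) ≠ 0 by linarith)
  exact ((e1.sub e2).add e3).sub e4

/-- First order condition at a touching point. -/
lemma AffineMajorant.stationary_unitRate (hA : 0 < A) (hB : 0 < B)
    (h : AffineMajorant (unitRate A B) l₁ l₂ c) (ha : 0 < a) (hb : 0 ≤ b)
    (e : unitRate A B a b = l₁ * a + l₂ * b + c) :
    l₁ = A / (1 + A * a + b) + 1 / (1 + a + B * b) - 1 / (1 + a) := by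
  have d := hasDerivAt_unitRate_line (a := a) (b := b) (u := 1) (v := 0) (s := 0) hA hB
    (by linarith) (by linarith)
  have d' : HasDerivAt (fun t : ℝ => l₁ * (a + t * 1) + l₂ * (b + t * 0) + c) l₁ 0 := by
    have : HasDerivAt (fun t : ℝ => a + t * 1) 1 0 := by
      simpa using (hasDerivAt_id (0 : ℝ)).const_add a
    simpa using ((this.const_mul l₁).add_const (l₂ * b)).add_const c
  have hm : IsLocalMax (fun t : ℝ => unitRate A B (a + t * 1) (b + t * 0) -
      (l₁ * (a + t * 1) + l₂ * (b + t * 0) + c)) 0 := by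
    filter_upwards [Ioi_mem_nhds (show -a < 0 by linarith)] with t ht
    have ht' : -a < t := ht
    have := h (a + t * 1) (b + t * 0) (by linarith) (by linarith)
    simp only [zero_mul, add_zero]
    simp only [mul_zero, add_zero] at this ⊢
    linarith
  have := hm.hasDerivAt_eq_zero (d.sub d')
  simp only [add_zero, mul_zero, mul_one, zero_div, sub_zero] at this
  linarith

lemma unitRate_axis (A B a : ℝ) : unitRate A B a 0 = Real.log (1 + A * a) := by
  simp [unitRate]

/-- The best split of `(a, b)` into two exclusive bands is below an affine majorant. -/
lemma AffineMajorant.log_one_add_le (hA : 0 < A) (hB : 0 < B)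
    (h : AffineMajorant (unitRate A B) l₁ l₂ c) (ha : 0 ≤ a) (hb : 0 ≤ b) :
    Real.log (1 + A * a + B * b) ≤ l₁ * a + l₂ * b + c := by
  obtain ⟨z, hz⟩ : ∃ z, z = A * a + B * b := ⟨_, rfl⟩
  have hz0 : 0 ≤ z := by rw [hz]; positivity
  -- With `z = A a + B b > 0`, the point `(a, b)` is the mixture of `(z / A, 0)` and `(0, z / B)`
  -- with weights `A a / z` and `B b / z`, and the rate at both of these is `log (1 + z)`.
  have h1 := h (z / A) 0 (by positivity) le_rfl
  have h2 := h.swap_unitRate (z / B) 0 (by positivity) le_rfl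
  rw [unitRate_axis, mul_div_cancel₀ _ hA.ne'] at h1
  rw [unitRate_axis, mul_div_cancel₀ _ hB.ne'] at h2
  rw [add_assoc, ← hz]
  rcases hz0.eq_or_lt with h0 | h0
  · have hA0 : 0 ≤ A * a := by positivity
    have hB0 : 0 ≤ B * b := by positivity
    have ea : a = 0 := by
      have : A * a = 0 := by linarith
      simpa [hA.ne'] using this
    have eb : b = 0 := by
      have : B * b = 0 := by linarith
      simpa [hB.ne'] using this
    rw [ea, eb]
    rw [← h0] at h1 ⊢
    simpa using h1
  · have e1 := mul_le_mul_of_nonneg_left h1 (show 0 ≤ A * a / z by positivity)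
    have e2 := mul_le_mul_of_nonneg_left h2 (show 0 ≤ B * b / z by positivity)
    have e3 : A * a / z + B * b / z = 1 := by rw [← add_div, ← hz, div_self h0.ne']
    have e4 : A * a / z * (l₁ * (z / A) + l₂ * 0 + c) = l₁ * a + A * a / z * c := by
      field_simp
      ring
    have e5 : B * b / z * (l₂ * (z / B) + l₁ * 0 + c) = l₂ * b + B * b / z * c := by
      field_simp
      ring
    have e6 : Real.log (1 + z) = A * a / z * Real.log (1 + z) + B * b / z * Real.log (1 + z) := by
      rw [← add_mul, e3, one_mul]
    have e7 : c = A * a / z * c + B * b / z * c := by rw [← add_mul, e3, one_mul]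
    linarith

/-- At an interior touching point, sharing is strictly better than splitting. -/
lemma AffineMajorant.lt_mul_of_touch (hA : 0 < A) (hB : 0 < B)
    (h : AffineMajorant (unitRate A B) l₁ l₂ c) (ha : 0 < a) (hb : 0 < b)
    (e : unitRate A B a b = l₁ * a + l₂ * b + c) :
    A * (1 + a) + B * (1 + b) < A * B := by
  have hD := h.log_one_add_le hA hB ha.le hb.le
  have hX : 0 < 1 + A * a + b := by positivity
  have hY : 0 < 1 + a + B * b := by positivity
  have hU : 0 < 1 + b := by positivity
  have hV : 0 < 1 + a := by positivity
  have hDp : 0 < 1 + A * a + B * b := by positivity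
  have hF : unitRate A B a b =
      Real.log ((1 + A * a + b) * (1 + a + B * b)) - Real.log ((1 + b) * (1 + a)) := by
    rw [Real.log_mul hX.ne' hY.ne', Real.log_mul hU.ne' hV.ne']
    unfold unitRate
    ring
  have h1 : Real.log ((1 + A * a + B * b) * ((1 + b) * (1 + a))) ≤
      Real.log ((1 + A * a + b) * (1 + a + B * b)) := by
    rw [Real.log_mul hDp.ne' (by positivity)]
    linarith
  have h2 := (Real.log_le_log_iff (by positivity) (by positivity)).1 h1
  have h3 : 0 ≤ a * b * (A * B - A * (1 + a) - B * (1 + b)) := by linarith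
  have h4 : 0 ≤ A * B - A * (1 + a) - B * (1 + b) :=
    nonneg_of_mul_nonneg_right h3 (by positivity)
  -- In the equality case the value of splitting touches the majorant at `(a, b)` too, so its
  -- derivative in `a` is also `l₁`. Comparison with the derivative of the rate yields `A (1 + a) a
  -- b = 0`.
  rcases h4.eq_or_lt with h5 | h5
  · exfalso
    have hDe : Real.log (1 + A * a + B * b) = l₁ * a + l₂ * b + c := by
      rw [← e, hF, ← Real.log_div (by positivity) (by positivity)]
      congr 1
      rw [eq_div_iff (by positivity)]
      linear_combination (a * b) * h5
    have st := h.stationary_unitRate hA hB ha hb.le e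
    have d : HasDerivAt (fun t : ℝ => Real.log (1 + A * (a + t) + B * b))
        (A / (1 + A * a + B * b)) 0 := by
      have d1 : HasDerivAt (fun t : ℝ => 1 + A * (a + t) + B * b) A 0 := by
        simpa using
          ((((hasDerivAt_id (0 : ℝ)).const_add a).const_mul A).const_add 1).add_const (B * b)
      simpa using d1.log (by simpa using hDp.ne')
    have d' : HasDerivAt (fun t : ℝ => l₁ * (a + t) + l₂ * b + c) l₁ 0 := by
      simpa using ((((hasDerivAt_id (0 : ℝ)).const_add a).const_mul l₁).add_const
        (l₂ * b)).add_const c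
    have hm : IsLocalMax (fun t : ℝ => Real.log (1 + A * (a + t) + B * b) -
        (l₁ * (a + t) + l₂ * b + c)) 0 := by
      filter_upwards [Ioi_mem_nhds (show -a < 0 by linarith)] with t ht
      have ht' : -a < t := ht
      have := h.log_one_add_le hA hB (a := a + t) (b := b) (by linarith) hb.le
      simp only [add_zero]
      linarith
    have h6 := hm.hasDerivAt_eq_zero (d.sub d')
    rw [st] at h6
    field_simp at h6
    have h7 : A * B = A * (1 + a) + B * (1 + b) := by linarith
    have h8 : (1 + A * a + B * b) * ((1 + b) * (1 + a)) = (1 + A * a + b) * (1 + a + B * b) := by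
      linear_combination (a * b) * h5
    have h9 : A * (1 + a) ^ 2 * (1 + b) = A * (1 + a) * (1 + a + B * b)
        - B * b * (1 + A * a + b) := by
      have : (1 + A * a + B * b) * (A * (1 + a) ^ 2 * (1 + b) - (A * (1 + a) * (1 + a + B * b)
        - B * b * (1 + A * a + b))) = 0 := by
        linear_combination (A * (1 + a)) * h8 + h6
      have := (mul_eq_zero.1 this).resolve_left hDp.ne'
      linarith
    have h10 : A * (1 + a) * a * b = 0 := by
      linear_combination h9 + b * h7
    have : 0 < A * (1 + a) * a * b := by positivity
    linarith
  · linarith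

/-- If `c = 0`, the majorant touches at the origin and its slopes are at least those of the rate
there, namely `A` and `B`. But away from the origin the rate is strictly below `A a + B b`, since
`log (1 + u) < u`. -/
lemma AffineMajorant.const_pos (hA : 0 < A) (hB : 0 < B) (hl₁ : 0 < l₁) (hl₂ : 0 < l₂)
    (h : AffineMajorant (unitRate A B) l₁ l₂ c) (ha : 0 ≤ a) (hb : 0 ≤ b) (hab : 0 < a + b)
    (e : unitRate A B a b = l₁ * a + l₂ * b + c) : 0 < c := by
  have h0 := h 0 0 le_rfl le_rfl
  rw [unitRate_axis] at h0
  simp only [mul_zero, add_zero, Real.log_one, zero_add] at h0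
  rcases h0.eq_or_lt with hc | hc
  · exfalso
    have slope : ∀ {A' B' m₁ m₂ : ℝ}, 0 < A' → 0 < m₁ →
        AffineMajorant (unitRate A' B') m₁ m₂ c → A' ≤ m₁ := by
      intro A' B' m₁ m₂ hA' hm h'
      by_contra! hlt
      -- For this `t` the number `m₁ (1 + A' t)` is the midpoint of `m₁` and `A'`, while the
      -- majorant at `(t, 0)` forces it to be at least `A'`.
      obtain ⟨t, ht⟩ : ∃ t, t = (A' - m₁) / (2 * m₁ * A') := ⟨_, rfl⟩
      have ht0 : 0 < t := by
        rw [ht]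
        have : 0 < A' - m₁ := by linarith
        positivity
      have h1 := h' t 0 ht0.le le_rfl
      rw [unitRate_axis, ← hc] at h1
      have h2 := Real.one_sub_inv_le_log_of_pos (show 0 < 1 + A' * t by positivity)
      have h3 : 1 - (1 + A' * t)⁻¹ = A' * t / (1 + A' * t) := by field_simp; ring
      have h4 : A' * t / (1 + A' * t) ≤ m₁ * t := by linarith
      rw [div_le_iff₀ (by positivity)] at h4
      have h5 : A' ≤ m₁ * (1 + A' * t) := by
        have : t * A' ≤ t * (m₁ * (1 + A' * t)) := by linarith
        exact le_of_mul_le_mul_left this ht0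
      have h6 : m₁ * (A' * t) = (A' - m₁) / 2 := by rw [ht]; field_simp
      linarith
    have s1 := slope hA hl₁ h
    have s2 := slope hB hl₂ h.swap_unitRate
    have ub : ∀ {A' a' b' : ℝ}, 0 < A' → 0 ≤ a' → 0 ≤ b' →
        Real.log (1 + A' * a' + b') - Real.log (1 + b') ≤ A' * a' ∧
        (0 < a' → Real.log (1 + A' * a' + b') - Real.log (1 + b') < A' * a') := by
      intro A' a' b' hA' ha' hb'
      rw [← Real.log_div (by positivity) (by positivity)]
      have hle : (1 + A' * a' + b') / (1 + b') - 1 ≤ A' * a' := by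
        rw [div_sub_one (by positivity), div_le_iff₀ (by positivity)]
        have : 0 ≤ A' * a' * b' := by positivity
        linarith
      refine ⟨(Real.log_le_sub_one_of_pos (by positivity)).trans hle, fun hp => ?_⟩
      refine (Real.log_lt_sub_one_of_pos (by positivity) ?_).trans_le hle
      rw [Ne, div_eq_iff (by positivity)]
      have : 0 < A' * a' := by positivity
      intro h'
      linarith
    have u1 := ub hA ha hb
    have u2 := ub hB hb ha
    have e' : unitRate A B a b = (Real.log (1 + A * a + b) - Real.log (1 + b)) +
        (Real.log (1 + B * b + a) - Real.log (1 + a)) := by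
      unfold unitRate
      rw [add_right_comm 1 (B * b) a]
      ring
    have p1 : A * a ≤ l₁ * a := by gcongr
    have p2 : B * b ≤ l₂ * b := by gcongr
    rcases ha.eq_or_lt with ha0 | ha0
    · have := u2.2 (by linarith)
      linarith [u1.1]
    · have := u1.2 ha0
      linarith [u2.1]
  · exact hc

/-- On the segment between the two points the derivative of the gap to the majorant vanishes at both
ends, by stationarity, and at an interior point, by Rolle. The derivative of the rate is a
combination of two strictly convex functions with constant coefficients, and the signs of these
exclude three equal values. -/
lemma AffineMajorant.false_of_touch_descending (hA : 0 < A) (hB : 0 < B)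
    (h : AffineMajorant (unitRate A B) l₁ l₂ c) {a' b' : ℝ} (ha : 0 < a) (hb' : 0 < b')
    (haa : a < a') (hbb : b' < b) (e : unitRate A B a b = l₁ * a + l₂ * b + c)
    (e' : unitRate A B a' b' = l₁ * a' + l₂ * b' + c) : False := by
  have hb : 0 < b := hb'.trans hbb
  have ha' : 0 < a' := ha.trans haa
  have hR := h.lt_mul_of_touch hA hB ha hb e
  obtain ⟨u, hu⟩ : ∃ u, u = a' - a := ⟨_, rfl⟩
  obtain ⟨v, hv⟩ : ∃ v, v = b' - b := ⟨_, rfl⟩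
  have hu0 : 0 < u := by linarith
  have hv0 : v < 0 := by linarith
  have pa : ∀ t ∈ Set.Icc (0 : ℝ) 1, 0 ≤ a + t * u := fun t ht => by
    have := mul_nonneg ht.1 hu0.le
    linarith
  have pb : ∀ t ∈ Set.Icc (0 : ℝ) 1, 0 ≤ b + t * v := fun t ht => by
    have : (1 - t) * v ≤ 0 := mul_nonpos_of_nonneg_of_nonpos (by linarith [ht.2]) hv0.le
    linarith
  have dlin : ∀ t : ℝ, HasDerivAt (fun t => l₁ * (a + t * u) + l₂ * (b + t * v) + c)
      (l₁ * u + l₂ * v) t := fun t => by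
    have d1 : HasDerivAt (fun t : ℝ => a + t * u) u t := by
      simpa using ((hasDerivAt_id t).mul_const u).const_add a
    have d2 : HasDerivAt (fun t : ℝ => b + t * v) v t := by
      simpa using ((hasDerivAt_id t).mul_const v).const_add b
    exact ((d1.const_mul l₁).add (d2.const_mul l₂)).add_const c
  have dg : ∀ t ∈ Set.Icc (0 : ℝ) 1, HasDerivAt (fun t => unitRate A B (a + t * u) (b + t * v) -
      (l₁ * (a + t * u) + l₂ * (b + t * v) + c)) _ t := fun t ht =>
    (hasDerivAt_unitRate_line hA hB (pa t ht) (pb t ht)).sub (dlin t)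
  obtain ⟨s, hs, hs0⟩ := exists_hasDerivAt_eq_zero (one_pos : (0 : ℝ) < 1)
    (fun t ht => (dg t ht).continuousAt.continuousWithinAt)
    (by
      have e1 : a + 1 * u = a' := by rw [hu]; ring
      have e2 : b + 1 * v = b' := by rw [hv]; ring
      simp only [e1, e2, zero_mul, add_zero, e, e', sub_self])
    (fun t ht => dg t ⟨ht.1.le, ht.2.le⟩)
  -- For affine `X`, `V` the derivative of `log X - log V` is `(X' V - X V') / (X V)` with constant
  -- numerator. This numerator is `κ₂` for `X = 1 + A a + b`, `V = 1 + a`, and `-κ₁` for the pair `1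
  -- + a + B b`, `1 + b`.
  obtain ⟨κ₂, hκ₂⟩ : ∃ κ, κ = u * (A - (1 + b)) + v * (1 + a) := ⟨_, rfl⟩
  obtain ⟨κ₁, hκ₁⟩ : ∃ κ, κ = -(u * (1 + b) + v * (B - (1 + a))) := ⟨_, rfl⟩
  have slope : ∀ t ∈ Set.Icc (0 : ℝ) 1,
      (A * u + v) / (1 + A * (a + t * u) + (b + t * v)) - v / (1 + (b + t * v))
        + (u + B * v) / (1 + (a + t * u) + B * (b + t * v)) - u / (1 + (a + t * u)) =
      κ₂ * (1 / ((1 + A * (a + t * u) + (b + t * v)) * (1 + (a + t * u)))) -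
      κ₁ * (1 / ((1 + (a + t * u) + B * (b + t * v)) * (1 + (b + t * v)))) := by
    intro t ht
    have q1 := pa t ht
    have q2 := pb t ht
    have x1 : 1 + A * (a + t * u) + (b + t * v) ≠ 0 := by
      have := mul_nonneg hA.le q1
      linarith
    have x2 : 1 + (a + t * u) + B * (b + t * v) ≠ 0 := by
      have := mul_nonneg hB.le q2
      linarith
    have x3 : 1 + (b + t * v) ≠ 0 := by linarith
    have x4 : 1 + (a + t * u) ≠ 0 := by linarith
    have r1 : κ₂ = (A * u + v) * (1 + (a + t * u)) - (1 + A * (a + t * u) + (b + t * v)) * u := by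
      rw [hκ₂]; ring
    have r2 : κ₁ = -((u + B * v) * (1 + (b + t * v)) -
        (1 + (a + t * u) + B * (b + t * v)) * v) := by
      rw [hκ₁]; ring
    rw [mul_one_div, mul_one_div, r1, r2, neg_div, ← div_sub_div _ _ x1 x4,
      ← div_sub_div _ _ x2 x3]
    ring
  have st1 := h.stationary_unitRate hA hB ha hb.le e
  have st2 := h.swap_unitRate.stationary_unitRate hB hA hb ha.le
    (by rw [unitRate_swap, e]; ring)
  have st1' := h.stationary_unitRate hA hB ha' hb'.le e'
  have st2' := h.swap_unitRate.stationary_unitRate hB hA hb' ha'.le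
    (by rw [unitRate_swap, e']; ring)
  rw [add_right_comm 1 (B * b) a, add_right_comm 1 b (A * a)] at st2
  rw [add_right_comm 1 (B * b') a', add_right_comm 1 b' (A * a')] at st2'
  have k0 : κ₂ * (1 / ((1 + A * a + b) * (1 + a))) - κ₁ * (1 / ((1 + a + B * b) * (1 + b))) =
      l₁ * u + l₂ * v := by
    have := slope 0 ⟨le_rfl, zero_le_one⟩
    simp only [zero_mul, add_zero] at this
    rw [← this, st1, st2]
    ring
  have k1 : κ₂ * (1 / ((1 + A * a' + b') * (1 + a'))) -
      κ₁ * (1 / ((1 + a' + B * b') * (1 + b'))) = l₁ * u + l₂ * v := by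
    have := slope 1 ⟨zero_le_one, le_rfl⟩
    have e1 : a + 1 * u = a' := by rw [hu]; ring
    have e2 : b + 1 * v = b' := by rw [hv]; ring
    rw [e1, e2] at this
    rw [← this, st1', st2']
    ring
  have ks : κ₂ * (1 / (((1 - s) * (1 + A * a + b) + s * (1 + A * a' + b')) *
      ((1 - s) * (1 + a) + s * (1 + a')))) -
      κ₁ * (1 / (((1 - s) * (1 + a + B * b) + s * (1 + a' + B * b')) *
      ((1 - s) * (1 + b) + s * (1 + b')))) = l₁ * u + l₂ * v := by
    have h1 := slope s ⟨hs.1.le, hs.2.le⟩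
    rw [sub_eq_zero] at hs0
    rw [← hs0, h1, hu, hv]
    ring_nf
  have c1 := one_div_affine_mul_affine_lt (x₀ := 1 + A * a + b) (x₁ := 1 + A * a' + b')
    (v₀ := 1 + a) (v₁ := 1 + a') (by positivity) (by positivity) (by positivity) (by positivity)
    (by linarith) hs.1 hs.2
  have c2 := one_div_affine_mul_affine_lt (x₀ := 1 + a + B * b) (x₁ := 1 + a' + B * b')
    (v₀ := 1 + b) (v₁ := 1 + b') (by positivity) (by positivity) (by positivity) (by positivity)
    (by linarith) hs.1 hs.2
  rcases le_or_gt κ₁ 0 with g1 | g1 <;> rcases le_or_gt κ₂ 0 with g2 | g2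
  -- Both coefficients nonpositive: multiplying the two inequalities gives `A B ≤ A (1 + a) + B (1 +
  -- b)`, against `lt_mul_of_touch`.
  · have r1 : 0 < A - (1 + b) := by
      have : 0 < B * (A - (1 + b)) := by
        have : 0 < A * (1 + a) := by positivity
        linarith
      exact (pos_iff_pos_of_mul_pos this).1 hB
    have r2 : 0 < B - (1 + a) := by
      have : 0 < A * (B - (1 + a)) := by
        have : 0 < B * (1 + b) := by positivity
        linarith
      exact (pos_iff_pos_of_mul_pos this).1 hA
    have t1 : u * (A - (1 + b)) ≤ (-v) * (1 + a) := by linarith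
    have t2 : (-v) * (B - (1 + a)) ≤ u * (1 + b) := by linarith
    have hnv : 0 < -v := by linarith
    have t3 := mul_le_mul t1 t2 (by positivity) (by positivity)
    have t4 : 0 < (u * (-v)) * (A * B - (A * (1 + a) + B * (1 + b))) := by
      have : 0 < A * B - (A * (1 + a) + B * (1 + b)) := by linarith
      positivity
    linarith
  -- Opposite signs: the derivative is strictly convex here and strictly concave in the next case,
  -- so it cannot take one value at `0`, `s` and `1`.
  · have t1 := mul_lt_mul_of_pos_left c1 g2
    have t2 := mul_le_mul_of_nonneg_left c2.le (show 0 ≤ -κ₁ by linarith)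
    have t0 : (1 - s) * (l₁ * u + l₂ * v) + s * (l₁ * u + l₂ * v) = l₁ * u + l₂ * v := by ring
    rw [← ks] at t0
    nth_rw 1 [ks] at t0
    nth_rw 1 [ks] at t0
    nth_rw 1 [← k0] at t0
    rw [← k1] at t0
    linarith
  · have t1 := mul_le_mul_of_nonneg_left c1.le (show 0 ≤ -κ₂ by linarith)
    have t2 := mul_lt_mul_of_pos_left c2 g1
    have t0 : (1 - s) * (l₁ * u + l₂ * v) + s * (l₁ * u + l₂ * v) = l₁ * u + l₂ * v := by ring
    rw [← ks] at t0
    nth_rw 1 [ks] at t0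
    nth_rw 1 [ks] at t0
    nth_rw 1 [← k0] at t0
    rw [← k1] at t0
    linarith
  -- Both coefficients positive: the denominator of the first fraction is larger at the end of the
  -- segment than at its start and that of the second is smaller. So the derivative is smaller at
  -- the end, although the two values should agree.
  · have x1 : 0 < A * u + v := by
      have h1 : κ₂ = (A * u + v) * (1 + a) - u * (1 + A * a + b) := by rw [hκ₂]; ring
      have h2 : 0 < u * (1 + A * a + b) := by positivity
      exact (pos_iff_pos_of_mul_pos (show 0 < (A * u + v) * (1 + a) by linarith)).2
        (by positivity)
    have y1 : u + B * v < 0 := by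
      have h1 : κ₁ = (-v) * (1 + a + B * b) * (-1) + (-(u + B * v)) * (1 + b) := by rw [hκ₁]; ring
      have h2 : 0 < (-v) * (1 + a + B * b) := mul_pos (by linarith) (by positivity)
      have := (pos_iff_pos_of_mul_pos (show 0 < (-(u + B * v)) * (1 + b) by linarith)).2
        (by positivity)
      linarith
    have p1 : 1 / ((1 + A * a' + b') * (1 + a')) < 1 / ((1 + A * a + b) * (1 + a)) := by
      apply one_div_lt_one_div_of_lt (by positivity)
      apply mul_lt_mul'' _ (by linarith) (by positivity) (by positivity)
      rw [hu, hv] at x1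
      linarith
    have p2 : 1 / ((1 + a + B * b) * (1 + b)) < 1 / ((1 + a' + B * b') * (1 + b')) := by
      apply one_div_lt_one_div_of_lt (by positivity)
      apply mul_lt_mul'' _ (by linarith) (by positivity) (by positivity)
      rw [hu, hv] at y1
      linarith
    have t1 := mul_lt_mul_of_pos_left p1 g2
    have t2 := mul_lt_mul_of_pos_left p2 g1
    linarith

/-- An affine majorant touches the rate function at most once in the open quadrant. -/
lemma AffineMajorant.touch_unique (hA : 0 < A) (hB : 0 < B) (hl₁ : 0 < l₁) (hl₂ : 0 < l₂)
    (h : AffineMajorant (unitRate A B) l₁ l₂ c) {a' b' : ℝ} (ha : 0 < a) (hb : 0 < b)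
    (ha' : 0 < a') (hb' : 0 < b') (e : unitRate A B a b = l₁ * a + l₂ * b + c)
    (e' : unitRate A B a' b' = l₁ * a' + l₂ * b' + c) : a = a' ∧ b = b' := by
  have key : ∀ {x y x' y' : ℝ}, 0 < x → 0 < y → x ≤ x' → y ≤ y' → (x < x' ∨ y < y') →
      unitRate A B x y = l₁ * x + l₂ * y + c → unitRate A B x' y' = l₁ * x' + l₂ * y' + c →
      False := by
    intro x y x' y' hx hy hxx hyy hlt e e'
    have hx' : 0 < x' := by linarith
    have hy' : 0 < y' := by linarith
    -- In this combination of the two first order conditions the terms with denominator `1 + x + B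
    -- y` sum to `1`. Since `A > 1`, the right side strictly decreases from the smaller to the
    -- larger of two comparable points, while the left side does not.
    have ident : ∀ {x y : ℝ}, 0 < x → 0 < y → unitRate A B x y = l₁ * x + l₂ * y + c →
        (1 + x) * l₁ + y * l₂ = 1 / (1 + y) + (A - 1) * (1 / (1 + A * x + y)) := by
      intro x y hx hy e
      have st1 := h.stationary_unitRate hA hB hx hy.le e
      have st2 := h.swap_unitRate.stationary_unitRate hB hA hy hx.le
        (by rw [unitRate_swap, e]; ring)
      rw [add_right_comm 1 (B * y) x, add_right_comm 1 y (A * x)] at st2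
      rw [st1, st2]
      field_simp
      ring
    have i1 := ident hx hy e
    have i2 := ident hx' hy' e'
    have hA1 : 0 < A - 1 := by
      have hR := h.lt_mul_of_touch hA hB hx hy e
      have : 0 < B * (A - 1) := by
        have : 0 < A * (1 + x) := by positivity
        have : 0 < B * y := by positivity
        linarith
      exact (pos_iff_pos_of_mul_pos this).1 hB
    have hX : 1 + A * x + y < 1 + A * x' + y' := by
      rcases hlt with hlt | hlt
      · have := mul_lt_mul_of_pos_left hlt hA
        linarith
      · have := mul_le_mul_of_nonneg_left hxx hA.le
        linarith
    have j1 := one_div_lt_one_div_of_lt (by positivity) hX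
    have j2 := one_div_le_one_div_of_le (show 0 < 1 + y by positivity)
      (show 1 + y ≤ 1 + y' by linarith)
    have j3 := mul_lt_mul_of_pos_left j1 hA1
    have j4 := mul_le_mul_of_nonneg_right hxx hl₁.le
    have j5 := mul_le_mul_of_nonneg_right hyy hl₂.le
    linarith
  rcases lt_trichotomy a a' with h1 | h1 | h1 <;> rcases lt_trichotomy b b' with h2 | h2 | h2
  · exact (key ha hb h1.le h2.le (Or.inl h1) e e').elim
  · exact (key ha hb h1.le h2.le (Or.inl h1) e e').elim
  · exact (h.false_of_touch_descending hA hB ha hb' h1 h2 e e').elim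
  · exact (key ha hb h1.le h2.le (Or.inr h2) e e').elim
  · exact ⟨h1, h2⟩
  · exact (key ha' hb' h1.ge h2.le (Or.inr h2) e' e).elim
  · exact (h.false_of_touch_descending hA hB ha' hb h1 h2 e' e).elim
  · exact (key ha' hb' h1.le h2.ge (Or.inl h1) e' e).elim
  · exact (key ha' hb' h1.le h2.le (Or.inl h1) e' e).elim

end UnitRate

/-! ### Duality for mixtures of points of a quadrant -/

/-- Points of the closed quadrant at which `f` equals `l₁ a + l₂ b + c`. -/
def touchSet (f : ℝ → ℝ → ℝ) (l₁ l₂ c : ℝ) : Set (ℝ × ℝ) :=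
  {p | 0 ≤ p.1 ∧ 0 ≤ p.2 ∧ f p.1 p.2 = l₁ * p.1 + l₂ * p.2 + c}

section Duality

variable {f : ℝ → ℝ → ℝ} {m₁ m₂ : ℝ}

/-- The affine majorant with the smallest value at `(m₁, m₂)`. -/
lemma exists_affineMajorant_min (hm₁ : 0 < m₁) (hm₂ : 0 < m₂) (h0 : f 0 0 = 0)
    (hsub : ∀ η > 0, ∃ K, ∀ a b, 0 ≤ a → 0 ≤ b → f a b ≤ η * (a + b) + K)
    (hax₁ : ∀ K, ∃ a, 0 ≤ a ∧ K < f a 0) (hax₂ : ∀ K, ∃ b, 0 ≤ b ∧ K < f 0 b) :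
    ∃ l₁ l₂ c, 0 < l₁ ∧ 0 < l₂ ∧ AffineMajorant f l₁ l₂ c ∧
      ∀ l₁' l₂' c', 0 ≤ l₁' → 0 ≤ l₂' → AffineMajorant f l₁' l₂' c' →
        l₁ * m₁ + l₂ * m₂ + c ≤ l₁' * m₁ + l₂' * m₂ + c' := by
  obtain ⟨K, hK⟩ := hsub 1 one_pos
  -- `φ₀` is the value at `(m₁, m₂)` of the majorant `a + b + K`. Below this level the coefficients
  -- are bounded, because all three are nonnegative and `m₁`, `m₂` are positive.
  obtain ⟨φ₀, hφ₀⟩ : ∃ φ₀, φ₀ = m₁ + m₂ + K := ⟨_, rfl⟩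
  let E : Set (ℝ × ℝ × ℝ) := {x | 0 ≤ x.1 ∧ 0 ≤ x.2.1 ∧ AffineMajorant f x.1 x.2.1 x.2.2}
  have hEc : IsClosed E := by
    have : E = {x | 0 ≤ x.1} ∩ ({x | 0 ≤ x.2.1} ∩ ⋂ (a : ℝ) (b : ℝ) (_ : 0 ≤ a) (_ : 0 ≤ b),
        {x : ℝ × ℝ × ℝ | f a b ≤ x.1 * a + x.2.1 * b + x.2.2}) := by
      ext x
      simp [E, AffineMajorant]
    rw [this]
    refine (isClosed_le (by fun_prop) (by fun_prop)).inter
      ((isClosed_le (by fun_prop) (by fun_prop)).inter ?_)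
    exact isClosed_iInter fun a => isClosed_iInter fun b => isClosed_iInter fun _ =>
      isClosed_iInter fun _ => isClosed_le (by fun_prop) (by fun_prop)
  have hc0 : ∀ x ∈ E, 0 ≤ x.2.2 := by
    rintro x ⟨-, -, h⟩
    have := h 0 0 le_rfl le_rfl
    rw [h0] at this
    linarith
  let F : Set (ℝ × ℝ × ℝ) := E ∩ {x | x.1 * m₁ + x.2.1 * m₂ + x.2.2 ≤ φ₀}
  have hF : IsCompact F := by
    refine (isCompact_Icc (a := ((0 : ℝ), (0 : ℝ), (0 : ℝ)))
      (b := (φ₀ / m₁, φ₀ / m₂, φ₀))).of_isClosed_subset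
      (hEc.inter (isClosed_le (by fun_prop) (by fun_prop))) ?_
    rintro x ⟨hx, hx'⟩
    have h3 := hc0 x hx
    have h1 := mul_nonneg hx.1 hm₁.le
    have h2 := mul_nonneg hx.2.1 hm₂.le
    have hx'' : x.1 * m₁ + x.2.1 * m₂ + x.2.2 ≤ φ₀ := hx'
    refine ⟨⟨hx.1, hx.2.1, h3⟩, ⟨?_, ?_, ?_⟩⟩
    · exact (le_div_iff₀ hm₁).2 (by linarith)
    · exact (le_div_iff₀ hm₂).2 (by linarith)
    · change x.2.2 ≤ φ₀
      linarith
  have hne : ((1 : ℝ), (1 : ℝ), K) ∈ F := by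
    refine ⟨⟨zero_le_one, zero_le_one, fun a b ha hb => ?_⟩, ?_⟩
    · have := hK a b ha hb
      simp only
      linarith
    · simp [hφ₀]
  obtain ⟨x, hxF, hmin⟩ := hF.exists_isMinOn ⟨_, hne⟩
    (f := fun x : ℝ × ℝ × ℝ => x.1 * m₁ + x.2.1 * m₂ + x.2.2) (by fun_prop)
  obtain ⟨⟨hx1, hx2, hx3⟩, hxφ⟩ := hxF
  refine ⟨x.1, x.2.1, x.2.2, ?_, ?_, hx3, ?_⟩
  · refine hx1.lt_of_ne fun h => ?_
    obtain ⟨a, ha, ha'⟩ := hax₁ x.2.2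
    have := hx3 a 0 ha le_rfl
    rw [← h] at this
    linarith
  · refine hx2.lt_of_ne fun h => ?_
    obtain ⟨b, hb, hb'⟩ := hax₂ x.2.2
    have := hx3 0 b le_rfl hb
    rw [← h] at this
    linarith
  · intro l₁' l₂' c' h1 h2 h3
    by_cases h : l₁' * m₁ + l₂' * m₂ + c' ≤ φ₀
    · exact hmin (show (l₁', l₂', c') ∈ F from ⟨⟨h1, h2, h3⟩, h⟩)
    · have : x.1 * m₁ + x.2.1 * m₂ + x.2.2 ≤ φ₀ := hxφ
      linarith

/-- Strong duality for the division of resources: `(m₁, m₂)` is a mixture of points at which a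
suitable affine majorant touches `f`. -/
theorem exists_affineMajorant_mem_convexHull (hm₁ : 0 < m₁) (hm₂ : 0 < m₂) (h0 : f 0 0 = 0)
    (hcont : ContinuousOn (fun p : ℝ × ℝ => f p.1 p.2) {p | 0 ≤ p.1 ∧ 0 ≤ p.2})
    (hsub : ∀ η > 0, ∃ K, ∀ a b, 0 ≤ a → 0 ≤ b → f a b ≤ η * (a + b) + K)
    (hax₁ : ∀ K, ∃ a, 0 ≤ a ∧ K < f a 0) (hax₂ : ∀ K, ∃ b, 0 ≤ b ∧ K < f 0 b)
    (hfin : ∀ l₁ l₂ c, 0 < l₁ → 0 < l₂ → AffineMajorant f l₁ l₂ c →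
      (touchSet f l₁ l₂ c).Finite) :
    ∃ l₁ l₂ c, 0 < l₁ ∧ 0 < l₂ ∧ AffineMajorant f l₁ l₂ c ∧
      (m₁, m₂) ∈ convexHull ℝ (touchSet f l₁ l₂ c) := by
  obtain ⟨l₁, l₂, c, hl₁, hl₂, hmaj, hmin⟩ :=
    exists_affineMajorant_min hm₁ hm₂ h0 hsub hax₁ hax₂
  refine ⟨l₁, l₂, c, hl₁, hl₂, hmaj, ?_⟩
  by_contra hnot
  -- Finiteness of the touching set makes its hull closed. A functional separating `(m₁, m₂)` from
  -- it shows how to tilt the majorant so that its value at `(m₁, m₂)` drops.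
  obtain ⟨φ, u, hφ, hu⟩ := geometric_hahn_banach_closed_point (convex_convexHull ℝ _)
    ((hfin l₁ l₂ c hl₁ hl₂ hmaj).isClosed_convexHull ℝ) hnot
  obtain ⟨v₁, hv₁⟩ : ∃ v, v = φ (1, 0) := ⟨_, rfl⟩
  obtain ⟨v₂, hv₂⟩ : ∃ v, v = φ (0, 1) := ⟨_, rfl⟩
  have hφv : ∀ p : ℝ × ℝ, φ p = v₁ * p.1 + v₂ * p.2 := by
    intro p
    have : p = p.1 • ((1 : ℝ), (0 : ℝ)) + p.2 • ((0 : ℝ), (1 : ℝ)) := by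
      ext <;> simp
    conv_lhs => rw [this]
    rw [map_add, map_smul, map_smul, ← hv₁, ← hv₂, smul_eq_mul, smul_eq_mul]
    ring
  obtain ⟨η, hη0, hη1, hη2⟩ : ∃ η > 0, 2 * η ≤ l₁ ∧ 2 * η ≤ l₂ :=
    ⟨min l₁ l₂ / 2, by positivity, by linarith [min_le_left l₁ l₂],
      by linarith [min_le_right l₁ l₂]⟩
  obtain ⟨η', hη'⟩ : ∃ η', η' = η / 2 := ⟨_, rfl⟩
  obtain ⟨K, hK⟩ := hsub η' (by linarith)
  -- The tilted slopes stay at least `η = 2 η'`, while `f` grows at most with slope `η'`. Beyond `R`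
  -- the difference `η' (a + b)` absorbs all constants.
  obtain ⟨R, hR⟩ : ∃ R, R = (|K| + |c| + |u|) / η' := ⟨_, rfl⟩
  have hη'0 : 0 < η' := by linarith
  let K₁ : Set (ℝ × ℝ) := Set.Icc (0, 0) (R, R) ∩ {p | u ≤ v₁ * p.1 + v₂ * p.2}
  have hK₁ : IsCompact K₁ := isCompact_Icc.inter_right (isClosed_le (by fun_prop) (by fun_prop))
  -- the gap on the part of the box on which the perturbation increases the excess
  obtain ⟨g, hg0, hg⟩ : ∃ g > 0, ∀ p ∈ K₁, f p.1 p.2 ≤ l₁ * p.1 + l₂ * p.2 + c - g := by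
    rcases K₁.eq_empty_or_nonempty with hemp | hne
    · exact ⟨1, one_pos, fun p hp => by simp [hemp] at hp⟩
    · have hco : ContinuousOn (fun p : ℝ × ℝ => f p.1 p.2 - (l₁ * p.1 + l₂ * p.2 + c)) K₁ :=
        (hcont.mono fun p hp => ⟨hp.1.1.1, hp.1.1.2⟩).sub (by fun_prop)
      obtain ⟨q, hq, hqmax⟩ := hK₁.exists_isMaxOn hne hco
      have hq1 : 0 ≤ q.1 := hq.1.1.1
      have hq2 : 0 ≤ q.2 := hq.1.1.2
      refine ⟨l₁ * q.1 + l₂ * q.2 + c - f q.1 q.2, ?_, fun p hp => ?_⟩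
      · have h1 := hmaj q.1 q.2 hq1 hq2
        have h2 : f q.1 q.2 ≠ l₁ * q.1 + l₂ * q.2 + c := by
          intro h
          have := hφ q (subset_convexHull ℝ _ ⟨hq1, hq2, h⟩)
          rw [hφv] at this
          have := hq.2
          simp only [Set.mem_ofPred_eq] at this
          linarith
        have := lt_of_le_of_ne h1 h2
        simp only [gt_iff_lt]
        linarith
      · have : f p.1 p.2 - (l₁ * p.1 + l₂ * p.2 + c) ≤ f q.1 q.2 - (l₁ * q.1 + l₂ * q.2 + c) :=
          hqmax hp
        linarith
  have hR0 : 0 ≤ R := by rw [hR]; positivity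
  obtain ⟨M, hM⟩ : ∃ M, M = |v₁| * R + |v₂| * R + |u| := ⟨_, rfl⟩
  have hM0 : 0 ≤ M := by rw [hM]; positivity
  -- The bounds serve, in order, to control `t u`, to keep the tilt below the gap `g` on `K₁`, and
  -- to keep the new slopes above `η`.
  obtain ⟨t, ht⟩ : ∃ t, t = min 1 (min (g / (M + 1)) (η / (|v₁| + |v₂| + 1))) := ⟨_, rfl⟩
  have ht0 : 0 < t := by
    rw [ht]
    have : 0 < M + 1 := by linarith
    positivity
  have ht1 : t ≤ 1 := by rw [ht]; exact min_le_left _ _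
  have htg : t * M ≤ g := by
    have : t ≤ g / (M + 1) := by
      rw [ht]
      exact (min_le_right _ _).trans (min_le_left _ _)
    rw [le_div_iff₀ (by linarith)] at this
    linarith
  have htv : t * (|v₁| + |v₂|) ≤ η := by
    have : t ≤ η / (|v₁| + |v₂| + 1) := by
      rw [ht]
      exact (min_le_right _ _).trans (min_le_right _ _)
    rw [le_div_iff₀ (by positivity)] at this
    linarith
  have htv₁ : t * v₁ ≤ η := by
    have h1 := mul_le_mul_of_nonneg_left (le_abs_self v₁) ht0.le
    have h2 := mul_nonneg ht0.le (abs_nonneg v₂)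
    linarith
  have htv₂ : t * v₂ ≤ η := by
    have h1 := mul_le_mul_of_nonneg_left (le_abs_self v₂) ht0.le
    have h2 := mul_nonneg ht0.le (abs_nonneg v₁)
    linarith
  have hnew : AffineMajorant f (l₁ - t * v₁) (l₂ - t * v₂) (c + t * u) := by
    intro a b ha hb
    have hab := hmaj a b ha hb
    -- Where the functional is at most `u` the tilt only raises the majorant. Elsewhere the gap
    -- covers the box and the growth of `f` the rest.
    rcases le_total (v₁ * a + v₂ * b) u with h | h
    · have := mul_le_mul_of_nonneg_left h ht0.le
      linarith
    · by_cases hbox : a ≤ R ∧ b ≤ R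
      · have h1 := hg (a, b) ⟨⟨⟨ha, hb⟩, ⟨hbox.1, hbox.2⟩⟩, h⟩
        simp only at h1
        have h2 : v₁ * a ≤ |v₁| * R :=
          (mul_le_mul_of_nonneg_right (le_abs_self v₁) ha).trans
            (mul_le_mul_of_nonneg_left hbox.1 (abs_nonneg _))
        have h3 : v₂ * b ≤ |v₂| * R :=
          (mul_le_mul_of_nonneg_right (le_abs_self v₂) hb).trans
            (mul_le_mul_of_nonneg_left hbox.2 (abs_nonneg _))
        have h4 : v₁ * a + v₂ * b - u ≤ M := by
          have := neg_abs_le u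
          linarith
        have := mul_le_mul_of_nonneg_left h4 ht0.le
        linarith
      · have h1 : R ≤ a + b := by
          by_contra! h'
          exact hbox ⟨by linarith, by linarith⟩
        have h2 : |K| + |c| + |u| ≤ η' * (a + b) := by
          rw [hR, div_le_iff₀ hη'0] at h1
          linarith
        have h3 := hK a b ha hb
        have h4 : η * a ≤ (l₁ - t * v₁) * a := mul_le_mul_of_nonneg_right (by linarith) ha
        have h5 : η * b ≤ (l₂ - t * v₂) * b := mul_le_mul_of_nonneg_right (by linarith) hb
        have h6 : -|u| ≤ t * u := by
          have h7 := mul_le_mul_of_nonneg_left (neg_abs_le u) ht0.le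
          have h8 := mul_le_mul_of_nonneg_right ht1 (abs_nonneg u)
          linarith
        have h7 := le_abs_self K
        have h8 := neg_abs_le c
        have h9 : η * (a + b) = η' * (a + b) + η' * (a + b) := by rw [hη']; ring
        linarith
  have h1 := hmin _ _ _ (by linarith) (by linarith) hnew
  rw [hφv] at hu
  have h2 := mul_lt_mul_of_pos_left hu ht0
  simp only at h2
  linarith

end Duality

/-! ### Rate of the channel and first order conditions at touching points -/

/-- Total rate of both users per unit of bandwidth at the densities `x`, `y`. -/
noncomputable def rate (ch : FlatChannel) (x y : ℝ) : ℝ :=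
  Real.log (1 + x * ch.h₁₁ / (y * ch.h₂₁ + ch.N₁)) +
    Real.log (1 + y * ch.h₂₂ / (x * ch.h₁₂ + ch.N₂))

namespace TwoUserSAPD.FlatChannel

/-- The channel with the two users exchanged. -/
def swap (ch : FlatChannel) : FlatChannel where
  W := ch.W
  P₁ := ch.P₂
  P₂ := ch.P₁
  N₁ := ch.N₂
  N₂ := ch.N₁
  h₁₁ := ch.h₂₂
  h₁₂ := ch.h₂₁
  h₂₁ := ch.h₁₂
  h₂₂ := ch.h₁₁
  W_pos := ch.W_pos
  P₁_pos := ch.P₂_pos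
  P₂_pos := ch.P₁_pos
  N₁_pos := ch.N₂_pos
  N₂_pos := ch.N₁_pos
  h₁₁_pos := ch.h₂₂_pos
  h₁₂_pos := ch.h₂₁_pos
  h₂₁_pos := ch.h₁₂_pos
  h₂₂_pos := ch.h₁₁_pos

/-- Direct gain of user 1 in units of noise and cross gains. -/
noncomputable def gain (ch : FlatChannel) : ℝ := ch.h₁₁ * ch.N₂ / (ch.N₁ * ch.h₁₂)

lemma gain_pos (ch : FlatChannel) : 0 < ch.gain := by
  have := ch.h₁₁_pos
  have := ch.N₂_pos
  have := ch.N₁_pos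
  have := ch.h₁₂_pos
  unfold gain
  positivity

end TwoUserSAPD.FlatChannel

section Rate

variable {ch : FlatChannel} {l₁ l₂ c x y : ℝ}

lemma rate_swap (ch : FlatChannel) (x y : ℝ) : rate ch.swap y x = rate ch x y := by
  unfold rate FlatChannel.swap
  exact add_comm _ _

lemma rate_axis (ch : FlatChannel) (x : ℝ) : rate ch x 0 = Real.log (1 + x * ch.h₁₁ / ch.N₁) := by
  simp [rate]

/-- Measuring each density by the interference it causes, relative to the noise at the other
receiver, leaves only the two normalised direct gains. -/
lemma rate_eq_unitRate (ch : FlatChannel) (hx : 0 ≤ x) (hy : 0 ≤ y) :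
    rate ch x y = unitRate ch.gain ch.swap.gain (x * ch.h₁₂ / ch.N₂) (y * ch.h₂₁ / ch.N₁) := by
  have h1 := ch.h₁₁_pos
  have h2 := ch.N₂_pos
  have h3 := ch.N₁_pos
  have h4 := ch.h₁₂_pos
  have h5 := ch.h₂₁_pos
  have h6 := ch.h₂₂_pos
  have g1 := ch.gain_pos
  have g2 := ch.swap.gain_pos
  unfold unitRate
  rw [← Real.log_div (by positivity) (by positivity), add_sub_assoc,
    ← Real.log_div (by positivity) (by positivity)]
  unfold rate FlatChannel.gain FlatChannel.swap
  congr 2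
  · field_simp
    ring
  · field_simp
    ring

lemma AffineMajorant.unitRate_of_rate (h : AffineMajorant (rate ch) l₁ l₂ c) :
    AffineMajorant (unitRate ch.gain ch.swap.gain) (l₁ * (ch.N₂ / ch.h₁₂)) (l₂ * (ch.N₁ / ch.h₂₁))
      c := by
  intro a b ha hb
  have h2 := ch.N₂_pos
  have h3 := ch.N₁_pos
  have h4 := ch.h₁₂_pos
  have h5 := ch.h₂₁_pos
  have hx : 0 ≤ a * ch.N₂ / ch.h₁₂ := by positivity
  have hy : 0 ≤ b * ch.N₁ / ch.h₂₁ := by positivity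
  have := h _ _ hx hy
  rw [rate_eq_unitRate ch hx hy] at this
  have e1 : a * ch.N₂ / ch.h₁₂ * ch.h₁₂ / ch.N₂ = a := by field_simp
  have e2 : b * ch.N₁ / ch.h₂₁ * ch.h₂₁ / ch.N₁ = b := by field_simp
  rw [e1, e2] at this
  convert this using 1
  ring

lemma unitRate_touch_of_rate_touch (hx : 0 ≤ x) (hy : 0 ≤ y)
    (e : rate ch x y = l₁ * x + l₂ * y + c) :
    unitRate ch.gain ch.swap.gain (x * ch.h₁₂ / ch.N₂) (y * ch.h₂₁ / ch.N₁) =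
      l₁ * (ch.N₂ / ch.h₁₂) * (x * ch.h₁₂ / ch.N₂) +
        l₂ * (ch.N₁ / ch.h₂₁) * (y * ch.h₂₁ / ch.N₁) + c := by
  have h2 := ch.N₂_pos
  have h3 := ch.N₁_pos
  have h4 := ch.h₁₂_pos
  have h5 := ch.h₂₁_pos
  rw [← rate_eq_unitRate ch hx hy, e]
  field_simp

lemma AffineMajorant.swap_rate (h : AffineMajorant (rate ch) l₁ l₂ c) :
    AffineMajorant (rate ch.swap) l₂ l₁ c := by
  intro a b ha hb
  rw [rate_swap]
  linarith [h b a hb ha]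

lemma rate_touch_swap (e : rate ch x y = l₁ * x + l₂ * y + c) :
    rate ch.swap y x = l₂ * y + l₁ * x + c := by
  rw [rate_swap, e, add_comm (l₁ * x)]

/-- First order condition for user 1 at a touching point. -/
lemma AffineMajorant.stationary_rate (h : AffineMajorant (rate ch) l₁ l₂ c) (hx : 0 < x)
    (hy : 0 ≤ y) (e : rate ch x y = l₁ * x + l₂ * y + c) :
    l₁ = ch.h₁₁ / (ch.N₁ + ch.h₁₁ * x + ch.h₂₁ * y) -
      ch.h₁₂ * ch.h₂₂ * y / ((ch.N₂ + ch.h₁₂ * x) * (ch.N₂ + ch.h₁₂ * x + ch.h₂₂ * y)) := by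
  have h1 := ch.h₁₁_pos
  have h2 := ch.N₂_pos
  have h3 := ch.N₁_pos
  have h4 := ch.h₁₂_pos
  have h5 := ch.h₂₁_pos
  have h6 := ch.h₂₂_pos
  have st := h.unitRate_of_rate.stationary_unitRate ch.gain_pos ch.swap.gain_pos
    (show 0 < x * ch.h₁₂ / ch.N₂ by positivity) (show 0 ≤ y * ch.h₂₁ / ch.N₁ by positivity)
    (unitRate_touch_of_rate_touch hx.le hy e)
  have e1 : l₁ = l₁ * (ch.N₂ / ch.h₁₂) * (ch.h₁₂ / ch.N₂) := by field_simp
  rw [e1, st]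
  unfold FlatChannel.gain FlatChannel.swap
  simp only
  have x1 : 0 < ch.N₁ + ch.h₁₁ * x + ch.h₂₁ * y := by positivity
  have x2 : 0 < ch.N₂ + ch.h₁₂ * x := by positivity
  have x3 : 0 < ch.N₂ + ch.h₁₂ * x + ch.h₂₂ * y := by positivity
  have f1 : 1 + ch.h₁₁ * ch.N₂ / (ch.N₁ * ch.h₁₂) * (x * ch.h₁₂ / ch.N₂) + y * ch.h₂₁ / ch.N₁ =
      (ch.N₁ + ch.h₁₁ * x + ch.h₂₁ * y) / ch.N₁ := by field_simp
  have f2 : 1 + x * ch.h₁₂ / ch.N₂ + ch.h₂₂ * ch.N₁ / (ch.N₂ * ch.h₂₁) * (y * ch.h₂₁ / ch.N₁) =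
      (ch.N₂ + ch.h₁₂ * x + ch.h₂₂ * y) / ch.N₂ := by field_simp
  have f3 : 1 + x * ch.h₁₂ / ch.N₂ = (ch.N₂ + ch.h₁₂ * x) / ch.N₂ := by field_simp
  rw [f1, f2, f3]
  generalize ch.N₁ + ch.h₁₁ * x + ch.h₂₁ * y = X at *
  have x4 : ch.h₂₂ * y = (ch.N₂ + ch.h₁₂ * x + ch.h₂₂ * y) - (ch.N₂ + ch.h₁₂ * x) := by ring
  rw [mul_assoc ch.h₁₂, x4]
  generalize ch.N₂ + ch.h₁₂ * x + ch.h₂₂ * y = Y at *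
  generalize ch.N₂ + ch.h₁₂ * x = V at *
  have x5 : ch.h₁₂ * (Y - V) / (V * Y) = ch.h₁₂ / V - ch.h₁₂ / Y := by
    rw [div_sub_div _ _ x2.ne' x3.ne']
    ring
  rw [add_sub_cancel, x5]
  field_simp
  ring

lemma AffineMajorant.rate_touch_unique (hl₁ : 0 < l₁) (hl₂ : 0 < l₂)
    (h : AffineMajorant (rate ch) l₁ l₂ c) {x' y' : ℝ} (hx : 0 < x) (hy : 0 < y) (hx' : 0 < x')
    (hy' : 0 < y') (e : rate ch x y = l₁ * x + l₂ * y + c)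
    (e' : rate ch x' y' = l₁ * x' + l₂ * y' + c) : x = x' ∧ y = y' := by
  have h2 := ch.N₂_pos
  have h3 := ch.N₁_pos
  have h4 := ch.h₁₂_pos
  have h5 := ch.h₂₁_pos
  have := h.unitRate_of_rate.touch_unique ch.gain_pos ch.swap.gain_pos (by positivity)
    (by positivity) (by positivity) (by positivity) (by positivity) (by positivity)
    (unitRate_touch_of_rate_touch hx.le hy.le e) (unitRate_touch_of_rate_touch hx'.le hy'.le e')
  obtain ⟨e1, e2⟩ := this
  field_simp at e1 e2
  exact ⟨e1, e2⟩

lemma AffineMajorant.rate_const_pos (hl₁ : 0 < l₁) (hl₂ : 0 < l₂)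
    (h : AffineMajorant (rate ch) l₁ l₂ c) (hx : 0 ≤ x) (hy : 0 ≤ y) (hxy : 0 < x + y)
    (e : rate ch x y = l₁ * x + l₂ * y + c) : 0 < c := by
  have h2 := ch.N₂_pos
  have h3 := ch.N₁_pos
  have h4 := ch.h₁₂_pos
  have h5 := ch.h₂₁_pos
  refine h.unitRate_of_rate.const_pos ch.gain_pos ch.swap.gain_pos (by positivity)
    (by positivity) (by positivity) (by positivity) ?_ (unitRate_touch_of_rate_touch hx hy e)
  rcases hx.eq_or_lt with h0 | h0
  · have : 0 < y := by linarith
    positivity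
  · positivity

/-- The slope of the majorant at an exclusive touching point. -/
lemma AffineMajorant.slope_of_axis (h : AffineMajorant (rate ch) l₁ l₂ c) (hx : 0 < x)
    (e : rate ch x 0 = l₁ * x + l₂ * 0 + c) : l₁ = ch.h₁₁ / (ch.N₁ + ch.h₁₁ * x) := by
  simpa using h.stationary_rate hx le_rfl e

lemma AffineMajorant.axis_unique (h : AffineMajorant (rate ch) l₁ l₂ c) {x' : ℝ} (hx : 0 < x)
    (hx' : 0 < x') (e : rate ch x 0 = l₁ * x + l₂ * 0 + c)
    (e' : rate ch x' 0 = l₁ * x' + l₂ * 0 + c) : x = x' := by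
  have h1 := ch.h₁₁_pos
  have h3 := ch.N₁_pos
  have s1 := h.slope_of_axis hx e
  rw [h.slope_of_axis hx' e', div_eq_div_iff (by positivity) (by positivity)] at s1
  have : ch.h₁₁ * (ch.h₁₁ * (x - x')) = 0 := by linear_combination s1
  simpa [h1.ne', sub_eq_zero] using this

/-- The two sides are intercepts at `0` of tangents to the concave function `log (1 + ·)`, and such
intercepts grow with the point of tangency. -/
lemma log_one_add_sub_div_lt {z w : ℝ} (hz : 0 < z) (hzw : z < w) :
    Real.log (1 + z) - z / (1 + z) < Real.log (1 + w) - w / (1 + w) := by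
  have hw : 0 < w := hz.trans hzw
  have h1 := Real.one_sub_inv_le_log_of_pos (show 0 < (1 + w) / (1 + z) by positivity)
  rw [Real.log_div (by positivity) (by positivity)] at h1
  have h2 : w / (1 + w) - z / (1 + z) < 1 - ((1 + w) / (1 + z))⁻¹ := by
    rw [inv_div, div_sub_div _ _ (by positivity) (by positivity), one_sub_div (by positivity),
      div_lt_div_iff₀ (by positivity) (by positivity)]
    have : 0 < (w - z) * z * (1 + w) := by
      have : 0 < w - z := by linarith
      positivity
    nlinarith
  linarith

/-- Comparison of the normalised heights of exclusive bands. -/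
lemma AffineMajorant.height_le (h : AffineMajorant (rate ch) l₁ l₂ c) (hx : 0 < x) (hy : 0 < y)
    (e : rate ch x 0 = l₁ * x + l₂ * 0 + c) (hl₂ : l₂ = ch.h₂₂ / (ch.N₂ + ch.h₂₂ * y)) :
    y * ch.h₂₂ / ch.N₂ ≤ x * ch.h₁₁ / ch.N₁ := by
  have h1 := ch.h₁₁_pos
  have h2 := ch.N₂_pos
  have h3 := ch.N₁_pos
  have h6 := ch.h₂₂_pos
  by_contra! hlt
  have k := log_one_add_sub_div_lt (by positivity) hlt
  have hy' := h 0 y le_rfl hy.le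
  rw [← rate_swap, rate_axis] at hy'
  rw [rate_axis] at e
  change Real.log (1 + y * ch.h₂₂ / ch.N₂) ≤ _ at hy'
  have e1 : x * ch.h₁₁ / ch.N₁ / (1 + x * ch.h₁₁ / ch.N₁) = l₁ * x := by
    have s1 := h.slope_of_axis hx (by rw [rate_axis, e])
    rw [s1]
    field_simp
  have e2 : y * ch.h₂₂ / ch.N₂ / (1 + y * ch.h₂₂ / ch.N₂) = l₂ * y := by
    rw [hl₂]
    field_simp
  rw [e1, e2] at k
  linarith

/-- Both tangents along the axes have intercept `c`, and the intercept determines the normalised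
height. This is the source of the ratio equation. -/
lemma AffineMajorant.height_eq (h : AffineMajorant (rate ch) l₁ l₂ c) (hx : 0 < x) (hy : 0 < y)
    (e : rate ch x 0 = l₁ * x + l₂ * 0 + c) (e' : rate ch 0 y = l₁ * 0 + l₂ * y + c) :
    x * ch.h₁₁ / ch.N₁ = y * ch.h₂₂ / ch.N₂ := by
  have e'' := rate_touch_swap e'
  exact le_antisymm (h.swap_rate.height_le hy hx e'' (h.slope_of_axis hx e))
    (h.height_le hx hy e (h.swap_rate.slope_of_axis hy e''))

/-- The slope is smaller than that of an exclusive band of the same density. -/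
lemma AffineMajorant.slope_lt (h : AffineMajorant (rate ch) l₁ l₂ c) (hx : 0 < x) (hy : 0 < y)
    (e : rate ch x y = l₁ * x + l₂ * y + c) : l₁ < ch.h₁₁ / (ch.N₁ + ch.h₁₁ * x) := by
  have h1 := ch.h₁₁_pos
  have h2 := ch.N₂_pos
  have h3 := ch.N₁_pos
  have h4 := ch.h₁₂_pos
  have h5 := ch.h₂₁_pos
  have h6 := ch.h₂₂_pos
  rw [h.stationary_rate hx hy.le e]
  have k1 : ch.h₁₁ / (ch.N₁ + ch.h₁₁ * x + ch.h₂₁ * y) < ch.h₁₁ / (ch.N₁ + ch.h₁₁ * x) := by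
    apply div_lt_div_of_pos_left h1 (by positivity)
    have : 0 < ch.h₂₁ * y := by positivity
    linarith
  have k2 : 0 < ch.h₁₂ * ch.h₂₂ * y / ((ch.N₂ + ch.h₁₂ * x) * (ch.N₂ + ch.h₁₂ * x + ch.h₂₂ * y)) := by
    positivity
  linarith

/-- At equal density, interference makes power in a shared band worth less than in an exclusive one.
Equal slopes then require a lower shared density, which is the positivity of `c₁`. -/
lemma AffineMajorant.shared_lt_axis (h : AffineMajorant (rate ch) l₁ l₂ c) {q₁ q₂ : ℝ}
    (hx : 0 < x) (hq₁ : 0 < q₁) (hq₂ : 0 < q₂) (e : rate ch x 0 = l₁ * x + l₂ * 0 + c)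
    (eq : rate ch q₁ q₂ = l₁ * q₁ + l₂ * q₂ + c) : q₁ < x := by
  have h1 := ch.h₁₁_pos
  have h3 := ch.N₁_pos
  have k := h.slope_lt hq₁ hq₂ eq
  rw [h.slope_of_axis hx e, div_lt_div_iff_of_pos_left h1 (by positivity) (by positivity)] at k
  have : ch.h₁₁ * q₁ < ch.h₁₁ * x := by linarith
  exact lt_of_mul_lt_mul_left this h1.le

/-- The two expressions for `l₁`, from the exclusive and from the shared point, are equated and the
denominators cleared. -/
lemma AffineMajorant.gam_eq_zero (h : AffineMajorant (rate ch) l₁ l₂ c) {q₁ q₂ : ℝ}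
    (hx : 0 < x) (hq₁ : 0 < q₁) (hq₂ : 0 < q₂) (e : rate ch x 0 = l₁ * x + l₂ * 0 + c)
    (eq : rate ch q₁ q₂ = l₁ * q₁ + l₂ * q₂ + c) :
    gam ch.N₁ ch.N₂ ch.h₁₁ ch.h₂₂ ch.h₁₂ ch.h₂₁ q₁ (x - q₁) q₂ = 0 := by
  have h1 := ch.h₁₁_pos
  have h2 := ch.N₂_pos
  have h3 := ch.N₁_pos
  have h4 := ch.h₁₂_pos
  have h5 := ch.h₂₁_pos
  have h6 := ch.h₂₂_pos
  have k := h.stationary_rate hq₁ hq₂.le eq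
  rw [h.slope_of_axis hx e] at k
  have x0 : 0 < ch.N₁ + ch.h₁₁ * x := by positivity
  have x1 : 0 < ch.N₁ + ch.h₁₁ * q₁ + ch.h₂₁ * q₂ := by positivity
  have x2 : 0 < ch.N₂ + ch.h₁₂ * q₁ := by positivity
  have x3 : 0 < ch.N₂ + ch.h₁₂ * q₁ + ch.h₂₂ * q₂ := by positivity
  rw [div_sub_div _ _ x1.ne' (by positivity), div_eq_div_iff x0.ne' (by positivity)] at k
  unfold gam
  linear_combination k

/-- On the line through two exclusive touching points: the density of user 2 in the shared band is
small compared with that of user 1 in the exclusive band. -/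
lemma AffineMajorant.shared_lt_height (h : AffineMajorant (rate ch) l₁ l₂ c) (hl₂ : 0 < l₂)
    {q₁ q₂ : ℝ} (hx : 0 < x) (hq₁ : 0 < q₁) (hq₂ : 0 < q₂)
    (e : rate ch x 0 = l₁ * x + l₂ * 0 + c) (eq : rate ch q₁ q₂ = l₁ * q₁ + l₂ * q₂ + c) :
    q₂ < ch.N₂ * ch.h₁₁ / (ch.N₁ * ch.h₂₂) * x := by
  have h1 := ch.h₁₁_pos
  have h2 := ch.N₂_pos
  have h3 := ch.N₁_pos
  have h6 := ch.h₂₂_pos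
  have k := h.swap_rate.slope_lt hq₂ hq₁ (rate_touch_swap eq)
  change l₂ < ch.h₂₂ / (ch.N₂ + ch.h₂₂ * q₂) at k
  -- `y` is the density at which an exclusive band of user 2 would have slope `l₂`. No such band
  -- need exist, which is why `height_le` asks only for a slope.
  obtain ⟨y, hy⟩ : ∃ y, y = 1 / l₂ - ch.N₂ / ch.h₂₂ := ⟨_, rfl⟩
  have hl : l₂ = ch.h₂₂ / (ch.N₂ + ch.h₂₂ * y) := by
    have : ch.N₂ + ch.h₂₂ * y = ch.h₂₂ / l₂ := by
      rw [hy]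
      field_simp
      ring
    rw [this]
    field_simp
  have hqy : q₂ < y := by
    rw [lt_div_iff₀ (by positivity)] at k
    have : ch.h₂₂ * (l₂ * q₂) < ch.h₂₂ * (l₂ * y) := by
      have : ch.h₂₂ * (l₂ * y) = ch.h₂₂ - l₂ * ch.N₂ := by
        rw [hy]
        field_simp
      linarith
    exact lt_of_mul_lt_mul_left (lt_of_mul_lt_mul_left this h6.le) hl₂.le
  have hy0 : 0 < y := hq₂.trans hqy
  have := h.height_le hx hy0 e hl
  refine hqy.trans_le ?_
  rw [div_le_div_iff₀ h2 h3] at this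
  rw [div_mul_eq_mul_div, le_div_iff₀ (by positivity)]
  linarith

end Rate

/-! ### Hypotheses of the duality theorem for the rate -/

section RateDuality

variable {ch : FlatChannel} {l₁ l₂ c x y : ℝ}

lemma rate_zero (ch : FlatChannel) : rate ch 0 0 = 0 := by simp [rate]

lemma log_user_le (ch : FlatChannel) (hx : 0 ≤ x) (hy : 0 ≤ y) :
    Real.log (1 + x * ch.h₁₁ / (y * ch.h₂₁ + ch.N₁)) ≤ Real.log (1 + x * ch.h₁₁ / ch.N₁) := by
  have h1 := ch.h₁₁_pos
  have h3 := ch.N₁_pos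
  have h5 := ch.h₂₁_pos
  apply Real.log_le_log (by positivity)
  gcongr
  have : 0 ≤ y * ch.h₂₁ := by positivity
  linarith

lemma log_user_nonneg (ch : FlatChannel) (hx : 0 ≤ x) (hy : 0 ≤ y) :
    0 ≤ Real.log (1 + x * ch.h₁₁ / (y * ch.h₂₁ + ch.N₁)) := by
  have h1 := ch.h₁₁_pos
  have h3 := ch.N₁_pos
  have h5 := ch.h₂₁_pos
  apply Real.log_nonneg
  have : 0 ≤ x * ch.h₁₁ / (y * ch.h₂₁ + ch.N₁) := by positivity
  linarith

lemma rate_sublinear (ch : FlatChannel) {η : ℝ} (hη : 0 < η) :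
    ∃ K, ∀ a b, 0 ≤ a → 0 ≤ b → rate ch a b ≤ η * (a + b) + K := by
  have key : ∀ k : ℝ, 0 < k → ∃ K, ∀ a, 0 ≤ a → Real.log (1 + a * k) ≤ η * a + K := by
    intro k hk
    -- This is the tangent to `log (1 + a k)` of slope `η`, obtained from `log u ≤ u - 1` at `u = (η
    -- / k) (1 + a k)`.
    refine ⟨η / k - 1 - Real.log (η / k), fun a ha => ?_⟩
    have h1 := Real.log_le_sub_one_of_pos (show 0 < η / k * (1 + a * k) by positivity)
    rw [Real.log_mul (by positivity) (by positivity)] at h1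
    have h2 : η / k * (1 + a * k) = η / k + η * a := by field_simp
    linarith
  have h1 := ch.h₁₁_pos
  have h2 := ch.N₂_pos
  have h3 := ch.N₁_pos
  have h6 := ch.h₂₂_pos
  obtain ⟨K₁, hK₁⟩ := key (ch.h₁₁ / ch.N₁) (by positivity)
  obtain ⟨K₂, hK₂⟩ := key (ch.h₂₂ / ch.N₂) (by positivity)
  refine ⟨K₁ + K₂, fun a b ha hb => ?_⟩
  have e1 := log_user_le ch ha hb
  have e2 := log_user_le ch.swap hb ha
  have e3 := hK₁ a ha
  have e4 := hK₂ b hb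
  rw [← mul_div_assoc] at e3 e4
  change Real.log (1 + b * ch.h₂₂ / (a * ch.h₁₂ + ch.N₂)) ≤
    Real.log (1 + b * ch.h₂₂ / ch.N₂) at e2
  unfold rate
  linarith

lemma exists_lt_rate_axis (ch : FlatChannel) (K : ℝ) : ∃ a, 0 ≤ a ∧ K < rate ch a 0 := by
  have h1 := ch.h₁₁_pos
  have h3 := ch.N₁_pos
  have hE := Real.exp_pos K
  refine ⟨Real.exp K * ch.N₁ / ch.h₁₁, by positivity, ?_⟩
  rw [rate_axis, Real.lt_log_iff_exp_lt (by positivity)]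
  have : Real.exp K * ch.N₁ / ch.h₁₁ * ch.h₁₁ / ch.N₁ = Real.exp K := by field_simp
  linarith

lemma continuousOn_rate (ch : FlatChannel) :
    ContinuousOn (fun p : ℝ × ℝ => rate ch p.1 p.2) {p | 0 ≤ p.1 ∧ 0 ≤ p.2} := by
  have h1 := ch.h₁₁_pos
  have h2 := ch.N₂_pos
  have h3 := ch.N₁_pos
  have h4 := ch.h₁₂_pos
  have h5 := ch.h₂₁_pos
  have h6 := ch.h₂₂_pos
  unfold rate
  apply ContinuousOn.add
  · apply ContinuousOn.log
    · apply ContinuousOn.add (by fun_prop)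
      apply ContinuousOn.div (by fun_prop) (by fun_prop)
      rintro p ⟨hp1, hp2⟩
      positivity
    · rintro p ⟨hp1, hp2⟩
      positivity
  · apply ContinuousOn.log
    · apply ContinuousOn.add (by fun_prop)
      apply ContinuousOn.div (by fun_prop) (by fun_prop)
      rintro p ⟨hp1, hp2⟩
      positivity
    · rintro p ⟨hp1, hp2⟩
      positivity

lemma finite_touchSet_rate (hl₁ : 0 < l₁) (hl₂ : 0 < l₂) (h : AffineMajorant (rate ch) l₁ l₂ c) :
    (touchSet (rate ch) l₁ l₂ c).Finite := by
  have hsub : touchSet (rate ch) l₁ l₂ c ⊆ {(0, 0)} ∪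
      ({p | 0 < p.1 ∧ p.2 = 0 ∧ rate ch p.1 p.2 = l₁ * p.1 + l₂ * p.2 + c} ∪
      ({p | p.1 = 0 ∧ 0 < p.2 ∧ rate ch p.1 p.2 = l₁ * p.1 + l₂ * p.2 + c} ∪
      {p | 0 < p.1 ∧ 0 < p.2 ∧ rate ch p.1 p.2 = l₁ * p.1 + l₂ * p.2 + c})) := by
    rintro ⟨a, b⟩ ⟨ha, hb, e⟩
    simp only at ha hb e
    rcases ha.eq_or_lt with ha | ha <;> rcases hb.eq_or_lt with hb | hb
    · left
      simp [← ha, ← hb]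
    · right; right; left
      exact ⟨ha.symm, hb, e⟩
    · right; left
      exact ⟨ha, hb.symm, e⟩
    · right; right; right
      exact ⟨ha, hb, e⟩
  refine Set.Finite.subset ((Set.finite_singleton _).union (Set.Finite.union ?_
    (Set.Finite.union ?_ ?_))) hsub
  · apply Set.Subsingleton.finite
    rintro ⟨a, b⟩ ⟨ha, rfl, e⟩ ⟨a', b'⟩ ⟨ha', hb', e'⟩
    simp only at ha e ha' hb' e'
    subst hb'
    rw [h.axis_unique ha ha' e e']
  · apply Set.Subsingleton.finite
    rintro ⟨a, b⟩ ⟨rfl, hb, e⟩ ⟨a', b'⟩ ⟨ha', hb', e'⟩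
    simp only at hb e ha' hb' e'
    subst ha'
    rw [h.swap_rate.axis_unique hb hb' (rate_touch_swap e) (rate_touch_swap e')]
  · apply Set.Subsingleton.finite
    rintro ⟨a, b⟩ ⟨ha, hb, e⟩ ⟨a', b'⟩ ⟨ha', hb', e'⟩
    obtain ⟨rfl, rfl⟩ := h.rate_touch_unique hl₁ hl₂ ha hb ha' hb' e e'
    rfl

end RateDuality

/-! ### Optimal bands, their equations and their value -/

/-- Sizes and densities of at most three bands in which an affine majorant touches the rate. -/
structure OptimalBands (ch : FlatChannel) (l₁ l₂ c S₁ S₂ S₁₂ x y q₁ q₂ : ℝ) : Prop where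
  S₁_nonneg : 0 ≤ S₁
  S₂_nonneg : 0 ≤ S₂
  S₁₂_nonneg : 0 ≤ S₁₂
  width : ch.W = S₁ + S₂ + S₁₂
  power₁ : ch.P₁ = S₁ * x + S₁₂ * q₁
  power₂ : ch.P₂ = S₂ * y + S₁₂ * q₂
  touch₁ : 0 < S₁ → 0 < x ∧ rate ch x 0 = l₁ * x + l₂ * 0 + c
  touch₂ : 0 < S₂ → 0 < y ∧ rate ch 0 y = l₁ * 0 + l₂ * y + c
  touch₁₂ : 0 < S₁₂ → 0 < q₁ ∧ 0 < q₂ ∧ rate ch q₁ q₂ = l₁ * q₁ + l₂ * q₂ + c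

/-- Positive powers cannot be a mixture of the origin alone, so some touching point is nonzero.
Positivity of `c` then excludes the origin as a touching point, hence no positive part of the
spectrum is idle. -/
lemma const_pos_of_mem_convexHull_touchSet {ch : FlatChannel} {l₁ l₂ c : ℝ} (hl₁ : 0 < l₁) (hl₂ : 0 < l₂)
    (h : AffineMajorant (rate ch) l₁ l₂ c)
    (hm : (ch.P₁ / ch.W, ch.P₂ / ch.W) ∈ convexHull ℝ (touchSet (rate ch) l₁ l₂ c)) : 0 < c := by
  by_cases hne : ∃ p ∈ touchSet (rate ch) l₁ l₂ c, 0 < p.1 + p.2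
  · obtain ⟨p, hp, hp'⟩ := hne
    exact h.rate_const_pos hl₁ hl₂ hp.1 hp.2.1 hp' hp.2.2
  · exfalso
    push Not at hne
    have hsub : touchSet (rate ch) l₁ l₂ c ⊆ {p | p.1 ≤ 0} := by
      intro p hp
      have h1 := hne p hp
      have h2 := hp.2.1
      change p.1 ≤ 0
      linarith
    have := convexHull_min hsub (convex_halfSpace_le (f := fun p : ℝ × ℝ => p.1)
      (LinearMap.fst ℝ ℝ ℝ).isLinear 0) hm
    have h1 : 0 < ch.P₁ / ch.W := div_pos ch.P₁_pos ch.W_pos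
    exact absurd this (not_le.2 h1)

/-- The touching points are at most one exclusive density of each user and one shared pair. -/
lemma exists_touchSet_rate_densities {ch : FlatChannel} {l₁ l₂ c : ℝ} (hl₁ : 0 < l₁)
    (hl₂ : 0 < l₂) (h : AffineMajorant (rate ch) l₁ l₂ c) (hc : 0 < c) :
    ∃ x y q₁ q₂, ∀ p ∈ touchSet (rate ch) l₁ l₂ c,
      (0 < p.1 ∧ p.2 = 0 ∧ p.1 = x) ∨ (p.1 = 0 ∧ 0 < p.2 ∧ p.2 = y) ∨
        (0 < p.1 ∧ 0 < p.2 ∧ p.1 = q₁ ∧ p.2 = q₂) := by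
  have hx : ∃ x, ∀ a, 0 < a → rate ch a 0 = l₁ * a + l₂ * 0 + c → a = x := by
    by_cases hex : ∃ a, 0 < a ∧ rate ch a 0 = l₁ * a + l₂ * 0 + c
    · obtain ⟨x, hx, e⟩ := hex
      exact ⟨x, fun a ha e' => h.axis_unique ha hx e' e⟩
    · exact ⟨0, fun a ha e => absurd ⟨a, ha, e⟩ hex⟩
  have hy : ∃ y, ∀ b, 0 < b → rate ch 0 b = l₁ * 0 + l₂ * b + c → b = y := by
    by_cases hex : ∃ b, 0 < b ∧ rate ch 0 b = l₁ * 0 + l₂ * b + c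
    · obtain ⟨y, hy, e⟩ := hex
      exact ⟨y, fun b hb e' =>
        h.swap_rate.axis_unique hb hy (rate_touch_swap e') (rate_touch_swap e)⟩
    · exact ⟨0, fun b hb e => absurd ⟨b, hb, e⟩ hex⟩
  have hq : ∃ q₁ q₂, ∀ a b, 0 < a → 0 < b → rate ch a b = l₁ * a + l₂ * b + c →
      a = q₁ ∧ b = q₂ := by
    by_cases hex : ∃ a b, 0 < a ∧ 0 < b ∧ rate ch a b = l₁ * a + l₂ * b + c
    · obtain ⟨q₁, q₂, h1, h2, e⟩ := hex
      exact ⟨q₁, q₂, fun a b ha hb e' => h.rate_touch_unique hl₁ hl₂ ha hb h1 h2 e' e⟩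
    · exact ⟨0, 0, fun a b ha hb e => absurd ⟨a, b, ha, hb, e⟩ hex⟩
  obtain ⟨x, hx⟩ := hx
  obtain ⟨y, hy⟩ := hy
  obtain ⟨q₁, q₂, hq⟩ := hq
  refine ⟨x, y, q₁, q₂, ?_⟩
  rintro ⟨a, b⟩ ⟨ha, hb, e⟩
  simp only at ha hb e ⊢
  rcases ha.eq_or_lt with ha | ha <;> rcases hb.eq_or_lt with hb | hb
  · rw [← ha, ← hb, rate_zero] at e
    linarith
  · right; left
    exact ⟨ha.symm, hb, hy b hb (by rw [← ha] at e; exact e)⟩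
  · left
    exact ⟨ha, hb.symm, hx a ha (by rw [← hb] at e; exact e)⟩
  · right; right
    exact ⟨ha, hb, hq a b ha hb e⟩

/-- Strong duality for the two-user channel. -/
theorem exists_optimalBands (ch : FlatChannel) :
    ∃ l₁ l₂ c, 0 < l₁ ∧ 0 < l₂ ∧ 0 < c ∧ AffineMajorant (rate ch) l₁ l₂ c ∧
      ∃ S₁ S₂ S₁₂ x y q₁ q₂, OptimalBands ch l₁ l₂ c S₁ S₂ S₁₂ x y q₁ q₂ := by
  have hW := ch.W_pos
  obtain ⟨l₁, l₂, c, hl₁, hl₂, h, hm⟩ := exists_affineMajorant_mem_convexHull (f := rate ch)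
    (div_pos ch.P₁_pos hW) (div_pos ch.P₂_pos hW) (rate_zero ch) (continuousOn_rate ch)
    (fun η hη => rate_sublinear ch hη) (exists_lt_rate_axis ch)
    (fun K => by
      obtain ⟨b, hb, hb'⟩ := exists_lt_rate_axis ch.swap K
      exact ⟨b, hb, by rwa [← rate_swap]⟩)
    (fun l₁ l₂ c hl₁ hl₂ h => finite_touchSet_rate hl₁ hl₂ h)
  have hc := const_pos_of_mem_convexHull_touchSet hl₁ hl₂ h hm
  refine ⟨l₁, l₂, c, hl₁, hl₂, hc, h, ?_⟩
  obtain ⟨x, y, q₁, q₂, hz⟩ := exists_touchSet_rate_densities hl₁ hl₂ h hc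
  obtain ⟨ι, _, w, z, hw, hw1, hzm, hsum⟩ := mem_convexHull_iff_exists_fintype.1 hm
  have hs1 : ∑ i, w i * (z i).1 = ch.P₁ / ch.W := by
    have := congrArg Prod.fst hsum
    simpa [Prod.fst_sum] using this
  have hs2 : ∑ i, w i * (z i).2 = ch.P₂ / ch.W := by
    have := congrArg Prod.snd hsum
    simpa [Prod.snd_sum] using this
  -- The weights are grouped by the vanishing coordinate of the touching point. All points of a
  -- group coincide, so each group is one band.
  refine ⟨ch.W * ∑ i, (if (z i).2 = 0 then w i else 0),
    ch.W * ∑ i, (if (z i).1 = 0 then w i else 0),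
    ch.W * ∑ i, (if (z i).1 = 0 ∨ (z i).2 = 0 then 0 else w i), x, y, q₁, q₂, ?_⟩
  have npos : ∀ {u : ι → ℝ}, 0 < ch.W * ∑ i, u i → ∃ i, u i ≠ 0 := by
    intro u hu
    by_contra! hcon
    simp [hcon] at hu
  refine ⟨?_, ?_, ?_, ?_, ?_, ?_, ?_, ?_, ?_⟩
  · refine mul_nonneg hW.le (Finset.sum_nonneg fun i _ => ?_)
    split_ifs
    exacts [hw i, le_rfl]
  · refine mul_nonneg hW.le (Finset.sum_nonneg fun i _ => ?_)
    split_ifs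
    exacts [hw i, le_rfl]
  · refine mul_nonneg hW.le (Finset.sum_nonneg fun i _ => ?_)
    split_ifs
    exacts [le_rfl, hw i]
  · rw [← mul_add, ← mul_add, ← Finset.sum_add_distrib, ← Finset.sum_add_distrib]
    conv_lhs => rw [← mul_one ch.W, ← hw1]
    congr 1
    refine Finset.sum_congr rfl fun i _ => ?_
    rcases hz _ (hzm i) with ⟨h1, h2, -⟩ | ⟨h1, h2, -⟩ | ⟨h1, h2, -⟩
    · simp [h1.ne', h2]
    · simp [h1, h2.ne']
    · simp [h1.ne', h2.ne']
  · rw [mul_assoc, mul_assoc, ← mul_add, Finset.sum_mul, Finset.sum_mul,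
      ← Finset.sum_add_distrib, mul_comm ch.W, ← div_eq_iff hW.ne', ← hs1]
    refine Finset.sum_congr rfl fun i _ => ?_
    rcases hz _ (hzm i) with ⟨h1, h2, h3⟩ | ⟨h1, h2, -⟩ | ⟨h1, h2, h3, -⟩
    · simp [h1.ne', h2, ← h3]
    · simp [h1, h2.ne']
    · simp [h2.ne', ← h3, h1.ne']
  · rw [mul_assoc, mul_assoc, ← mul_add, Finset.sum_mul, Finset.sum_mul,
      ← Finset.sum_add_distrib, mul_comm ch.W, ← div_eq_iff hW.ne', ← hs2]
    refine Finset.sum_congr rfl fun i _ => ?_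
    rcases hz _ (hzm i) with ⟨h1, h2, h3⟩ | ⟨h1, h2, h3⟩ | ⟨h1, h2, -, h3⟩
    · simp [h1.ne', h2]
    · simp [h1, h2.ne', ← h3]
    · simp [h1.ne', ← h3, h2.ne']
  · intro hpos
    obtain ⟨i, hi⟩ := npos hpos
    have hi' : (z i).2 = 0 := by
      by_contra hcon
      simp [hcon] at hi
    rcases hz _ (hzm i) with ⟨h1, h2, h3⟩ | ⟨h1, h2, h3⟩ | ⟨h1, h2, -, h3⟩
    · have := (hzm i).2.2
      rw [h2, h3] at this
      exact ⟨h3 ▸ h1, this⟩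
    · exact absurd hi' h2.ne'
    · exact absurd hi' h2.ne'
  · intro hpos
    obtain ⟨i, hi⟩ := npos hpos
    have hi' : (z i).1 = 0 := by
      by_contra hcon
      simp [hcon] at hi
    rcases hz _ (hzm i) with ⟨h1, h2, h3⟩ | ⟨h1, h2, h3⟩ | ⟨h1, h2, -, h3⟩
    · exact absurd hi' h1.ne'
    · have := (hzm i).2.2
      rw [h1, h3] at this
      exact ⟨h3 ▸ h2, this⟩
    · exact absurd hi' h1.ne'
  · intro hpos
    obtain ⟨i, hi⟩ := npos hpos
    have hi' : ¬ ((z i).1 = 0 ∨ (z i).2 = 0) := by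
      intro hcon
      simp [hcon] at hi
    rcases hz _ (hzm i) with ⟨h1, h2, h3⟩ | ⟨h1, h2, h3⟩ | ⟨h1, h2, h3, h4⟩
    · exact absurd (Or.inr h2) hi'
    · exact absurd (Or.inl h1) hi'
    · have := (hzm i).2.2
      rw [h3, h4] at this
      exact ⟨h3 ▸ h1, h4 ▸ h2, this⟩

lemma bandCapacity_eq_rate (ch : FlatChannel) (t : BandParams) :
    bandCapacity ch t = t.S₁ * rate ch (t.σ₁ + t.c₁) 0 + t.S₂ * rate ch 0 (t.σ₂ + t.c₂) +
      t.S₁₂ * rate ch t.σ₁ t.σ₂ := by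
  simp [bandCapacity, rate]

lemma disjointCapacity_eq (ch : FlatChannel) {z : ℝ}
    (hz : ch.P₁ * ch.h₁₁ / ch.N₁ + ch.P₂ * ch.h₂₂ / ch.N₂ = ch.W * z) :
    disjointCapacity ch = ch.W * Real.log (1 + z) := by
  have h2 := ch.N₂_pos
  have h3 := ch.N₁_pos
  have hW := ch.W_pos
  unfold disjointCapacity
  have : ch.P₁ * ch.h₁₁ / (ch.W * ch.N₁) + ch.P₂ * ch.h₂₂ / (ch.W * ch.N₂) = z := by
    rw [mul_comm ch.W ch.N₁, mul_comm ch.W ch.N₂, ← div_div, ← div_div, ← add_div, hz]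
    field_simp
  rw [add_assoc, this]

lemma overlapCapacity_eq_rate (ch : FlatChannel) :
    overlapCapacity ch = ch.W * rate ch (ch.P₁ / ch.W) (ch.P₂ / ch.W) := by
  have h2 := ch.N₂_pos
  have h3 := ch.N₁_pos
  have hW := ch.W_pos
  have h4 := ch.h₁₂_pos
  have h5 := ch.h₂₁_pos
  have hP1 := ch.P₁_pos
  have hP2 := ch.P₂_pos
  unfold overlapCapacity rate
  rw [mul_add]
  congr 4
  · field_simp
  · field_simp

namespace OptimalBands

variable {ch : FlatChannel} {l₁ l₂ c S₁ S₂ S₁₂ x y q₁ q₂ : ℝ}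

lemma value (hb : OptimalBands ch l₁ l₂ c S₁ S₂ S₁₂ x y q₁ q₂) :
    S₁ * rate ch x 0 + S₂ * rate ch 0 y + S₁₂ * rate ch q₁ q₂ =
      l₁ * ch.P₁ + l₂ * ch.P₂ + c * ch.W := by
  have e1 : S₁ * rate ch x 0 = S₁ * (l₁ * x + c) := by
    rcases hb.S₁_nonneg.eq_or_lt with h | h
    · rw [← h]; ring
    · rw [(hb.touch₁ h).2]; ring
  have e2 : S₂ * rate ch 0 y = S₂ * (l₂ * y + c) := by
    rcases hb.S₂_nonneg.eq_or_lt with h | h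
    · rw [← h]; ring
    · rw [(hb.touch₂ h).2]; ring
  have e3 : S₁₂ * rate ch q₁ q₂ = S₁₂ * (l₁ * q₁ + l₂ * q₂ + c) := by
    rcases hb.S₁₂_nonneg.eq_or_lt with h | h
    · rw [← h]; ring
    · rw [(hb.touch₁₂ h).2.2]
  rw [e1, e2, e3, hb.power₁, hb.power₂, hb.width]
  ring

/-- The ratio equation is equality of heights, and the two stationarity equations are equality of
slopes between an exclusive and the shared band. -/
lemma mem_threeBand (hb : OptimalBands ch l₁ l₂ c S₁ S₂ S₁₂ x y q₁ q₂)
    (h : AffineMajorant (rate ch) l₁ l₂ c) (hS₁ : 0 < S₁) (hS₂ : 0 < S₂) (hS₁₂ : 0 < S₁₂) :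
    (⟨S₁, S₂, S₁₂, q₁, x - q₁, q₂, y - q₂⟩ : BandParams) ∈ ThreeBand ch := by
  have h1 := ch.h₁₁_pos
  have h2 := ch.N₂_pos
  have h3 := ch.N₁_pos
  have h6 := ch.h₂₂_pos
  obtain ⟨hx, ex⟩ := hb.touch₁ hS₁
  obtain ⟨hy, ey⟩ := hb.touch₂ hS₂
  obtain ⟨hq₁, hq₂, eq⟩ := hb.touch₁₂ hS₁₂
  have hz := h.height_eq hx hy ex ey
  refine ⟨hS₁, hS₂, hS₁₂, hq₁, ?_, hq₂, ?_, hb.width, ?_, ?_, ?_, ?_, ?_⟩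
  · exact sub_pos.2 (h.shared_lt_axis hx hq₁ hq₂ ex eq)
  · exact sub_pos.2 (h.swap_rate.shared_lt_axis hy hq₂ hq₁ (rate_touch_swap ey)
      (rate_touch_swap eq))
  · simpa using hb.power₁
  · simpa using hb.power₂
  · simp only [add_sub_cancel]
    rw [div_eq_div_iff h3.ne' h2.ne'] at hz
    rw [div_eq_div_iff hS₂.ne' (by positivity)]
    linear_combination (-S₁ * S₂) * hz
  · exact h.gam_eq_zero hx hq₁ hq₂ ex eq
  · exact h.swap_rate.gam_eq_zero hy hq₂ hq₁ (rate_touch_swap ey) (rate_touch_swap eq)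

lemma mem_noExclusive₁ (hb : OptimalBands ch l₁ l₂ c S₁ S₂ S₁₂ x y q₁ q₂)
    (h : AffineMajorant (rate ch) l₁ l₂ c) (hS₁ : S₁ = 0) (hS₂ : 0 < S₂) (hS₁₂ : 0 < S₁₂) :
    (⟨0, S₂, S₁₂, q₁, 0, q₂, y - q₂⟩ : BandParams) ∈ NoExclusive₁ ch := by
  obtain ⟨hy, ey⟩ := hb.touch₂ hS₂
  obtain ⟨hq₁, hq₂, eq⟩ := hb.touch₁₂ hS₁₂
  refine ⟨rfl, rfl, hS₂, hS₁₂, hq₁, hq₂, ?_, ?_, ?_, ?_, ?_⟩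
  · exact sub_pos.2 (h.swap_rate.shared_lt_axis hy hq₂ hq₁ (rate_touch_swap ey)
      (rate_touch_swap eq))
  · have := hb.width
    rw [hS₁] at this
    simpa using this
  · have := hb.power₁
    rw [hS₁] at this
    simpa using this
  · simpa using hb.power₂
  · exact h.swap_rate.gam_eq_zero hy hq₂ hq₁ (rate_touch_swap ey) (rate_touch_swap eq)

lemma mem_noExclusive₂ (hb : OptimalBands ch l₁ l₂ c S₁ S₂ S₁₂ x y q₁ q₂)
    (h : AffineMajorant (rate ch) l₁ l₂ c) (hS₁ : 0 < S₁) (hS₂ : S₂ = 0) (hS₁₂ : 0 < S₁₂) :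
    (⟨S₁, 0, S₁₂, q₁, x - q₁, q₂, 0⟩ : BandParams) ∈ NoExclusive₂ ch := by
  obtain ⟨hx, ex⟩ := hb.touch₁ hS₁
  obtain ⟨hq₁, hq₂, eq⟩ := hb.touch₁₂ hS₁₂
  refine ⟨rfl, rfl, hS₁, hS₁₂, hq₁, ?_, hq₂, ?_, ?_, ?_, ?_⟩
  · exact sub_pos.2 (h.shared_lt_axis hx hq₁ hq₂ ex eq)
  · have := hb.width
    rw [hS₂] at this
    simpa using this
  · simpa using hb.power₁
  · have := hb.power₂
    rw [hS₂] at this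
    simpa using this
  · exact h.gam_eq_zero hx hq₁ hq₂ ex eq

/-- There is no ratio equation to compare the users, so the comparison of `q₂` with `x` comes from
the majorant, through `shared_lt_height`. -/
lemma lt_sigmaBound_of_S₂_eq_zero (hb : OptimalBands ch l₁ l₂ c S₁ S₂ S₁₂ x y q₁ q₂)
    (h : AffineMajorant (rate ch) l₁ l₂ c) (hl₂ : 0 < l₂) (hS₁ : 0 < S₁) (hS₂ : S₂ = 0)
    (hS₁₂ : 0 < S₁₂) : q₂ < sigmaBound ch := by
  obtain ⟨hx, ex⟩ := hb.touch₁ hS₁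
  obtain ⟨hq₁, hq₂, eq⟩ := hb.touch₁₂ hS₁₂
  have k := h.shared_lt_height hl₂ hx hq₁ hq₂ ex eq
  unfold sigmaBound
  obtain ⟨γ, hγ⟩ : ∃ γ, γ = max 1 (ch.N₂ * ch.h₁₁ / (ch.N₁ * ch.h₂₂)) := ⟨_, rfl⟩
  have g1 : 1 ≤ γ := hγ ▸ le_max_left _ _
  have g2 : ch.N₂ * ch.h₁₁ / (ch.N₁ * ch.h₂₂) ≤ γ := hγ ▸ le_max_right _ _
  rw [← hγ, lt_div_iff₀ ch.W_pos, hb.width, hb.power₁, hb.power₂, hS₂]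
  have k1 : q₂ * S₁ < γ * x * S₁ :=
    mul_lt_mul_of_pos_right (k.trans_le (mul_le_mul_of_nonneg_right g2 hx.le)) hS₁
  have k2 : 0 ≤ (γ - 1) * (S₁₂ * q₂) := mul_nonneg (by linarith) (by positivity)
  have k3 : 0 < γ * (S₁₂ * q₁) := by positivity
  nlinarith

lemma disjointCapacity_eq_of_S₁₂_eq_zero (hb : OptimalBands ch l₁ l₂ c S₁ S₂ S₁₂ x y q₁ q₂)
    (h : AffineMajorant (rate ch) l₁ l₂ c) (hS₁₂ : S₁₂ = 0) :
    disjointCapacity ch = l₁ * ch.P₁ + l₂ * ch.P₂ + c * ch.W := by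
  have hP1 := ch.P₁_pos
  have hP2 := ch.P₂_pos
  have p1 := hb.power₁
  have p2 := hb.power₂
  have w := hb.width
  rw [hS₁₂, zero_mul, add_zero] at p1 p2
  have hS₁ : 0 < S₁ := hb.S₁_nonneg.lt_of_ne fun h => by
    rw [← h, zero_mul] at p1
    linarith
  have hS₂ : 0 < S₂ := hb.S₂_nonneg.lt_of_ne fun h => by
    rw [← h, zero_mul] at p2
    linarith
  obtain ⟨hx, ex⟩ := hb.touch₁ hS₁
  obtain ⟨hy, ey⟩ := hb.touch₂ hS₂
  have hz := h.height_eq hx hy ex ey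
  have ex' := ex
  have ey' := ey
  rw [rate_axis] at ex'
  rw [← rate_swap, rate_axis] at ey'
  change Real.log (1 + y * ch.h₂₂ / ch.N₂) = _ at ey'
  rw [disjointCapacity_eq ch (z := x * ch.h₁₁ / ch.N₁), ← hb.value, ex, ey, w, hS₁₂]
  · rw [← hz] at ey'
    linear_combination S₁ * ex' + S₂ * ey'
  · rw [p1, p2, w, hS₁₂]
    linear_combination (-S₂) * hz

lemma overlapCapacity_eq_of_S₁_S₂_eq_zero (hb : OptimalBands ch l₁ l₂ c S₁ S₂ S₁₂ x y q₁ q₂)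
    (hS₁ : S₁ = 0) (hS₂ : S₂ = 0) :
    overlapCapacity ch = l₁ * ch.P₁ + l₂ * ch.P₂ + c * ch.W := by
  have hW := ch.W_pos
  have p1 := hb.power₁
  have p2 := hb.power₂
  have w := hb.width
  rw [hS₁, hS₂, zero_add, zero_add] at w
  rw [hS₁, zero_mul, zero_add, ← w] at p1
  rw [hS₂, zero_mul, zero_add, ← w] at p2
  have e1 : ch.P₁ / ch.W = q₁ := by rw [p1]; field_simp
  have e2 : ch.P₂ / ch.W = q₂ := by rw [p2]; field_simp
  rw [overlapCapacity_eq_rate, e1, e2, ← hb.value, hS₁, hS₂, ← w]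
  ring

/-- If the shared densities lie on the line through the exclusive ones, sharing gains nothing. -/
lemma disjointCapacity_eq_of_singular (hb : OptimalBands ch l₁ l₂ c S₁ S₂ S₁₂ x y q₁ q₂)
    (h : AffineMajorant (rate ch) l₁ l₂ c) (hS₁ : 0 < S₁) (hS₂ : 0 < S₂)
    (hsing : (x - q₁) * (y - q₂) = q₁ * q₂) :
    disjointCapacity ch = l₁ * ch.P₁ + l₂ * ch.P₂ + c * ch.W := by
  have h1 := ch.h₁₁_pos
  have h2 := ch.N₂_pos
  have h3 := ch.N₁_pos
  have h6 := ch.h₂₂_pos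
  obtain ⟨hx, ex⟩ := hb.touch₁ hS₁
  obtain ⟨hy, ey⟩ := hb.touch₂ hS₂
  have hz := h.height_eq hx hy ex ey
  have ex' := ex
  have ey' := ey
  rw [rate_axis] at ex'
  rw [← rate_swap, rate_axis] at ey'
  change Real.log (1 + y * ch.h₂₂ / ch.N₂) = _ at ey'
  rw [← hz] at ey'
  -- Equal heights mean equal rates at the two exclusive points, so the majorant is constant on the
  -- line through them.
  have hl : l₁ * x = l₂ * y := by linarith
  have hline : x * y = q₁ * y + q₂ * x := by linear_combination hsing
  -- Singularity says exactly that `(q₁, q₂)` lies on this line. Its rate is therefore that of the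
  -- exclusive points, and so is its total height.
  have hq : q₁ / x + q₂ / y = 1 := by
    field_simp
    linarith
  have e1 : q₁ * ch.h₁₁ / ch.N₁ = q₁ / x * (x * ch.h₁₁ / ch.N₁) := by field_simp
  have e2 : q₂ * ch.h₂₂ / ch.N₂ = q₂ / y * (x * ch.h₁₁ / ch.N₁) := by rw [hz]; field_simp
  have e3 : l₁ * q₁ = q₁ / x * (l₁ * x) := by field_simp
  have e4 : l₂ * q₂ = q₂ / y * (l₁ * x) := by rw [hl]; field_simp
  rw [disjointCapacity_eq ch (z := x * ch.h₁₁ / ch.N₁), ex', hb.width, hb.power₁, hb.power₂]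
  · linear_combination S₂ * hl - S₁₂ * e3 - S₁₂ * e4 - S₁₂ * l₁ * x * hq
  · rw [hb.width, hb.power₁, hb.power₂]
    linear_combination (-S₂) * hz + S₁₂ * e1 + S₁₂ * e2 + S₁₂ * (x * ch.h₁₁ / ch.N₁) * hq

end OptimalBands

/-! ### Bounds on `σ₂` and elimination of the other variables -/

/-- The equations force the density of user 2 below the bound. -/
lemma lt_sigmaBound_of_mem_threeBand {ch : FlatChannel} {t : BandParams} (ht : t ∈ ThreeBand ch) :
    t.σ₂ < sigmaBound ch := by
  obtain ⟨hS₁, hS₂, hS₁₂, hσ₁, hc₁, hσ₂, hc₂, hW, hP₁, hP₂, hr, -, -⟩ := ht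
  have h1 := ch.h₁₁_pos
  have h2 := ch.N₂_pos
  have h3 := ch.N₁_pos
  have h6 := ch.h₂₂_pos
  have hx : 0 < t.σ₁ + t.c₁ := by positivity
  have hy : 0 < t.σ₂ + t.c₂ := by positivity
  rw [div_eq_div_iff hS₂.ne' (by positivity)] at hr
  have hr' : t.σ₂ + t.c₂ = ch.N₂ * ch.h₁₁ / (ch.N₁ * ch.h₂₂) * (t.σ₁ + t.c₁) := by
    rw [div_mul_eq_mul_div, eq_div_iff (by positivity)]
    have : (t.S₁ * t.S₂) * ((t.σ₂ + t.c₂) * (ch.N₁ * ch.h₂₂)) =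
        (t.S₁ * t.S₂) * (ch.N₂ * ch.h₁₁ * (t.σ₁ + t.c₁)) := by linear_combination hr
    exact mul_left_cancel₀ (by positivity) this
  unfold sigmaBound
  obtain ⟨γ, hγ⟩ : ∃ γ, γ = max 1 (ch.N₂ * ch.h₁₁ / (ch.N₁ * ch.h₂₂)) := ⟨_, rfl⟩
  have g1 : 1 ≤ γ := hγ ▸ le_max_left _ _
  have g2 : ch.N₂ * ch.h₁₁ / (ch.N₁ * ch.h₂₂) ≤ γ := hγ ▸ le_max_right _ _
  rw [← hγ, lt_div_iff₀ ch.W_pos, hW, hP₁, hP₂]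
  have k1 : t.σ₂ * t.S₁ < γ * (t.σ₁ + t.c₁) * t.S₁ := by
    refine mul_lt_mul_of_pos_right (lt_of_lt_of_le ?_ (mul_le_mul_of_nonneg_right g2 hx.le)) hS₁
    rw [← hr']
    linarith
  have k2 : 0 ≤ (γ - 1) * (t.S₁₂ * t.σ₂) := mul_nonneg (by linarith) (by positivity)
  have k3 : 0 < γ * (t.S₁₂ * t.σ₁) := by positivity
  have k4 : 0 ≤ (γ - 1) * (t.S₂ * (t.σ₂ + t.c₂)) := mul_nonneg (by linarith) (by positivity)
  have k5 : 0 < t.S₂ * t.c₂ := by positivity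
  linarith

lemma lt_sigmaBound_of_mem_noExclusive₁ {ch : FlatChannel} {t : BandParams} (ht : t ∈ NoExclusive₁ ch) :
    t.σ₂ < sigmaBound ch := by
  obtain ⟨-, -, hS₂, hS₁₂, hσ₁, hσ₂, hc₂, hW, hP₁, hP₂, -⟩ := ht
  unfold sigmaBound
  obtain ⟨γ, hγ⟩ : ∃ γ, γ = max 1 (ch.N₂ * ch.h₁₁ / (ch.N₁ * ch.h₂₂)) := ⟨_, rfl⟩
  have g1 : 1 ≤ γ := hγ ▸ le_max_left _ _
  have hP1 := ch.P₁_pos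
  have hP2 := ch.P₂_pos
  rw [← hγ, lt_div_iff₀ ch.W_pos]
  have k1 : 0 ≤ (γ - 1) * (ch.P₁ + ch.P₂) := mul_nonneg (by linarith) (by positivity)
  have k2 : t.σ₂ * ch.W < ch.P₂ := by
    rw [hW, hP₂]
    have : 0 < t.S₂ * t.c₂ := by positivity
    linarith
  linarith

/-- The stationarity equation determines the excess density of the exclusive band. -/
lemma gam_injective {N N' h h' g g' σ σ' c c' : ℝ} (hN : 0 < N) (hN' : 0 < N') (hh : 0 < h)
    (hh' : 0 < h') (hg : 0 < g) (hg' : 0 < g') (hσ : 0 < σ) (hσ' : 0 < σ')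
    (e : gam N N' h h' g g' σ c σ' = 0) (e' : gam N N' h h' g g' σ c' σ' = 0) : c = c' := by
  -- As a function of `c` the expression is `K - c E`. Since `K > 0`, the existence of a root
  -- already gives `E ≠ 0`.
  obtain ⟨E, hE⟩ : ∃ E, E = h * ((N' + g * σ) * (N' + g * σ + h' * σ')) * h -
      g * h' * σ' * h * (N + h * σ + g' * σ') := ⟨_, rfl⟩
  obtain ⟨K, hK⟩ : ∃ K, K = h * (g' * σ') * ((N' + g * σ) * (N' + g * σ + h' * σ')) +
      g * h' * σ' * (N + h * σ) * (N + h * σ + g' * σ') := ⟨_, rfl⟩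
  have hK0 : 0 < K := by rw [hK]; positivity
  have h1 : c * E = K := by
    rw [hE, hK]
    unfold gam at e
    linear_combination -e
  have h2 : c' * E = K := by
    rw [hE, hK]
    unfold gam at e'
    linear_combination -e'
  have hE0 : E ≠ 0 := fun h0 => by
    rw [h0, mul_zero] at h1
    linarith
  exact mul_right_cancel₀ hE0 (h1.trans h2.symm)

open Polynomial in
lemma eliminatesToσ₂_regularThreeBand (ch : FlatChannel) :
    EliminatesToσ₂ (RegularThreeBand ch) := by
  obtain ⟨W, P₁, P₂, N₁, N₂, h₁₁, h₁₂, h₂₁, h₂₂, hW, hP₁, hP₂, hN₁, hN₂, hh₁₁, hh₁₂, hh₂₁, hh₂₂⟩ :=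
    ch
  refine ⟨?_, ?_⟩
  · let U : ℝ[X] := C N₁ + C h₂₁ * X
    let Y : ℝ[X] := C N₂ + C h₂₂ * X
    -- The equation is a cubic whose leading coefficient does not depend on `σ₂`. It arises by
    -- eliminating both exclusive heights from `Γ₁ = 0`, `Γ₂ = 0` and the ratio equation.
    refine ⟨![C (N₂ * h₁₁ * h₂₂) * U * (C N₂ * U) - C (N₁ * h₂₂ * h₁₁) * U * (C N₂ * Y)
          + C (N₁ * h₂₂ ^ 2 * h₁₂) * X * U * U,
        C (N₂ * h₁₁ * h₂₂) * U * (C (N₂ * h₁₁) + C h₁₂ * U) - C (N₂ * h₁₁ ^ 2 * h₂₁) * (C N₂ * Y)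
          - C (N₁ * h₂₂ * h₁₁) * U * (C h₁₂ * (C N₂ + Y)) + C (N₁ * h₂₂ ^ 2 * h₁₂) * X * U * C h₁₁,
        C (N₂ * h₁₁ * h₂₂) * U * C (h₁₂ * h₁₁) - C (N₂ * h₁₁ ^ 2 * h₂₁) * (C h₁₂ * (C N₂ + Y))
          - C (N₁ * h₂₂ * h₁₁) * U * C (h₁₂ ^ 2),
        - C (N₂ * h₁₁ ^ 2 * h₂₁ * h₁₂ ^ 2), 0], fun s hs => ⟨⟨3, ?_⟩, ?_⟩⟩
    · simp [hN₂.ne', hh₁₁.ne', hh₂₁.ne', hh₁₂.ne']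
    · rintro t ⟨⟨hS₁, hS₂, hS₁₂, hσ₁, hc₁, hσ₂, hc₂, -, -, -, hr, g1, g2⟩, -⟩ rfl
      simp only at hr
      rw [div_eq_div_iff hS₂.ne' (by positivity)] at hr
      have hr' : N₂ * (N₁ + h₁₁ * (t.σ₁ + t.c₁)) = N₁ * (N₂ + h₂₂ * (t.σ₂ + t.c₂)) := by
        have : (t.S₁ * t.S₂) * (h₂₂ * N₁ * (t.σ₂ + t.c₂)) =
          (t.S₁ * t.S₂) * (N₂ * h₁₁ * (t.σ₁ + t.c₁)) := by linear_combination hr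
        have := mul_left_cancel₀ (by positivity) this
        linarith
      -- With `X = N₁ + h₁₁ (σ₁ + c₁)`, the first stationarity expression is affine in `X`, and the
      -- second is affine in its analogue for user 2. The ratio equation makes the two analogues
      -- proportional, so one positive common factor can be cancelled.
      have key : (N₁ * (N₂ + h₂₂ * (t.σ₂ + t.c₂))) *
          (N₂ * h₁₁ * (N₂ + h₁₂ * t.σ₁) * (h₂₂ * (N₁ + h₂₁ * t.σ₂) *
            (N₁ + h₁₁ * t.σ₁ + h₂₁ * t.σ₂) - h₂₁ * h₁₁ * t.σ₁ * (N₂ + h₁₂ * t.σ₁ + h₂₂ * t.σ₂)) -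
          N₁ * h₂₂ * (N₁ + h₂₁ * t.σ₂) * (h₁₁ * (N₂ + h₁₂ * t.σ₁) *
            (N₂ + h₁₂ * t.σ₁ + h₂₂ * t.σ₂) - h₁₂ * h₂₂ * t.σ₂ * (N₁ + h₁₁ * t.σ₁ + h₂₁ * t.σ₂)))
          = 0 := by
        unfold Γ₁ gam at g1
        unfold Γ₂ gam at g2
        simp only at g1 g2
        linear_combination (N₁ * h₂₂ * (N₁ + h₂₁ * t.σ₂) * N₂) * g1
          - (N₁ * N₂ * h₁₁ * (N₂ + h₁₂ * t.σ₁)) * g2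
          + (N₁ * h₂₂ * (N₁ + h₂₁ * t.σ₂) * (h₁₁ * (N₂ + h₁₂ * t.σ₁) *
            (N₂ + h₁₂ * t.σ₁ + h₂₂ * t.σ₂) - h₁₂ * h₂₂ * t.σ₂ * (N₁ + h₁₁ * t.σ₁ + h₂₁ * t.σ₂)))
            * hr'
      have := (mul_eq_zero.1 key).resolve_left (by positivity)
      simp [Fin.sum_univ_five, U, Y]
      linear_combination this
  · rintro ⟨S₁, S₂, S₁₂, σ₁, c₁, σ₂, c₂⟩ ⟨⟨-, -, -, hσ₁, hc₁, hσ₂, hc₂, w, p1, p2, -, g1, g2⟩, hreg⟩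
      ⟨S₁', S₂', S₁₂', σ₁', c₁', σ₂', c₂'⟩ ⟨⟨-, -, -, -, -, -, -, w', p1', p2', -, g1', g2'⟩, -⟩
      e1 e2
    simp only at *
    subst e1 e2
    have ec₁ : c₁ = c₁' := gam_injective hN₁ hN₂ hh₁₁ hh₂₂ hh₁₂ hh₂₁ hσ₁ hσ₂ g1 g1'
    have ec₂ : c₂ = c₂' := gam_injective hN₂ hN₁ hh₂₂ hh₁₁ hh₂₁ hh₁₂ hσ₂ hσ₁ g2 g2'
    subst ec₁ ec₂
    have hS : S₁₂ = S₁₂' := by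
      -- For known densities the bandwidth and power equations are linear in the three widths, with
      -- determinant `c₁ c₂ - σ₁ σ₂` up to sign.
      have : (S₁₂ - S₁₂') * (c₁ * c₂ - σ₁ * σ₂) = 0 := by
        linear_combination (σ₁ + c₁) * (σ₂ + c₂) * (w' - w) - (σ₂ + c₂) * (p1' - p1)
          - (σ₁ + c₁) * (p2' - p2)
      exact sub_eq_zero.1 ((mul_eq_zero.1 this).resolve_right (sub_ne_zero.2 hreg))
    subst hS
    have hS₁ : S₁ = S₁' :=
      mul_right_cancel₀ (show σ₁ + c₁ ≠ 0 by positivity) (by linarith)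
    have hS₂ : S₂ = S₂' := by linarith
    rw [hS₁, hS₂]

open Polynomial in
lemma eliminatesToσ₂_noExclusive₁ (ch : FlatChannel) : EliminatesToσ₂ (NoExclusive₁ ch) := by
  obtain ⟨W, P₁, P₂, N₁, N₂, h₁₁, h₁₂, h₂₁, h₂₂, hW, hP₁, hP₂, hN₁, hN₂, hh₁₁, hh₁₂, hh₂₁, hh₂₂⟩ :=
    ch
  refine ⟨?_, ?_⟩
  · let U : ℝ[X] := C N₁ + C h₂₁ * X
    let Y : ℝ[X] := C N₂ + C h₂₂ * X
    let D : ℝ[X] := C P₂ - C W * X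
    let Q₀ : ℝ[X] := C (h₂₂ * h₁₂) * U * U + C (h₂₁ * h₁₁) * Y * Y
    let Q₁ : ℝ[X] := C (h₂₂ * h₁₂ * h₁₁) * U + C (h₂₁ * h₁₁ * h₁₂) * Y
    refine ⟨![- C P₁ * Q₀ - D * C h₂₂ * (C h₂₂ * U * U),
        C W * Q₀ - C P₁ * Q₁ - D * C h₂₂ * (C (h₂₂ * h₁₁) * U - C (h₂₁ * h₁₁) * Y),
        C W * Q₁ + D * C (h₂₂ * h₂₁ * h₁₁ * h₁₂), 0, 0], fun s hs => ⟨⟨2, ?_⟩, ?_⟩⟩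
    -- In the quadratic coefficient the negative term `-W s` of `D` cancels against the part of `Q₁`
    -- coming from `Y`, which leaves a positive sum.
    · have : 0 < W * (h₂₂ * h₁₂ * h₁₁ * (N₁ + h₂₁ * s) + h₂₁ * h₁₁ * h₁₂ * N₂) +
          P₂ * (h₂₂ * h₂₁ * h₁₁ * h₁₂) := by positivity
      simp [Q₁, D, U, Y]
      apply ne_of_gt
      linarith
    · rintro t ⟨-, -, hS₂, hS₁₂, hσ₁, hσ₂, hc₂, w, p1, p2, g2⟩ rfl
      unfold Γ₂ gam at g2
      simp only at w p1 p2 g2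
      -- Eliminating both widths from the three linear equations expresses `c₂`, which then enters
      -- the affine equation `Γ₂ = 0`. The common factor `σ₁` is removed.
      have hw : (W * t.σ₁ - P₁) * t.c₂ = (P₂ - W * t.σ₂) * t.σ₁ := by
        rw [w, p1, p2]
        ring
      have key : t.σ₁ * ((W * t.σ₁ - P₁) * (h₂₂ * h₁₂ * (N₁ + h₂₁ * t.σ₂) *
            (N₁ + h₁₁ * t.σ₁ + h₂₁ * t.σ₂) +
            h₂₁ * h₁₁ * (N₂ + h₂₂ * t.σ₂) * (N₂ + h₁₂ * t.σ₁ + h₂₂ * t.σ₂)) -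
          (P₂ - W * t.σ₂) * h₂₂ * (h₂₂ * (N₁ + h₂₁ * t.σ₂) * (N₁ + h₁₁ * t.σ₁ + h₂₁ * t.σ₂) -
            h₂₁ * h₁₁ * t.σ₁ * (N₂ + h₁₂ * t.σ₁ + h₂₂ * t.σ₂))) = 0 := by
        linear_combination (W * t.σ₁ - P₁) * g2 + (h₂₂ * (h₂₂ * (N₁ + h₂₁ * t.σ₂) *
          (N₁ + h₁₁ * t.σ₁ + h₂₁ * t.σ₂) -
            h₂₁ * h₁₁ * t.σ₁ * (N₂ + h₁₂ * t.σ₁ + h₂₂ * t.σ₂))) * hw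
      have := (mul_eq_zero.1 key).resolve_left hσ₁.ne'
      simp [Fin.sum_univ_five, U, Y, D, Q₀, Q₁]
      linear_combination this
  · rintro ⟨S₁, S₂, S₁₂, σ₁, c₁, σ₂, c₂⟩ ⟨z1, z2, -, -, hσ₁, hσ₂, -, w, p1, p2, g2⟩
      ⟨S₁', S₂', S₁₂', σ₁', c₁', σ₂', c₂'⟩ ⟨z1', z2', -, -, -, -, -, w', p1', p2', g2'⟩ e1 e2
    simp only at *
    subst e1 e2 z1 z2 z1' z2'
    have hc₂ : c₂ = c₂' := gam_injective hN₂ hN₁ hh₂₂ hh₁₁ hh₂₁ hh₁₂ hσ₂ hσ₁ g2 g2'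
    have hS : S₁₂ = S₁₂' := mul_right_cancel₀ hσ₁.ne' (p1.symm.trans p1')
    subst hc₂ hS
    have : S₂ = S₂' := by linarith
    rw [this]

open Polynomial in
lemma eliminatesToσ₂_noExclusive₂ (ch : FlatChannel) : EliminatesToσ₂ (NoExclusive₂ ch) := by
  obtain ⟨W, P₁, P₂, N₁, N₂, h₁₁, h₁₂, h₂₁, h₂₂, hW, hP₁, hP₂, hN₁, hN₂, hh₁₁, hh₁₂, hh₂₁, hh₂₂⟩ :=
    ch
  refine ⟨?_, ?_⟩
  · let U : ℝ[X] := C N₁ + C h₂₁ * X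
    let Y : ℝ[X] := C N₂ + C h₂₂ * X
    let D : ℝ[X] := C W * X - C P₂
    let E₀ : ℝ[X] := C (h₁₁ * N₂) * Y - C (h₁₂ * h₂₂) * X * U
    let E₁ : ℝ[X] := C (h₁₁ * h₁₂) * (C N₂ + Y) - C (h₁₂ * h₂₂ * h₁₁) * X
    refine ⟨![D * (C (h₁₁ * h₂₁ * N₂) * Y + C (h₁₂ * h₂₂ * N₁) * U) - C (P₁ * h₁₁) * E₀,
        D * (C (h₁₁ * h₂₁ * h₁₂) * (C N₂ + Y) + C (h₁₂ * h₂₂ * h₁₁) * (C N₁ + U))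
          - C (P₁ * h₁₁) * E₁ + C (W * h₁₁) * E₀,
        D * C (h₁₁ * h₂₁ * h₁₂ ^ 2 + h₁₂ * h₂₂ * h₁₁ ^ 2) - C (P₁ * h₁₁ ^ 2 * h₁₂ ^ 2)
          + C (W * h₁₁) * E₁,
        C (W * h₁₁ ^ 2 * h₁₂ ^ 2), 0], fun s hs => ⟨⟨3, ?_⟩, ?_⟩⟩
    · simp [hW.ne', hh₁₁.ne', hh₁₂.ne']
    · rintro t ⟨-, -, hS₁, hS₁₂, hσ₁, hc₁, hσ₂, w, p1, p2, g1⟩ rfl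
      unfold Γ₁ gam at g1
      simp only at w p1 p2 g1
      have hw : (W * t.σ₂ - P₂) * t.c₁ = t.σ₂ * (P₁ - W * t.σ₁) := by
        rw [w, p1, p2]
        ring
      have key : t.σ₂ * ((W * t.σ₂ - P₂) * (h₁₁ * h₂₁ * (N₂ + h₁₂ * t.σ₁) *
            (N₂ + h₁₂ * t.σ₁ + h₂₂ * t.σ₂) +
            h₁₂ * h₂₂ * (N₁ + h₁₁ * t.σ₁) * (N₁ + h₁₁ * t.σ₁ + h₂₁ * t.σ₂)) -
          (P₁ - W * t.σ₁) * h₁₁ * (h₁₁ * (N₂ + h₁₂ * t.σ₁) * (N₂ + h₁₂ * t.σ₁ + h₂₂ * t.σ₂) -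
            h₁₂ * h₂₂ * t.σ₂ * (N₁ + h₁₁ * t.σ₁ + h₂₁ * t.σ₂))) = 0 := by
        linear_combination (W * t.σ₂ - P₂) * g1 + (h₁₁ * (h₁₁ * (N₂ + h₁₂ * t.σ₁) *
          (N₂ + h₁₂ * t.σ₁ + h₂₂ * t.σ₂) -
            h₁₂ * h₂₂ * t.σ₂ * (N₁ + h₁₁ * t.σ₁ + h₂₁ * t.σ₂))) * hw
      have := (mul_eq_zero.1 key).resolve_left hσ₂.ne'
      simp [Fin.sum_univ_five, U, Y, D, E₀, E₁]
      linear_combination this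
  · rintro ⟨S₁, S₂, S₁₂, σ₁, c₁, σ₂, c₂⟩ ⟨z1, z2, -, -, hσ₁, -, hσ₂, w, p1, p2, g1⟩
      ⟨S₁', S₂', S₁₂', σ₁', c₁', σ₂', c₂'⟩ ⟨z1', z2', -, -, -, -, -, w', p1', p2', g1'⟩ e1 e2
    simp only at *
    subst e1 e2 z1 z2 z1' z2'
    have hc₁ : c₁ = c₁' := gam_injective hN₁ hN₂ hh₁₁ hh₂₂ hh₁₂ hh₂₁ hσ₁ hσ₂ g1 g1'
    have hS : S₁₂ = S₁₂' := mul_right_cancel₀ hσ₂.ne' (p2.symm.trans p2')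
    subst hc₁ hS
    have : S₁ = S₁' := by linarith
    rw [this]

open Polynomial in
lemma encard_fiber_le {T : Set BandParams} (hT : EliminatesToσ₂ T) {s : ℝ} (hs : 0 < s) :
    {t ∈ T | t.σ₂ = s}.encard ≤ 4 := by
  obtain ⟨⟨k, hk⟩, hinj⟩ := hT
  obtain ⟨⟨i, hi⟩, hroot⟩ := hk s hs
  let p : ℝ[X] := ∑ j : Fin 5, C ((k j).eval s) * X ^ (j : ℕ)
  have hcoeff : p.coeff i = (k i).eval s := by
    simp only [p, finsetSum_coeff, coeff_C_mul, coeff_X_pow]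
    rw [Finset.sum_eq_single i]
    · simp
    · intro j _ hj
      have : (i : ℕ) ≠ j := fun h => hj (Fin.ext h.symm)
      simp [this]
    · simp
  have hp : p ≠ 0 := fun h => hi (by rw [← hcoeff, h, coeff_zero])
  have hdeg : p.natDegree ≤ 4 := by
    refine natDegree_sum_le_of_forall_le _ _ fun j _ => ?_
    exact (natDegree_C_mul_X_pow_le _ _).trans (by have := j.2; omega)
  have hmaps : Set.MapsTo BandParams.σ₁ {t ∈ T | t.σ₂ = s} (p.roots.toFinset : Set ℝ) := by
    rintro t ⟨ht, hts⟩
    rw [Finset.mem_coe, Multiset.mem_toFinset, mem_roots hp, IsRoot.def]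
    have := hroot t ht hts
    simpa [p, eval_finsetSum] using this
  have hinj' : Set.InjOn BandParams.σ₁ {t ∈ T | t.σ₂ = s} := by
    rintro t ⟨ht, hts⟩ t' ⟨ht', hts'⟩ e
    exact hinj t ht t' ht' e (hts.trans hts'.symm)
  refine (Set.encard_le_encard_of_injOn hmaps hinj').trans ?_
  rw [Set.encard_coe_eq_coe_finsetCard]
  exact_mod_cast (Multiset.toFinset_card_le _).trans ((card_roots' p).trans hdeg)

/-- Each of the three systems contributes at most four roots `σ₁`, so even twelve would do. -/
lemma encard_partialSolutions_le (ch : FlatChannel) {s : ℝ} (hs : 0 < s) :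
    {t ∈ PartialSolutions ch | t.σ₂ = s}.encard ≤ 16 := by
  have e : {t ∈ PartialSolutions ch | t.σ₂ = s} = ({t ∈ RegularThreeBand ch | t.σ₂ = s} ∪
      {t ∈ NoExclusive₁ ch | t.σ₂ = s}) ∪ {t ∈ NoExclusive₂ ch | t.σ₂ = s} := by
    ext t
    simp only [PartialSolutions, Set.mem_union, Set.mem_ofPred_eq]
    tauto
  rw [e]
  calc _ ≤ ({t ∈ RegularThreeBand ch | t.σ₂ = s} ∪ {t ∈ NoExclusive₁ ch | t.σ₂ = s}).encard +
        {t ∈ NoExclusive₂ ch | t.σ₂ = s}.encard := Set.encard_union_le _ _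
    _ ≤ {t ∈ RegularThreeBand ch | t.σ₂ = s}.encard + {t ∈ NoExclusive₁ ch | t.σ₂ = s}.encard +
        {t ∈ NoExclusive₂ ch | t.σ₂ = s}.encard := by
      gcongr
      exact Set.encard_union_le _ _
    _ ≤ 4 + 4 + 4 := add_le_add (add_le_add
      (encard_fiber_le (eliminatesToσ₂_regularThreeBand ch) hs)
      (encard_fiber_le (eliminatesToσ₂_noExclusive₁ ch) hs))
      (encard_fiber_le (eliminatesToσ₂_noExclusive₂ ch) hs)
    _ ≤ 16 := by norm_num

/-! ### Weak duality, complementary slackness and the bands of an optimum -/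

section Measure

variable {ch : FlatChannel} {p : PSDPair} {l₁ l₂ c : ℝ}

lemma isPSD_iff {W P : ℝ} (hW : 0 < W) {f : ℝ → ℝ} :
    IsPSD W P f ↔ (∀ x ∈ Set.Icc 0 W, 0 ≤ f x) ∧ IntegrableOn f (Set.Icc 0 W) ∧
      ∫ x in Set.Icc 0 W, f x ≤ P := by
  unfold IsPSD
  rw [intervalIntegral.integral_of_le hW.le, integral_Icc_eq_integral_Ioc]

lemma integrableOn_log_user (ch : FlatChannel) {f g : ℝ → ℝ}
    (hf : ∀ x ∈ Set.Icc 0 ch.W, 0 ≤ f x) (hg : ∀ x ∈ Set.Icc 0 ch.W, 0 ≤ g x)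
    (hfi : IntegrableOn f (Set.Icc 0 ch.W)) (hgi : IntegrableOn g (Set.Icc 0 ch.W)) :
    IntegrableOn (fun x => Real.log (1 + f x * ch.h₁₁ / (g x * ch.h₂₁ + ch.N₁)))
      (Set.Icc 0 ch.W) := by
  have h1 := ch.h₁₁_pos
  have h3 := ch.N₁_pos
  refine Integrable.mono' (g := fun x => f x * (ch.h₁₁ / ch.N₁)) (hfi.mul_const _) ?_ ?_
  · have m1 := hfi.aestronglyMeasurable.aemeasurable
    have m2 := hgi.aestronglyMeasurable.aemeasurable
    exact (Real.measurable_log.comp_aemeasurable (((m1.mul_const _).div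
      ((m2.mul_const _).add_const _)).const_add 1)).aestronglyMeasurable
  · refine (ae_restrict_iff' measurableSet_Icc).2 (Filter.Eventually.of_forall fun x hx => ?_)
    rw [Real.norm_of_nonneg (log_user_nonneg ch (hf x hx) (hg x hx)), ← mul_div_assoc]
    refine (log_user_le ch (hf x hx) (hg x hx)).trans ?_
    have := hf x hx
    refine (Real.log_le_sub_one_of_pos (by positivity)).trans (by linarith)

lemma rate_le (ch : FlatChannel) {x y : ℝ} (hx : 0 ≤ x) (hy : 0 ≤ y) :
    rate ch x y ≤ x * (ch.h₁₁ / ch.N₁) + y * (ch.h₂₂ / ch.N₂) := by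
  have h1 := ch.h₁₁_pos
  have h2 := ch.N₂_pos
  have h3 := ch.N₁_pos
  have h6 := ch.h₂₂_pos
  have e1 := log_user_le ch hx hy
  have e2 : Real.log (1 + y * ch.h₂₂ / (x * ch.h₁₂ + ch.N₂)) ≤ Real.log (1 + y * ch.h₂₂ / ch.N₂) :=
    log_user_le ch.swap hy hx
  have e3 := Real.log_le_sub_one_of_pos (show 0 < 1 + x * ch.h₁₁ / ch.N₁ by positivity)
  have e4 := Real.log_le_sub_one_of_pos (show 0 < 1 + y * ch.h₂₂ / ch.N₂ by positivity)
  unfold rate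
  rw [← mul_div_assoc, ← mul_div_assoc]
  linarith

lemma rate_nonneg (ch : FlatChannel) {x y : ℝ} (hx : 0 ≤ x) (hy : 0 ≤ y) : 0 ≤ rate ch x y :=
  add_nonneg (log_user_nonneg ch hx hy) (log_user_nonneg ch.swap hy hx)

lemma Feasible_iff (ch : FlatChannel) (p : PSDPair) : Feasible ch p ↔
    ((∀ x ∈ Set.Icc 0 ch.W, 0 ≤ p.p₁ x) ∧ IntegrableOn p.p₁ (Set.Icc 0 ch.W) ∧
      ∫ x in Set.Icc 0 ch.W, p.p₁ x ≤ ch.P₁) ∧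
    ((∀ x ∈ Set.Icc 0 ch.W, 0 ≤ p.p₂ x) ∧ IntegrableOn p.p₂ (Set.Icc 0 ch.W) ∧
      ∫ x in Set.Icc 0 ch.W, p.p₂ x ≤ ch.P₂) := by
  unfold Feasible
  rw [isPSD_iff ch.W_pos, isPSD_iff ch.W_pos]

lemma integrableOn_rate (hp : Feasible ch p) :
    IntegrableOn (fun x => rate ch (p.p₁ x) (p.p₂ x)) (Set.Icc 0 ch.W) := by
  obtain ⟨⟨n1, i1, -⟩, ⟨n2, i2, -⟩⟩ := (Feasible_iff ch p).1 hp
  exact (integrableOn_log_user ch n1 n2 i1 i2).add (integrableOn_log_user ch.swap n2 n1 i2 i1)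

lemma capacity_eq_integral_rate (hp : Feasible ch p) :
    capacity ch p = ∫ x in Set.Icc 0 ch.W, rate ch (p.p₁ x) (p.p₂ x) := by
  obtain ⟨⟨n1, i1, -⟩, ⟨n2, i2, -⟩⟩ := (Feasible_iff ch p).1 hp
  unfold capacity rate
  rw [intervalIntegral.integral_of_le ch.W_pos.le, intervalIntegral.integral_of_le ch.W_pos.le,
    ← integral_Icc_eq_integral_Ioc, ← integral_Icc_eq_integral_Ioc]
  exact (integral_add (integrableOn_log_user ch n1 n2 i1 i2)
    (integrableOn_log_user ch.swap n2 n1 i2 i1)).symm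

lemma integrableOn_affine (hp : Feasible ch p) (l₁ l₂ c : ℝ) :
    IntegrableOn (fun x => l₁ * p.p₁ x + l₂ * p.p₂ x + c) (Set.Icc 0 ch.W) := by
  obtain ⟨⟨-, i1, -⟩, ⟨-, i2, -⟩⟩ := (Feasible_iff ch p).1 hp
  have : IntegrableOn (fun _ : ℝ => c) (Set.Icc 0 ch.W) := integrableOn_const (by simp)
  exact ((i1.const_mul l₁).add (i2.const_mul l₂)).add this

lemma integral_affine (hp : Feasible ch p) (l₁ l₂ c : ℝ) :
    ∫ x in Set.Icc 0 ch.W, (l₁ * p.p₁ x + l₂ * p.p₂ x + c) =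
      l₁ * (∫ x in Set.Icc 0 ch.W, p.p₁ x) + l₂ * (∫ x in Set.Icc 0 ch.W, p.p₂ x) +
        c * ch.W := by
  obtain ⟨⟨-, i1, -⟩, ⟨-, i2, -⟩⟩ := (Feasible_iff ch p).1 hp
  have : IntegrableOn (fun _ : ℝ => c) (Set.Icc 0 ch.W) := integrableOn_const (by simp)
  have e1 := integral_add (f := fun x => l₁ * p.p₁ x + l₂ * p.p₂ x)
    ((i1.const_mul l₁).add (i2.const_mul l₂)) this
  have e2 := integral_add (i1.const_mul l₁) (i2.const_mul l₂)
  rw [e1, e2, integral_const_mul, integral_const_mul, setIntegral_const]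
  simp [ch.W_pos.le, mul_comm]

/-- Weak duality. -/
lemma capacity_le (hl₁ : 0 < l₁) (hl₂ : 0 < l₂) (h : AffineMajorant (rate ch) l₁ l₂ c)
    (hp : Feasible ch p) : capacity ch p ≤ l₁ * ch.P₁ + l₂ * ch.P₂ + c * ch.W := by
  obtain ⟨⟨n1, i1, b1⟩, ⟨n2, i2, b2⟩⟩ := (Feasible_iff ch p).1 hp
  rw [capacity_eq_integral_rate hp]
  have := setIntegral_mono_on (integrableOn_rate hp) (integrableOn_affine hp l₁ l₂ c)
    measurableSet_Icc (fun x hx => h _ _ (n1 x hx) (n2 x hx))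
  rw [integral_affine hp] at this
  have k1 := mul_le_mul_of_nonneg_left b1 hl₁.le
  have k2 := mul_le_mul_of_nonneg_left b2 hl₂.le
  linarith

/-- Complementary slackness. -/
lemma touch_of_le_capacity (hl₁ : 0 < l₁) (hl₂ : 0 < l₂)
    (h : AffineMajorant (rate ch) l₁ l₂ c) (hp : Feasible ch p)
    (hopt : l₁ * ch.P₁ + l₂ * ch.P₂ + c * ch.W ≤ capacity ch p) :
    (∫ x in Set.Icc 0 ch.W, p.p₁ x = ch.P₁) ∧ (∫ x in Set.Icc 0 ch.W, p.p₂ x = ch.P₂) ∧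
      ∀ᵐ x, x ∈ Set.Icc 0 ch.W → (p.p₁ x, p.p₂ x) ∈ touchSet (rate ch) l₁ l₂ c := by
  obtain ⟨⟨n1, i1, b1⟩, ⟨n2, i2, b2⟩⟩ := (Feasible_iff ch p).1 hp
  rw [capacity_eq_integral_rate hp] at hopt
  have hle := setIntegral_mono_on (integrableOn_rate hp) (integrableOn_affine hp l₁ l₂ c)
    measurableSet_Icc (fun x hx => h _ _ (n1 x hx) (n2 x hx))
  have haff := integral_affine hp l₁ l₂ c
  have k1 := mul_le_mul_of_nonneg_left b1 hl₁.le
  have k2 := mul_le_mul_of_nonneg_left b2 hl₂.le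
  refine ⟨?_, ?_, ?_⟩
  · exact mul_left_cancel₀ hl₁.ne' (by linarith)
  · exact mul_left_cancel₀ hl₂.ne' (by linarith)
  · have hz : ∫ x in Set.Icc 0 ch.W, ((l₁ * p.p₁ x + l₂ * p.p₂ x + c) -
        rate ch (p.p₁ x) (p.p₂ x)) = 0 := by
      rw [integral_sub (integrableOn_affine hp l₁ l₂ c) (integrableOn_rate hp)]
      linarith
    rw [setIntegral_eq_zero_iff_of_nonneg_ae] at hz
    · have := (ae_restrict_iff' measurableSet_Icc).1 hz
      filter_upwards [this] with x hx hxI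
      have e := hx hxI
      simp only [Pi.zero_apply] at e
      exact ⟨n1 x hxI, n2 x hxI, by simp only; linarith⟩
    · refine (ae_restrict_iff' measurableSet_Icc).2 (Filter.Eventually.of_forall fun x hx => ?_)
      exact sub_nonneg.2 (h _ _ (n1 x hx) (n2 x hx))
    · exact (integrableOn_affine hp l₁ l₂ c).sub (integrableOn_rate hp)

/-- An integrable density is measurable only up to a null set, so the parts of the spectrum are
merely null measurable. -/
lemma nullMeasurableSet_usedSpectrum (ch : FlatChannel) {f : ℝ → ℝ}
    (hf : IntegrableOn f (Set.Icc 0 ch.W)) : NullMeasurableSet (usedSpectrum ch f) := by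
  have h1 : AEMeasurable (Set.indicator (Set.Icc 0 ch.W) f) :=
    (aemeasurable_indicator_iff measurableSet_Icc).2 hf.aestronglyMeasurable.aemeasurable
  have h2 : usedSpectrum ch f = {x | 0 < Set.indicator (Set.Icc 0 ch.W) f x} := by
    ext x
    by_cases hx : x ∈ Set.Icc 0 ch.W
    · simp only [usedSpectrum, Set.mem_ofPred_eq, Set.indicator_of_mem hx, hx, true_and]
    · simp only [usedSpectrum, Set.mem_ofPred_eq, Set.indicator_of_notMem hx, hx, false_and,
        lt_irrefl]
  rw [h2]
  exact nullMeasurableSet_lt aemeasurable_const h1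

lemma volume_ne_top_of_subset_Icc {W : ℝ} {s : Set ℝ} (hs : s ⊆ Set.Icc 0 W) : volume s ≠ ⊤ :=
  ne_top_of_le_ne_top (by simp) (measure_mono hs)

lemma integral_eq_of_two_values {W u v : ℝ} {f : ℝ → ℝ} {s t : Set ℝ} (hs : s ⊆ Set.Icc 0 W)
    (ht : t ⊆ Set.Icc 0 W) (hsm : NullMeasurableSet s) (htm : NullMeasurableSet t)
    (hf : ∀ᵐ x, x ∈ Set.Icc 0 W → f x = s.indicator (fun _ => u) x + t.indicator (fun _ => v) x) :
    ∫ x in Set.Icc 0 W, f x = volume.real s * u + volume.real t * v := by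
  have ints : Integrable (s.indicator (fun _ => u)) :=
    (integrableOn_const (volume_ne_top_of_subset_Icc hs)).integrable_indicator₀ hsm
  have intt : Integrable (t.indicator (fun _ => v)) :=
    (integrableOn_const (volume_ne_top_of_subset_Icc ht)).integrable_indicator₀ htm
  rw [← integral_indicator measurableSet_Icc]
  have : (Set.Icc 0 W).indicator f =ᵐ[volume]
      fun x => s.indicator (fun _ => u) x + t.indicator (fun _ => v) x := by
    filter_upwards [hf] with x hx
    by_cases hxI : x ∈ Set.Icc 0 W
    · rw [Set.indicator_of_mem hxI, hx hxI]
    · rw [Set.indicator_of_notMem hxI, Set.indicator_of_notMem fun h => hxI (hs h),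
        Set.indicator_of_notMem fun h => hxI (ht h), add_zero]
  rw [integral_congr_ae this, integral_add ints intt, integral_indicator₀ hsm,
    integral_indicator₀ htm, setIntegral_const, setIntegral_const, smul_eq_mul, smul_eq_mul]

/-- The bands of an optimal solution. -/
lemma optimalBands_of_le_capacity (hl₁ : 0 < l₁) (hl₂ : 0 < l₂) (hc : 0 < c)
    (h : AffineMajorant (rate ch) l₁ l₂ c) (hp : Feasible ch p)
    (hopt : l₁ * ch.P₁ + l₂ * ch.P₂ + c * ch.W ≤ capacity ch p) :
    ∃ x y q₁ q₂, OptimalBands ch l₁ l₂ c (volume.real (excl₁ ch p)) (volume.real (excl₂ ch p))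
        (volume.real (shared ch p)) x y q₁ q₂ ∧
      (∀ᵐ z, z ∈ excl₁ ch p → p.p₁ z = x) ∧ (∀ᵐ z, z ∈ excl₂ ch p → p.p₂ z = y) ∧
      (volume.real (shared ch p) * q₁ = ∫ z in shared ch p, p.p₁ z) ∧
      (volume.real (shared ch p) * q₂ = ∫ z in shared ch p, p.p₂ z) := by
  obtain ⟨x, y, q₁, q₂, hz⟩ := exists_touchSet_rate_densities hl₁ hl₂ h hc
  obtain ⟨e1, e2, hae⟩ := touch_of_le_capacity hl₁ hl₂ h hp hopt
  obtain ⟨⟨n1, i1, -⟩, ⟨n2, i2, -⟩⟩ := (Feasible_iff ch p).1 hp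
  have m1 := nullMeasurableSet_usedSpectrum ch i1
  have m2 := nullMeasurableSet_usedSpectrum ch i2
  have mE1 : NullMeasurableSet (excl₁ ch p) := m1.diff m2
  have mE2 : NullMeasurableSet (excl₂ ch p) := m2.diff m1
  have mS : NullMeasurableSet (shared ch p) := m1.inter m2
  have sE1 : excl₁ ch p ⊆ Set.Icc 0 ch.W := fun z hz => hz.1.1
  have sE2 : excl₂ ch p ⊆ Set.Icc 0 ch.W := fun z hz => hz.1.1
  have sS : shared ch p ⊆ Set.Icc 0 ch.W := fun z hz => hz.1.1
  have memE1 : ∀ z ∈ Set.Icc 0 ch.W, (z ∈ excl₁ ch p ↔ 0 < p.p₁ z ∧ ¬ 0 < p.p₂ z) := by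
    intro z hz
    simp only [excl₁, usedSpectrum, Set.mem_sdiff, Set.mem_ofPred_eq, hz, true_and]
  have memE2 : ∀ z ∈ Set.Icc 0 ch.W, (z ∈ excl₂ ch p ↔ 0 < p.p₂ z ∧ ¬ 0 < p.p₁ z) := by
    intro z hz
    simp only [excl₂, usedSpectrum, Set.mem_sdiff, Set.mem_ofPred_eq, hz, true_and]
  have memS : ∀ z ∈ Set.Icc 0 ch.W, (z ∈ shared ch p ↔ 0 < p.p₁ z ∧ 0 < p.p₂ z) := by
    intro z hz
    simp only [shared, usedSpectrum, Set.mem_inter_iff, Set.mem_ofPred_eq, hz, true_and]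
  -- As the origin is not a touching point, almost every frequency lies in exactly one of the three
  -- parts, and the touching point there is unique.
  have tri : ∀ᵐ z, z ∈ Set.Icc 0 ch.W →
      (rate ch (p.p₁ z) (p.p₂ z) = l₁ * p.p₁ z + l₂ * p.p₂ z + c) ∧
      ((z ∈ excl₁ ch p ∧ z ∉ excl₂ ch p ∧ z ∉ shared ch p ∧ p.p₁ z = x ∧ p.p₂ z = 0) ∨
      (z ∉ excl₁ ch p ∧ z ∈ excl₂ ch p ∧ z ∉ shared ch p ∧ p.p₁ z = 0 ∧ p.p₂ z = y) ∨
      (z ∉ excl₁ ch p ∧ z ∉ excl₂ ch p ∧ z ∈ shared ch p ∧ p.p₁ z = q₁ ∧ p.p₂ z = q₂)) := by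
    filter_upwards [hae] with z hz' hzI
    refine ⟨(hz' hzI).2.2, ?_⟩
    rw [memE1 z hzI, memE2 z hzI, memS z hzI]
    rcases hz _ (hz' hzI) with ⟨h1, h2, h3⟩ | ⟨h1, h2, h3⟩ | ⟨h1, h2, h3, h4⟩
    · simp only at h1 h2 h3
      exact Or.inl ⟨⟨h1, by simp [h2]⟩, fun h => absurd h2 h.1.ne', fun h => absurd h2 h.2.ne',
        h3, h2⟩
    · simp only at h1 h2 h3
      exact Or.inr (Or.inl ⟨fun h => absurd h1 h.1.ne', ⟨h2, by simp [h1]⟩,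
        fun h => absurd h1 h.1.ne', h1, h3⟩)
    · simp only at h1 h2 h3 h4
      right; right
      refine ⟨fun h => h.2 h2, fun h => h.2 h1, ⟨h1, h2⟩, h3, h4⟩
  have exists_of_pos : ∀ {s : Set ℝ} {Q : ℝ → Prop}, 0 < volume.real s → s ⊆ Set.Icc 0 ch.W →
      (∀ᵐ z, z ∈ Set.Icc 0 ch.W → Q z) → ∃ z ∈ s, Q z := by
    intro s Q hs hsI hQ
    by_contra! hcon
    have : volume s = 0 := by
      refine measure_mono_null (fun z hz => ?_) hQ
      exact fun h => hcon z hz (h (hsI hz))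
    rw [measureReal_def, this] at hs
    simp at hs
  refine ⟨x, y, q₁, q₂, ⟨measureReal_nonneg, measureReal_nonneg, measureReal_nonneg, ?_, ?_, ?_,
    ?_, ?_, ?_⟩, ?_, ?_, ?_, ?_⟩
  -- The widths add up to `W` by integrating the constant `1`, split into the exclusive parts and
  -- the shared part.
  · have hd : ∀ᵐ z, z ∈ Set.Icc 0 ch.W → (1 : ℝ) = (excl₁ ch p ∪ excl₂ ch p).indicator
        (fun _ => 1) z + (shared ch p).indicator (fun _ => 1) z := by
      filter_upwards [tri] with z hz hzI
      rcases (hz hzI).2 with ⟨h1, h2, h3, -⟩ | ⟨h1, h2, h3, -⟩ | ⟨h1, h2, h3, -⟩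
      · simp [h1, h3]
      · simp [h2, h3]
      · simp [h1, h2, h3]
    have := integral_eq_of_two_values (Set.union_subset sE1 sE2) sS (mE1.union mE2) mS hd
    rw [setIntegral_const, measureReal_union₀ mE2
      (Set.disjoint_left.2 fun z hz hz' => hz.2 hz'.1 : Disjoint _ _).aedisjoint
      (volume_ne_top_of_subset_Icc sE1) (volume_ne_top_of_subset_Icc sE2)] at this
    simpa [ch.W_pos.le] using this
  · rw [← e1]
    refine integral_eq_of_two_values sE1 sS mE1 mS ?_
    filter_upwards [tri] with z hz hzI
    rcases (hz hzI).2 with ⟨h1, h2, h3, h4, -⟩ | ⟨h1, h2, h3, h4, -⟩ | ⟨h1, h2, h3, h4, -⟩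
    · simp [h1, h3, h4]
    · simp [h1, h3, h4]
    · simp [h1, h3, h4]
  · rw [← e2]
    refine integral_eq_of_two_values sE2 sS mE2 mS ?_
    filter_upwards [tri] with z hz hzI
    rcases (hz hzI).2 with ⟨h1, h2, h3, -, h4⟩ | ⟨h1, h2, h3, -, h4⟩ | ⟨h1, h2, h3, -, h4⟩
    · simp [h2, h3, h4]
    · simp [h2, h3, h4]
    · simp [h2, h3, h4]
  · intro hpos
    obtain ⟨z, hzE, hz⟩ := exists_of_pos hpos sE1 tri
    obtain ⟨e, ⟨h1, h2, h3, h4, h5⟩ | ⟨h1, -⟩ | ⟨h1, -⟩⟩ := hz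
    · rw [h4, h5] at e
      exact ⟨h4 ▸ hzE.1.2, e⟩
    · exact absurd hzE h1
    · exact absurd hzE h1
  · intro hpos
    obtain ⟨z, hzE, hz⟩ := exists_of_pos hpos sE2 tri
    obtain ⟨e, ⟨-, h1, -⟩ | ⟨h1, h2, h3, h4, h5⟩ | ⟨-, h1, -⟩⟩ := hz
    · exact absurd hzE h1
    · rw [h4, h5] at e
      exact ⟨h5 ▸ hzE.1.2, e⟩
    · exact absurd hzE h1
  · intro hpos
    obtain ⟨z, hzE, hz⟩ := exists_of_pos hpos sS tri
    obtain ⟨e, ⟨-, -, h1, -⟩ | ⟨-, -, h1, -⟩ | ⟨h1, h2, h3, h4, h5⟩⟩ := hz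
    · exact absurd hzE h1
    · exact absurd hzE h1
    · rw [h4, h5] at e
      exact ⟨h4 ▸ hzE.1.2, h5 ▸ hzE.2.2, e⟩
  · filter_upwards [tri] with z hz hzE
    rcases (hz (sE1 hzE)).2 with ⟨h1, h2, h3, h4, h5⟩ | ⟨h1, -⟩ | ⟨h1, -⟩
    exacts [h4, absurd hzE h1, absurd hzE h1]
  · filter_upwards [tri] with z hz hzE
    rcases (hz (sE2 hzE)).2 with ⟨-, h1, -⟩ | ⟨h1, h2, h3, h4, h5⟩ | ⟨-, h1, -⟩
    exacts [absurd hzE h1, h5, absurd hzE h1]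
  · rw [← smul_eq_mul, ← setIntegral_const]
    refine integral_congr_ae ((ae_restrict_iff'₀ mS).2 ?_)
    filter_upwards [tri] with z hz hzE
    rcases (hz (sS hzE)).2 with ⟨-, -, h1, -⟩ | ⟨-, -, h1, -⟩ | ⟨h1, h2, h3, h4, h5⟩
    exacts [absurd hzE h1, absurd hzE h1, h4.symm]
  · rw [← smul_eq_mul, ← setIntegral_const]
    refine integral_congr_ae ((ae_restrict_iff'₀ mS).2 ?_)
    filter_upwards [tri] with z hz hzE
    rcases (hz (sS hzE)).2 with ⟨-, -, h1, -⟩ | ⟨-, -, h1, -⟩ | ⟨h1, h2, h3, h4, h5⟩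
    exacts [absurd hzE h1, absurd hzE h1, h5.symm]

end Measure

/-! ### Contiguous layouts and their capacities -/

section Layout

lemma step_eq_indicator {a b : ℝ} (hab : a ≤ b) (u v w x : ℝ) :
    (if x < a then u else if x < b then v else w) =
      w + (Set.Iio b).indicator (fun _ => v - w) x + (Set.Iio a).indicator (fun _ => u - v) x := by
  by_cases h1 : x < a
  · have h2 : x < b := h1.trans_le hab
    simp [h1, h2]
  · by_cases h2 : x < b
    · simp [h1, h2]
    · simp [h1, h2]

lemma integrableOn_step {a b W : ℝ} (hab : a ≤ b) (u v w : ℝ) :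
    IntegrableOn (fun x => if x < a then u else if x < b then v else w) (Set.Icc 0 W) := by
  simp_rw [step_eq_indicator hab]
  have k : ∀ k : ℝ, IntegrableOn (fun _ : ℝ => k) (Set.Icc 0 W) := fun k =>
    integrableOn_const (by simp)
  exact ((k w).add ((k (v - w)).indicator measurableSet_Iio)).add
    ((k (u - v)).indicator measurableSet_Iio)

lemma integral_step {a b W : ℝ} (ha : 0 ≤ a) (hab : a ≤ b) (hb : b ≤ W) (u v w : ℝ) :
    ∫ x in Set.Icc 0 W, (if x < a then u else if x < b then v else w) =
      a * u + (b - a) * v + (W - b) * w := by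
  simp_rw [step_eq_indicator hab]
  have k : ∀ k : ℝ, IntegrableOn (fun _ : ℝ => k) (Set.Icc 0 W) := fun k =>
    integrableOn_const (by simp)
  have hI : ∀ d, 0 ≤ d → d ≤ W → Set.Icc 0 W ∩ Set.Iio d = Set.Ico 0 d := by
    intro d h0 hd
    ext x
    simp only [Set.mem_inter_iff, Set.mem_Icc, Set.mem_Iio, Set.mem_Ico]
    exact ⟨fun h => ⟨h.1.1, h.2⟩, fun h => ⟨⟨h.1, by linarith [h.2]⟩, h.2⟩⟩
  have e1 := integral_add ((k w).add ((k (v - w)).indicator (measurableSet_Iio (a := b))))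
    ((k (u - v)).indicator (measurableSet_Iio (a := a)))
  have e2 := integral_add (k w) ((k (v - w)).indicator (measurableSet_Iio (a := b)))
  simp only [Pi.add_apply] at e1
  rw [e1, e2, setIntegral_indicator measurableSet_Iio, setIntegral_indicator measurableSet_Iio,
    hI a ha (hab.trans hb), hI b (ha.trans hab) hb, setIntegral_const, setIntegral_const,
    setIntegral_const, Real.volume_real_Icc_of_le (by linarith), Real.volume_real_Ico_of_le ha,
    Real.volume_real_Ico_of_le (ha.trans hab)]
  simp only [smul_eq_mul]
  ring

/-- Band parameters of a solution with at most three bands. -/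
structure IsBandSolution (ch : FlatChannel) (t : BandParams) : Prop where
  S₁_nonneg : 0 ≤ t.S₁
  S₂_nonneg : 0 ≤ t.S₂
  S₁₂_nonneg : 0 ≤ t.S₁₂
  width : ch.W = t.S₁ + t.S₂ + t.S₁₂
  σ₁_nonneg : 0 ≤ t.σ₁
  σ₂_nonneg : 0 ≤ t.σ₂
  c₁_nonneg : 0 ≤ t.c₁
  c₂_nonneg : 0 ≤ t.c₂
  power₁ : t.S₁ * (t.σ₁ + t.c₁) + t.S₁₂ * t.σ₁ ≤ ch.P₁
  power₂ : t.S₂ * (t.σ₂ + t.c₂) + t.S₁₂ * t.σ₂ ≤ ch.P₂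

namespace IsBandSolution

variable {ch : FlatChannel} {t : BandParams}

lemma feasible (ht : IsBandSolution ch t) : Feasible ch (layout t) := by
  have hab : t.S₁ ≤ t.S₁ + t.S₁₂ := by linarith [ht.S₁₂_nonneg]
  have hb : t.S₁ + t.S₁₂ ≤ ch.W := by linarith [ht.width, ht.S₂_nonneg]
  have h1 := ht.σ₁_nonneg
  have h2 := ht.σ₂_nonneg
  have h3 := ht.c₁_nonneg
  have h4 := ht.c₂_nonneg
  rw [Feasible_iff]
  refine ⟨⟨fun x _ => ?_, integrableOn_step hab _ _ _, ?_⟩,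
    ⟨fun x _ => ?_, integrableOn_step hab _ _ _, ?_⟩⟩
  · simp only [layout]
    split_ifs <;> positivity
  · refine (integral_step ht.S₁_nonneg hab hb _ _ _).trans_le ?_
    linarith [ht.power₁]
  · simp only [layout]
    split_ifs <;> positivity
  · refine (integral_step ht.S₁_nonneg hab hb _ _ _).trans_le ?_
    have := ht.power₂
    rw [ht.width]
    linarith

lemma capacity_layout (ht : IsBandSolution ch t) :
    capacity ch (layout t) = bandCapacity ch t := by
  have hab : t.S₁ ≤ t.S₁ + t.S₁₂ := by linarith [ht.S₁₂_nonneg]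
  have hb : t.S₁ + t.S₁₂ ≤ ch.W := by linarith [ht.width, ht.S₂_nonneg]
  rw [capacity_eq_integral_rate ht.feasible, bandCapacity_eq_rate]
  have : ∀ x, rate ch ((layout t).p₁ x) ((layout t).p₂ x) =
      if x < t.S₁ then rate ch (t.σ₁ + t.c₁) 0 else
        if x < t.S₁ + t.S₁₂ then rate ch t.σ₁ t.σ₂ else rate ch 0 (t.σ₂ + t.c₂) := by
    intro x
    simp only [layout]
    split_ifs <;> rfl
  simp_rw [this]
  rw [integral_step ht.S₁_nonneg hab hb, ht.width]
  ring

lemma partiallyOverlapping (ht : IsBandSolution ch t) (hS₁₂ : 0 < t.S₁₂) (hσ₁ : 0 < t.σ₁)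
    (hσ₂ : 0 < t.σ₂) (hS : 0 < t.S₁ ∨ 0 < t.S₂) : PartiallyOverlapping ch (layout t) := by
  have h1 := ht.S₁_nonneg
  have h2 := ht.S₂_nonneg
  have hc₁ := ht.c₁_nonneg
  have hc₂ := ht.c₂_nonneg
  have hW := ht.width
  have pos_of_subset : ∀ {a b : ℝ} {s : Set ℝ}, a < b → Set.Ico a b ⊆ s → volume s ≠ 0 := by
    intro a b s hab hs h0
    have := measure_mono_null hs h0
    simp at this
    linarith
  refine ⟨pos_of_subset (a := t.S₁) (b := t.S₁ + t.S₁₂) (by linarith) fun x hx => ?_, ?_⟩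
  · have hxI : x ∈ Set.Icc 0 ch.W := ⟨by linarith [hx.1], by linarith [hx.2]⟩
    have n1 : ¬ x < t.S₁ := not_lt.2 hx.1
    refine ⟨⟨hxI, ?_⟩, ⟨hxI, ?_⟩⟩
    · simpa [layout, n1, hx.2] using hσ₁
    · simpa [layout, n1, hx.2] using hσ₂
  · rintro ⟨e1, e2⟩
    rcases hS with hS | hS
    · refine pos_of_subset (a := 0) (b := t.S₁) hS (fun x hx => ?_) e1
      have hxI : x ∈ Set.Icc 0 ch.W := ⟨by linarith [hx.1], by linarith [hx.2]⟩
      refine ⟨⟨hxI, ?_⟩, fun h => ?_⟩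
      · simp only [layout, hx.2, if_true]
        positivity
      · have := h.2
        simp [layout, hx.2] at this
    · refine pos_of_subset (a := t.S₁ + t.S₁₂) (b := ch.W) (by linarith) (fun x hx => ?_) e2
      have hxI : x ∈ Set.Icc 0 ch.W := ⟨by linarith [hx.1], by linarith [hx.2]⟩
      have n1 : ¬ x < t.S₁ := not_lt.2 (by linarith [hx.1])
      have n2 : ¬ x < t.S₁ + t.S₁₂ := not_lt.2 hx.1
      refine ⟨⟨hxI, ?_⟩, fun h => ?_⟩
      · simp only [layout, n1, n2, if_false]
        positivity
      · have := h.2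
        simp [layout, n1, n2] at this

end IsBandSolution

variable {ch : FlatChannel} {t : BandParams}

lemma isBandSolution_and_partiallyOverlapping
    (ht : t ∈ ThreeBand ch ∪ NoExclusive₁ ch ∪ NoExclusive₂ ch) :
    IsBandSolution ch t ∧ PartiallyOverlapping ch (layout t) := by
  rcases ht with (ht | ht) | ht
  · obtain ⟨hS₁, hS₂, hS₁₂, hσ₁, hc₁, hσ₂, hc₂, w, p1, p2, -⟩ := ht
    have hb : IsBandSolution ch t := ⟨hS₁.le, hS₂.le, hS₁₂.le, w, hσ₁.le, hσ₂.le, hc₁.le, hc₂.le,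
      p1.ge, p2.ge⟩
    exact ⟨hb, hb.partiallyOverlapping hS₁₂ hσ₁ hσ₂ (Or.inl hS₁)⟩
  · obtain ⟨hS₁, hc₁, hS₂, hS₁₂, hσ₁, hσ₂, hc₂, w, p1, p2, -⟩ := ht
    have hb : IsBandSolution ch t := ⟨hS₁.ge, hS₂.le, hS₁₂.le, by rw [hS₁, w]; ring, hσ₁.le,
      hσ₂.le, hc₁.ge, hc₂.le, by rw [hS₁, p1]; linarith, p2.ge⟩
    exact ⟨hb, hb.partiallyOverlapping hS₁₂ hσ₁ hσ₂ (Or.inr hS₂)⟩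
  · obtain ⟨hS₂, hc₂, hS₁, hS₁₂, hσ₁, hc₁, hσ₂, w, p1, p2, -⟩ := ht
    have hb : IsBandSolution ch t := ⟨hS₁.le, hS₂.ge, hS₁₂.le, by rw [hS₂, w]; ring, hσ₁.le,
      hσ₂.le, hc₁.le, hc₂.ge, p1.ge, by rw [hS₂, p2]; linarith⟩
    exact ⟨hb, hb.partiallyOverlapping hS₁₂ hσ₁ hσ₂ (Or.inl hS₁)⟩

lemma isBandSolution_overlapBands (ch : FlatChannel) : IsBandSolution ch (overlapBands ch) := by
  have hW := ch.W_pos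
  have h1 := ch.P₁_pos
  have h2 := ch.P₂_pos
  refine ⟨le_rfl, le_rfl, hW.le, ?_, ?_, ?_, le_rfl, le_rfl, ?_, ?_⟩
  · simp [overlapBands]
  · simp only [overlapBands]
    positivity
  · simp only [overlapBands]
    positivity
  · simp only [overlapBands]
    exact le_of_eq (by field_simp; ring)
  · simp only [overlapBands]
    exact le_of_eq (by field_simp; ring)

lemma bandCapacity_overlapBands (ch : FlatChannel) :
    bandCapacity ch (overlapBands ch) = overlapCapacity ch := by
  rw [bandCapacity_eq_rate, overlapCapacity_eq_rate]
  simp [overlapBands]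

lemma equalSpectra_overlapBands (ch : FlatChannel) :
    EqualSpectra ch (layout (overlapBands ch)) := by
  have h1 := ch.P₁_pos
  have h2 := ch.P₂_pos
  have hW := ch.W_pos
  constructor
  · convert measure_empty (μ := volume)
    refine Set.eq_empty_of_forall_notMem fun x hx => hx.2 ⟨hx.1.1, ?_⟩
    have : ¬ x < 0 := not_lt.2 hx.1.1.1
    simp only [layout, overlapBands, this, if_false]
    split_ifs <;> positivity
  -- The bands of `layout` are half-open, so at the right endpoint `W` only user 2 is active.
  · refine measure_mono_null (t := {ch.W}) (fun x hx => ?_) (by simp)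
    by_contra hne
    have hlt : x < ch.W := lt_of_le_of_ne hx.1.1.2 hne
    refine hx.2 ⟨hx.1.1, ?_⟩
    have : ¬ x < 0 := not_lt.2 hx.1.1.1
    simp only [layout, overlapBands, this, if_false, zero_add, hlt, if_true]
    positivity

lemma isBandSolution_disjointBands (ch : FlatChannel) : IsBandSolution ch (disjointBands ch) := by
  have hW := ch.W_pos
  have h1 := ch.P₁_pos
  have h2 := ch.P₂_pos
  have h3 := ch.N₁_pos
  have h4 := ch.N₂_pos
  have h5 := ch.h₁₁_pos
  have h6 := ch.h₂₂_pos
  refine ⟨?_, ?_, le_rfl, ?_, le_rfl, le_rfl, ?_, ?_, ?_, ?_⟩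
  · simp only [disjointBands]
    positivity
  · simp only [disjointBands]
    positivity
  · simp only [disjointBands]
    field_simp
    ring
  · simp only [disjointBands]
    positivity
  · simp only [disjointBands]
    positivity
  · simp only [disjointBands, zero_add, zero_mul, add_zero]
    exact le_of_eq (mul_div_cancel₀ _ (by positivity))
  · simp only [disjointBands, zero_add, zero_mul, add_zero]
    exact le_of_eq (mul_div_cancel₀ _ (by positivity))

lemma bandCapacity_disjointBands (ch : FlatChannel) :
    bandCapacity ch (disjointBands ch) = disjointCapacity ch := by
  have hW := ch.W_pos
  have h1 := ch.P₁_pos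
  have h2 := ch.P₂_pos
  have h3 := ch.N₁_pos
  have h4 := ch.N₂_pos
  have h5 := ch.h₁₁_pos
  have h6 := ch.h₂₂_pos
  have w := (isBandSolution_disjointBands ch).width
  obtain ⟨z, hz⟩ : ∃ z, z = (ch.P₁ * ch.h₁₁ / ch.N₁ + ch.P₂ * ch.h₂₂ / ch.N₂) / ch.W := ⟨_, rfl⟩
  have e1 : ((disjointBands ch).σ₁ + (disjointBands ch).c₁) * ch.h₁₁ / ch.N₁ = z := by
    rw [hz]
    simp only [disjointBands, zero_add]
    field_simp
  have e2 : ((disjointBands ch).σ₂ + (disjointBands ch).c₂) * ch.h₂₂ / ch.N₂ = z := by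
    rw [hz]
    simp only [disjointBands, zero_add]
    field_simp
  rw [disjointCapacity_eq ch (z := z) (by rw [hz]; field_simp), bandCapacity, e1, e2, w]
  simp only [disjointBands]
  ring

lemma disjointSpectra_disjointBands (ch : FlatChannel) :
    DisjointSpectra ch (layout (disjointBands ch)) := by
  have : shared ch (layout (disjointBands ch)) = ∅ := by
    refine Set.eq_empty_of_forall_notMem fun x hx => ?_
    have h1 := hx.1.2
    have h2 := hx.2.2
    have e : (disjointBands ch).S₁₂ = 0 := rfl
    by_cases hlt : x < (disjointBands ch).S₁
    · simp [layout, hlt] at h2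
    · simp [layout, hlt, e] at h1
  rw [DisjointSpectra, this, measure_empty]

/-- Solutions with disjoint spectra. -/
lemma capacity_le_disjointCapacity {p : PSDPair} (hp : Feasible ch p)
    (hd : DisjointSpectra ch p) : capacity ch p ≤ disjointCapacity ch := by
  have hW := ch.W_pos
  have h1 := ch.P₁_pos
  have h2 := ch.P₂_pos
  have h3 := ch.N₁_pos
  have h4 := ch.N₂_pos
  have h5 := ch.h₁₁_pos
  have h6 := ch.h₂₂_pos
  obtain ⟨z, hz⟩ : ∃ z, z = (ch.P₁ * ch.h₁₁ / ch.N₁ + ch.P₂ * ch.h₂₂ / ch.N₂) / ch.W := ⟨_, rfl⟩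
  have hz0 : 0 < z := by rw [hz]; positivity
  obtain ⟨⟨n1, i1, b1⟩, ⟨n2, i2, b2⟩⟩ := (Feasible_iff ch p).1 hp
  -- The tangent of `log (1 + ·)` at the common height `z` of the disjoint bands bounds the rate
  -- wherever only one user is active. It need not bound the rate of a shared frequency.
  have tangent : ∀ u, 0 ≤ u → Real.log (1 + u) ≤ u / (1 + z) + (Real.log (1 + z) - z / (1 + z)) := by
    intro u hu
    have := Real.log_le_sub_one_of_pos (show 0 < (1 + u) / (1 + z) by positivity)
    rw [Real.log_div (by positivity) (by positivity)] at this
    have e : (1 + u) / (1 + z) - 1 = u / (1 + z) - z / (1 + z) := by field_simp; ring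
    linarith
  rw [capacity_eq_integral_rate hp]
  have hle := setIntegral_mono_on_ae (integrableOn_rate hp)
    (integrableOn_affine hp (ch.h₁₁ / ch.N₁ / (1 + z)) (ch.h₂₂ / ch.N₂ / (1 + z))
      (Real.log (1 + z) - z / (1 + z))) measurableSet_Icc (by
    have hd' : ∀ᵐ x, x ∉ shared ch p := by
      have : volume {x | ¬ x ∉ shared ch p} = 0 := by simpa [DisjointSpectra] using hd
      exact this
    filter_upwards [hd'] with x hx hxI
    have hx1 := n1 x hxI
    have hx2 := n2 x hxI
    by_cases hp1 : 0 < p.p₁ x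
    · have hp2 : p.p₂ x = 0 := by
        by_contra hne
        exact hx ⟨⟨hxI, hp1⟩, ⟨hxI, lt_of_le_of_ne hx2 (Ne.symm hne)⟩⟩
      rw [hp2, rate_axis]
      have := tangent (p.p₁ x * ch.h₁₁ / ch.N₁) (by positivity)
      refine this.trans (le_of_eq ?_)
      ring
    · have hp1' : p.p₁ x = 0 := le_antisymm (not_lt.1 hp1) hx1
      rw [hp1', ← rate_swap, rate_axis]
      have := tangent (p.p₂ x * ch.h₂₂ / ch.N₂) (by positivity)
      refine this.trans (le_of_eq ?_)
      ring)
  rw [integral_affine hp] at hle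
  refine hle.trans ?_
  rw [disjointCapacity_eq ch (z := z) (by rw [hz]; field_simp)]
  have k1 := mul_le_mul_of_nonneg_left b1 (show 0 ≤ ch.h₁₁ / ch.N₁ / (1 + z) by positivity)
  have k2 := mul_le_mul_of_nonneg_left b2 (show 0 ≤ ch.h₂₂ / ch.N₂ / (1 + z) by positivity)
  have k3 : ch.h₁₁ / ch.N₁ / (1 + z) * ch.P₁ + ch.h₂₂ / ch.N₂ / (1 + z) * ch.P₂ =
      ch.W * (z / (1 + z)) := by
    have : ch.P₁ * ch.h₁₁ / ch.N₁ + ch.P₂ * ch.h₂₂ / ch.N₂ = ch.W * z := by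
      rw [hz]
      field_simp
    rw [← mul_div_assoc, ← this]
    ring
  linarith

end Layout

/-! ### Approximation by equal and by partially overlapping spectra -/

section Density

open Filter Topology

/-- A small perturbation of `p` towards the flat solution; user 2 is silent on `[0, κ ε]`. -/
noncomputable def perturb (ch : FlatChannel) (p : PSDPair) (κ ε : ℝ) : PSDPair where
  p₁ x := (1 - ε) * p.p₁ x + ε * (ch.P₁ / ch.W)
  p₂ x := if x ≤ κ * ε then 0 else (1 - ε) * p.p₂ x + ε * (ch.P₂ / ch.W)

variable {ch : FlatChannel} {p : PSDPair} {κ ε : ℝ}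

lemma mix_isPSD {W P : ℝ} (hW : 0 < W) (hP : 0 < P) {f : ℝ → ℝ}
    (hf : (∀ x ∈ Set.Icc 0 W, 0 ≤ f x) ∧ IntegrableOn f (Set.Icc 0 W) ∧
      ∫ x in Set.Icc 0 W, f x ≤ P) (hε : 0 < ε) (hε' : ε < 1) :
    (∀ x ∈ Set.Icc 0 W, 0 < (1 - ε) * f x + ε * (P / W)) ∧
      (∀ x ∈ Set.Icc 0 W, (1 - ε) * f x + ε * (P / W) ≤ f x + P / W) ∧
      IntegrableOn (fun x => (1 - ε) * f x + ε * (P / W)) (Set.Icc 0 W) ∧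
      ∫ x in Set.Icc 0 W, ((1 - ε) * f x + ε * (P / W)) ≤ P := by
  obtain ⟨n, i, b⟩ := hf
  have k : IntegrableOn (fun _ : ℝ => ε * (P / W)) (Set.Icc 0 W) := integrableOn_const (by simp)
  have hε1 : 0 < 1 - ε := by linarith
  have hPW : 0 < P / W := by positivity
  refine ⟨fun x hx => ?_, fun x hx => ?_, (i.const_mul _).add k, ?_⟩
  · have := n x hx
    positivity
  · have h1 := mul_nonneg hε.le (n x hx)
    have h2 := mul_nonneg hε1.le hPW.le
    linarith
  · rw [integral_add (i.const_mul _) k, integral_const_mul, setIntegral_const,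
      Real.volume_real_Icc_of_le hW.le, sub_zero, smul_eq_mul]
    have h1 := mul_le_mul_of_nonneg_left b hε1.le
    have h2 : W * (ε * (P / W)) = ε * P := by field_simp
    linarith

lemma feasible_perturb (hp : Feasible ch p) (hε : 0 < ε) (hε' : ε < 1) :
    Feasible ch (perturb ch p κ ε) := by
  have hp' := (Feasible_iff ch p).1 hp
  obtain ⟨a1, -, a3, a4⟩ := mix_isPSD ch.W_pos ch.P₁_pos hp'.1 hε hε'
  obtain ⟨b1, -, b3, b4⟩ := mix_isPSD ch.W_pos ch.P₂_pos hp'.2 hε hε'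
  have e : (perturb ch p κ ε).p₂ = (Set.Ioi (κ * ε)).indicator
      (fun x => (1 - ε) * p.p₂ x + ε * (ch.P₂ / ch.W)) := by
    ext x
    by_cases hx : x ≤ κ * ε
    · simp [perturb, hx]
    · rw [Set.indicator_of_mem (show x ∈ Set.Ioi (κ * ε) from not_le.1 hx)]
      simp [perturb, hx]
  have hi : IntegrableOn (perturb ch p κ ε).p₂ (Set.Icc 0 ch.W) := by
    rw [e]
    exact b3.indicator measurableSet_Ioi
  rw [Feasible_iff]
  refine ⟨⟨fun x hx => (a1 x hx).le, a3, a4⟩, ⟨fun x hx => ?_, hi, ?_⟩⟩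
  · simp only [perturb]
    split_ifs
    exacts [le_rfl, (b1 x hx).le]
  · refine (setIntegral_mono_on hi b3 measurableSet_Icc fun x hx => ?_).trans b4
    simp only [perturb]
    split_ifs
    exacts [(b1 x hx).le, le_rfl]

/-- Mixing with the flat solution makes both densities positive. For `κ = 0` user 2 is silent on
`[0, W]` only at the point `0`. -/
lemma equalSpectra_perturb (hp : Feasible ch p) (hε : 0 < ε) (hε' : ε < 1) :
    EqualSpectra ch (perturb ch p 0 ε) := by
  have hp' := (Feasible_iff ch p).1 hp
  obtain ⟨a1, -⟩ := mix_isPSD ch.W_pos ch.P₁_pos hp'.1 hε hε'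
  obtain ⟨b1, -⟩ := mix_isPSD ch.W_pos ch.P₂_pos hp'.2 hε hε'
  constructor
  · refine measure_mono_null (t := {0}) (fun x hx => ?_) (by simp)
    by_contra hne
    have hx0 : ¬ x ≤ 0 * ε := by
      rw [zero_mul, not_le]
      exact lt_of_le_of_ne hx.1.1.1 (Ne.symm hne)
    refine hx.2 ⟨hx.1.1, ?_⟩
    simp only [perturb, hx0, if_false]
    exact b1 x hx.1.1
  · convert measure_empty (μ := volume)
    exact Set.eq_empty_of_forall_notMem fun x hx => hx.2 ⟨hx.1.1, a1 x hx.1.1⟩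

/-- With `κ = W` the silent interval `[0, W ε]` and its complement both have positive length, and
user 1 is active on all of `[0, W]`. -/
lemma partiallyOverlapping_perturb (hp : Feasible ch p) (hε : 0 < ε) (hε' : ε < 1) :
    PartiallyOverlapping ch (perturb ch p ch.W ε) := by
  have hp' := (Feasible_iff ch p).1 hp
  have hW := ch.W_pos
  obtain ⟨a1, -⟩ := mix_isPSD ch.W_pos ch.P₁_pos hp'.1 hε hε'
  obtain ⟨b1, -⟩ := mix_isPSD ch.W_pos ch.P₂_pos hp'.2 hε hε'
  have hWε : ch.W * ε < ch.W := by nlinarith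
  have hWε0 : 0 < ch.W * ε := by positivity
  constructor
  · intro h0
    have hsub : Set.Ioc (ch.W * ε) ch.W ⊆ shared ch (perturb ch p ch.W ε) := by
      intro x hx
      have hxI : x ∈ Set.Icc 0 ch.W := ⟨by linarith [hx.1], hx.2⟩
      refine ⟨⟨hxI, a1 x hxI⟩, ⟨hxI, ?_⟩⟩
      have : ¬ x ≤ ch.W * ε := not_le.2 hx.1
      simp only [perturb, this, if_false]
      exact b1 x hxI
    have := measure_mono_null hsub h0
    rw [Real.volume_Ioc, ENNReal.ofReal_eq_zero] at this
    linarith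
  · rintro ⟨h0, -⟩
    have hsub : Set.Icc 0 (ch.W * ε) ⊆ excl₁ ch (perturb ch p ch.W ε) := by
      intro x hx
      have hxI : x ∈ Set.Icc 0 ch.W := ⟨hx.1, by linarith [hx.2]⟩
      refine ⟨⟨hxI, a1 x hxI⟩, fun h => ?_⟩
      have := h.2
      simp [perturb, hx.2] at this
    have := measure_mono_null hsub h0
    rw [Real.volume_Icc, ENNReal.ofReal_eq_zero] at this
    linarith

lemma tendsto_capacity_perturb (hp : Feasible ch p) (κ : ℝ) {e : ℕ → ℝ} (he : ∀ n, 0 < e n)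
    (he' : ∀ n, e n < 1) (hlim : Tendsto e atTop (𝓝 0)) :
    Tendsto (fun n => capacity ch (perturb ch p κ (e n))) atTop (𝓝 (capacity ch p)) := by
  have hp' := (Feasible_iff ch p).1 hp
  have h3 := ch.N₁_pos
  have h4 := ch.N₂_pos
  have h5 := ch.h₁₁_pos
  have h6 := ch.h₂₂_pos
  have hf : ∀ n, Feasible ch (perturb ch p κ (e n)) := fun n =>
    feasible_perturb hp (he n) (he' n)
  simp_rw [capacity_eq_integral_rate (hf _), capacity_eq_integral_rate hp]
  -- The perturbed densities are at most `pᵢ + Pᵢ / W`, and the rate is at most linear by `rate_le`.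
  refine tendsto_integral_of_dominated_convergence (fun x => (ch.h₁₁ / ch.N₁) * p.p₁ x +
      (ch.h₂₂ / ch.N₂) * p.p₂ x +
      (ch.P₁ / ch.W * (ch.h₁₁ / ch.N₁) + ch.P₂ / ch.W * (ch.h₂₂ / ch.N₂)))
    (fun n => (integrableOn_rate (hf n)).aestronglyMeasurable)
    (integrableOn_affine hp _ _ _) (fun n => ?_) ?_
  · refine (ae_restrict_iff' measurableSet_Icc).2 (Eventually.of_forall fun x hx => ?_)
    obtain ⟨a1, a2, -⟩ := mix_isPSD ch.W_pos ch.P₁_pos hp'.1 (he n) (he' n)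
    obtain ⟨b1, b2, -⟩ := mix_isPSD ch.W_pos ch.P₂_pos hp'.2 (he n) (he' n)
    have hf' := (Feasible_iff ch _).1 (hf n)
    have q1 := hf'.1.1 x hx
    have q2 := hf'.2.1 x hx
    have r1 : (perturb ch p κ (e n)).p₁ x ≤ p.p₁ x + ch.P₁ / ch.W := a2 x hx
    have r2 : (perturb ch p κ (e n)).p₂ x ≤ p.p₂ x + ch.P₂ / ch.W := by
      simp only [perturb]
      split_ifs
      · exact (b1 x hx).le.trans (b2 x hx)
      · exact b2 x hx
    rw [Real.norm_of_nonneg (rate_nonneg ch q1 q2)]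
    refine (rate_le ch q1 q2).trans ?_
    have s1 := mul_le_mul_of_nonneg_right r1 (show 0 ≤ ch.h₁₁ / ch.N₁ by positivity)
    have s2 := mul_le_mul_of_nonneg_right r2 (show 0 ≤ ch.h₂₂ / ch.N₂ by positivity)
    linarith
  -- For `κ ≥ 0` the point `0` stays in the silent interval for every `n`, whereas any fixed `x > 0`
  -- eventually leaves it.
  · have hne : ∀ᵐ x : ℝ, x ≠ 0 := by
      have : volume ({0} : Set ℝ) = 0 := by simp
      exact compl_mem_ae_iff.2 this
    refine (ae_restrict_iff' measurableSet_Icc).2 ?_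
    filter_upwards [hne] with x hx0 hx
    have hxpos : 0 < x := lt_of_le_of_ne hx.1 (Ne.symm hx0)
    have l0 : ∀ u v : ℝ, Tendsto (fun n => (1 - e n) * u + e n * v) atTop (𝓝 u) := by
      intro u v
      have := ((hlim.const_sub 1).mul_const u).add (hlim.mul_const v)
      simpa using this
    have l1 : Tendsto (fun n => (perturb ch p κ (e n)).p₁ x) atTop (𝓝 (p.p₁ x)) := l0 _ _
    have l2 : Tendsto (fun n => (perturb ch p κ (e n)).p₂ x) atTop (𝓝 (p.p₂ x)) := by
      refine (l0 (p.p₂ x) (ch.P₂ / ch.W)).congr' ?_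
      have : Tendsto (fun n => κ * e n) atTop (𝓝 0) := by simpa using hlim.const_mul κ
      filter_upwards [this.eventually_lt_const hxpos] with n hn
      simp [perturb, not_le.2 hn]
    have hc : Tendsto (fun r : ℝ × ℝ => rate ch r.1 r.2) (𝓝[{r | 0 ≤ r.1 ∧ 0 ≤ r.2}]
        (p.p₁ x, p.p₂ x)) (𝓝 (rate ch (p.p₁ x) (p.p₂ x))) :=
      continuousOn_rate ch (p.p₁ x, p.p₂ x) ⟨hp'.1.1 x hx, hp'.2.1 x hx⟩
    have hin : Tendsto (fun n => ((perturb ch p κ (e n)).p₁ x, (perturb ch p κ (e n)).p₂ x)) atTop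
        (𝓝[{r | 0 ≤ r.1 ∧ 0 ≤ r.2}] (p.p₁ x, p.p₂ x)) := by
      refine tendsto_nhdsWithin_iff.2 ⟨l1.prodMk_nhds l2, Eventually.of_forall fun n => ?_⟩
      have hf' := (Feasible_iff ch _).1 (hf n)
      exact ⟨hf'.1.1 x hx, hf'.2.1 x hx⟩
    have hlim' := hc.comp hin
    simp only [Function.comp_def] at hlim'
    exact hlim'

/-- A solution that is optimal in a class containing perturbations of all solutions is optimal. -/
lemma IsOptimalAmong_dense {Q : PSDPair → Prop} (κ : ℝ)
    (hQ : ∀ q ε, Feasible ch q → 0 < ε → ε < 1 → Q (perturb ch q κ ε))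
    (hp : IsOptimalAmong ch Q p) {q : PSDPair} (hq : Feasible ch q) :
    capacity ch q ≤ capacity ch p := by
  -- The shift by `2` keeps the parameter strictly below `1` already at `n = 0`.
  have he : ∀ n : ℕ, 0 < 1 / ((n : ℝ) + 2) := fun n => by positivity
  have he' : ∀ n : ℕ, 1 / ((n : ℝ) + 2) < 1 := fun n => by
    rw [div_lt_one (by positivity)]
    have : (0 : ℝ) ≤ n := Nat.cast_nonneg n
    linarith
  have hlim : Tendsto (fun n : ℕ => 1 / ((n : ℝ) + 2)) atTop (𝓝 0) := by
    have := tendsto_one_div_add_atTop_nhds_zero_nat (𝕜 := ℝ)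
    have := this.comp (tendsto_add_atTop_nat 1)
    refine this.congr fun n => ?_
    simp only [Function.comp, Nat.cast_add, Nat.cast_one]
    ring
  exact le_of_tendsto' (tendsto_capacity_perturb hq κ he he' hlim) fun n =>
    hp.2 _ (feasible_perturb hq (he n) (he' n)) (hQ q _ hq (he n) (he' n))

end Density

/-! ### Classification of the optimum and assembly -/

namespace TwoUserSAPD

variable {ch : FlatChannel} {l₁ l₂ c : ℝ}

lemma IsOptimalAmong.capacity_le_of_partiallyOverlapping {p q : PSDPair}
    (hp : IsOptimalAmong ch (PartiallyOverlapping ch) p) (hq : Feasible ch q) :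
    capacity ch q ≤ capacity ch p :=
  IsOptimalAmong_dense ch.W (fun _ _ h => partiallyOverlapping_perturb h) hp hq

lemma IsOptimalAmong.capacity_le_of_equalSpectra {p q : PSDPair}
    (hp : IsOptimalAmong ch (EqualSpectra ch) p) (hq : Feasible ch q) :
    capacity ch q ≤ capacity ch p :=
  IsOptimalAmong_dense 0 (fun _ _ h => equalSpectra_perturb h) hp hq

lemma partialSolutions_subset (ch : FlatChannel) :
    PartialSolutions ch ⊆ ThreeBand ch ∪ NoExclusive₁ ch ∪ NoExclusive₂ ch :=
  Set.union_subset_union_left _ (Set.union_subset_union_left _ fun _ h => h.1)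

namespace OptimalBands

variable {S₁ S₂ S₁₂ x y q₁ q₂ : ℝ}

lemma bandCapacity_eq (hb : OptimalBands ch l₁ l₂ c S₁ S₂ S₁₂ x y q₁ q₂) {t : BandParams}
    (hS₁ : t.S₁ = S₁) (hS₂ : t.S₂ = S₂) (hS₁₂ : t.S₁₂ = S₁₂) (hσ₁ : t.σ₁ = q₁) (hσ₂ : t.σ₂ = q₂)
    (hx : S₁ ≠ 0 → t.σ₁ + t.c₁ = x) (hy : S₂ ≠ 0 → t.σ₂ + t.c₂ = y) :
    bandCapacity ch t = l₁ * ch.P₁ + l₂ * ch.P₂ + c * ch.W := by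
  rw [bandCapacity_eq_rate, ← hb.value, hS₁, hS₂, hS₁₂]
  have e1 : S₁ * rate ch (t.σ₁ + t.c₁) 0 = S₁ * rate ch x 0 := by
    by_cases h : S₁ = 0
    · simp [h]
    · rw [hx h]
  have e2 : S₂ * rate ch 0 (t.σ₂ + t.c₂) = S₂ * rate ch 0 y := by
    by_cases h : S₂ = 0
    · simp [h]
    · rw [hy h]
  rw [e1, e2, hσ₁, hσ₂]

/-- The three kinds of partially overlapping bands. -/
lemma exists_bandParams (hb : OptimalBands ch l₁ l₂ c S₁ S₂ S₁₂ x y q₁ q₂)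
    (h : AffineMajorant (rate ch) l₁ l₂ c) (hl₂ : 0 < l₂) (hS₁₂ : 0 < S₁₂)
    (hS : 0 < S₁ ∨ 0 < S₂) :
    ∃ t : BandParams, (0 < S₁ → 0 < S₂ → t ∈ ThreeBand ch) ∧ (S₁ = 0 → t ∈ NoExclusive₁ ch) ∧
      (S₂ = 0 → t ∈ NoExclusive₂ ch) ∧ t.σ₂ < sigmaBound ch ∧
      t.S₁ = S₁ ∧ t.S₂ = S₂ ∧ t.S₁₂ = S₁₂ ∧ t.σ₁ = q₁ ∧ t.σ₂ = q₂ ∧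
      (S₁ ≠ 0 → t.σ₁ + t.c₁ = x) ∧ (S₂ ≠ 0 → t.σ₂ + t.c₂ = y) := by
  rcases hb.S₁_nonneg.eq_or_lt with h1 | h1
  · have h2 : 0 < S₂ := hS.resolve_left (by rw [← h1]; exact lt_irrefl 0)
    have ht := hb.mem_noExclusive₁ h h1.symm h2 hS₁₂
    exact ⟨_, fun k => absurd h1 k.ne, fun _ => ht, fun k => absurd k h2.ne',
      lt_sigmaBound_of_mem_noExclusive₁ ht, h1, rfl, rfl, rfl, rfl, fun k => absurd h1.symm k,
      fun _ => add_sub_cancel q₂ y⟩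
  rcases hb.S₂_nonneg.eq_or_lt with h2 | h2
  · have ht := hb.mem_noExclusive₂ h h1 h2.symm hS₁₂
    exact ⟨_, fun _ k => absurd h2 k.ne, fun k => absurd k h1.ne', fun _ => ht,
      hb.lt_sigmaBound_of_S₂_eq_zero h hl₂ h1 h2.symm hS₁₂, rfl, h2, rfl, rfl, rfl,
      fun _ => add_sub_cancel q₁ x, fun k => absurd h2.symm k⟩
  · have ht := hb.mem_threeBand h h1 h2 hS₁₂
    exact ⟨_, fun _ _ => ht, fun k => absurd k h1.ne', fun k => absurd k h2.ne',
      lt_sigmaBound_of_mem_threeBand ht, rfl, rfl, rfl, rfl, rfl,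
      fun _ => add_sub_cancel q₁ x, fun _ => add_sub_cancel q₂ y⟩

/-- `PartialSolutions` omits the singular three-band parameters. For these the value equals that of
the disjoint layout, which is the first alternative. -/
lemma disjointCapacity_eq_or_exists (hb : OptimalBands ch l₁ l₂ c S₁ S₂ S₁₂ x y q₁ q₂)
    (h : AffineMajorant (rate ch) l₁ l₂ c) (hl₂ : 0 < l₂) (hS₁₂ : 0 < S₁₂)
    (hS : 0 < S₁ ∨ 0 < S₂) :
    disjointCapacity ch = l₁ * ch.P₁ + l₂ * ch.P₂ + c * ch.W ∨
      ∃ t ∈ PartialSolutions ch, t.σ₂ < sigmaBound ch ∧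
        bandCapacity ch t = l₁ * ch.P₁ + l₂ * ch.P₂ + c * ch.W := by
  obtain ⟨t, h3, hn1, hn2, hσ, e1, e2, e3, e4, e5, ex, ey⟩ := hb.exists_bandParams h hl₂ hS₁₂ hS
  have hB := hb.bandCapacity_eq e1 e2 e3 e4 e5 ex ey
  rcases hb.S₁_nonneg.eq_or_lt with h1 | h1
  · exact Or.inr ⟨t, Or.inl (Or.inr (hn1 h1.symm)), hσ, hB⟩
  rcases hb.S₂_nonneg.eq_or_lt with h2 | h2
  · exact Or.inr ⟨t, Or.inr (hn2 h2.symm), hσ, hB⟩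
  by_cases hs : t.c₁ * t.c₂ = t.σ₁ * t.σ₂
  · have hx := ex h1.ne'
    have hy := ey h2.ne'
    left
    refine hb.disjointCapacity_eq_of_singular h h1 h2 ?_
    rw [← hx, ← hy, ← e4, ← e5, add_sub_cancel_left, add_sub_cancel_left, hs]
  · exact Or.inr ⟨t, Or.inl (Or.inl ⟨h3 h1 h2, hs⟩), hσ, hB⟩

/-- The optimal value is attained by one of the three kinds of solutions. -/
lemma value_cases (hb : OptimalBands ch l₁ l₂ c S₁ S₂ S₁₂ x y q₁ q₂)
    (h : AffineMajorant (rate ch) l₁ l₂ c) (hl₂ : 0 < l₂) :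
    disjointCapacity ch = l₁ * ch.P₁ + l₂ * ch.P₂ + c * ch.W ∨
      overlapCapacity ch = l₁ * ch.P₁ + l₂ * ch.P₂ + c * ch.W ∨
      ∃ t ∈ PartialSolutions ch, t.σ₂ < sigmaBound ch ∧
        bandCapacity ch t = l₁ * ch.P₁ + l₂ * ch.P₂ + c * ch.W := by
  rcases hb.S₁₂_nonneg.eq_or_lt with h12 | h12
  · exact Or.inl (hb.disjointCapacity_eq_of_S₁₂_eq_zero h h12.symm)
  by_cases hS : 0 < S₁ ∨ 0 < S₂
  · exact (hb.disjointCapacity_eq_or_exists h hl₂ h12 hS).imp_right Or.inr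
  · rw [not_or, not_lt, not_lt] at hS
    exact Or.inr (Or.inl (hb.overlapCapacity_eq_of_S₁_S₂_eq_zero
      (le_antisymm hS.1 hb.S₁_nonneg) (le_antisymm hS.2 hb.S₂_nonneg)))

end OptimalBands

lemma σ₂_pos_of_mem_partialSolutions {t : BandParams} (ht : t ∈ PartialSolutions ch) :
    0 < t.σ₂ := by
  rcases ht with (ht | ht) | ht
  · exact ht.1.2.2.2.2.2.1
  · exact ht.2.2.2.2.2.1
  · exact ht.2.2.2.2.2.2.1

section Reduced

variable {V : ℝ}

lemma bandCapacity_le (hV : ∀ p, Feasible ch p → capacity ch p ≤ V) {t : BandParams}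
    (ht : t ∈ PartialSolutions ch) : bandCapacity ch t ≤ V := by
  have hb := (isBandSolution_and_partiallyOverlapping (partialSolutions_subset ch ht)).1
  rw [← hb.capacity_layout]
  exact hV _ hb.feasible

lemma mem_upperBounds_reducedCapacity (hV : ∀ p, Feasible ch p → capacity ch p ≤ V) :
    V ∈ upperBounds (reducedCapacity ch '' sigmaDomain ch) := by
  rintro _ ⟨s, ⟨-, -, t, ht, hs⟩, rfl⟩
  refine csSup_le ⟨_, t, ⟨ht, hs⟩, rfl⟩ ?_
  rintro _ ⟨t', ht', rfl⟩
  exact bandCapacity_le hV ht'.1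

/-- A parameter that attains the global bound `V` makes the supremum over its fibre a maximum, since
all other members of the fibre are feasible. -/
lemma mem_reducedCapacity (hV : ∀ p, Feasible ch p → capacity ch p ≤ V) {t : BandParams}
    (ht : t ∈ PartialSolutions ch) (hσ : t.σ₂ < sigmaBound ch) (hB : bandCapacity ch t = V) :
    V ∈ reducedCapacity ch '' sigmaDomain ch := by
  refine ⟨t.σ₂, ⟨σ₂_pos_of_mem_partialSolutions ht, hσ, t, ht, rfl⟩, ?_⟩
  refine IsGreatest.csSup_eq ⟨⟨t, ⟨ht, rfl⟩, hB⟩, ?_⟩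
  rintro _ ⟨t', ht', rfl⟩
  exact bandCapacity_le hV ht'.1

end Reduced

section Partial

lemma real_volume_pos {W : ℝ} {s : Set ℝ} (hs : s ⊆ Set.Icc 0 W) (h : volume s ≠ 0) :
    0 < volume.real s :=
  ENNReal.toReal_pos h (volume_ne_top_of_subset_Icc hs)

lemma real_volume_eq_zero {s : Set ℝ} (h : volume s = 0) : volume.real s = 0 := by
  simp [Measure.real, h]

lemma exists_describedBy (hl₁ : 0 < l₁) (hl₂ : 0 < l₂) (hc : 0 < c)
    (h : AffineMajorant (rate ch) l₁ l₂ c) {p : PSDPair} (hp : Feasible ch p)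
    (hpp : PartiallyOverlapping ch p)
    (hV : capacity ch p = l₁ * ch.P₁ + l₂ * ch.P₂ + c * ch.W) :
    ∃ t : BandParams, DescribedBy ch p t ∧ t.σ₂ < sigmaBound ch ∧
      (volume (excl₁ ch p) ≠ 0 → volume (excl₂ ch p) ≠ 0 → t ∈ ThreeBand ch) ∧
      (volume (excl₁ ch p) = 0 → t ∈ NoExclusive₁ ch) ∧
      (volume (excl₂ ch p) = 0 → t ∈ NoExclusive₂ ch) := by
  have i1 : excl₁ ch p ⊆ Set.Icc 0 ch.W := fun x hx => hx.1.1
  have i2 : excl₂ ch p ⊆ Set.Icc 0 ch.W := fun x hx => hx.1.1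
  have i12 : shared ch p ⊆ Set.Icc 0 ch.W := fun x hx => hx.1.1
  obtain ⟨x, y, q₁, q₂, hb, ax, ay, a1, a2⟩ := optimalBands_of_le_capacity hl₁ hl₂ hc h hp hV.ge
  have hS : 0 < volume.real (excl₁ ch p) ∨ 0 < volume.real (excl₂ ch p) := by
    by_cases h1 : volume (excl₁ ch p) = 0
    · exact Or.inr (real_volume_pos i2 fun h2 => hpp.2 ⟨h1, h2⟩)
    · exact Or.inl (real_volume_pos i1 h1)
  obtain ⟨t, h3, hn1, hn2, hσ, e1, e2, e3, e4, e5, ex, ey⟩ :=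
    hb.exists_bandParams h hl₂ (real_volume_pos i12 hpp.1) hS
  have hB := hb.bandCapacity_eq e1 e2 e3 e4 e5 ex ey
  have m3 : volume (excl₁ ch p) ≠ 0 → volume (excl₂ ch p) ≠ 0 → t ∈ ThreeBand ch :=
    fun k1 k2 => h3 (real_volume_pos i1 k1) (real_volume_pos i2 k2)
  have m1 : volume (excl₁ ch p) = 0 → t ∈ NoExclusive₁ ch := fun k => hn1 (real_volume_eq_zero k)
  have m2 : volume (excl₂ ch p) = 0 → t ∈ NoExclusive₂ ch := fun k => hn2 (real_volume_eq_zero k)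
  have hm : t ∈ ThreeBand ch ∪ NoExclusive₁ ch ∪ NoExclusive₂ ch := by
    by_cases k1 : volume (excl₁ ch p) = 0
    · exact Or.inl (Or.inr (m1 k1))
    by_cases k2 : volume (excl₂ ch p) = 0
    · exact Or.inr (m2 k2)
    · exact Or.inl (Or.inl (m3 k1 k2))
  obtain ⟨hbs, hpo⟩ := isBandSolution_and_partiallyOverlapping hm
  refine ⟨t, ⟨e1, e2, e3, ?_, ?_, ?_, ?_, hB.trans hV.symm,
    hbs.capacity_layout.trans (hB.trans hV.symm), ⟨hbs.feasible, hpo⟩, fun q hq _ => ?_⟩,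
    hσ, m3, m1, m2⟩
  · by_cases k : volume (excl₁ ch p) = 0
    · filter_upwards [measure_eq_zero_iff_ae_notMem.1 k] with z hz hz' using absurd hz' hz
    · rw [ex (real_volume_pos i1 k).ne']
      exact ax
  · by_cases k : volume (excl₂ ch p) = 0
    · filter_upwards [measure_eq_zero_iff_ae_notMem.1 k] with z hz hz' using absurd hz' hz
    · rw [ey (real_volume_pos i2 k).ne']
      exact ay
  · rw [e3, e4, a1]
  · rw [e3, e5, a2]
  · rw [hbs.capacity_layout, hB]
    exact capacity_le hl₁ hl₂ h hq

lemma overlapCapacity_eq_of_equalSpectra (hl₁ : 0 < l₁) (hl₂ : 0 < l₂) (hc : 0 < c)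
    (h : AffineMajorant (rate ch) l₁ l₂ c) {p : PSDPair} (hp : Feasible ch p)
    (hpe : EqualSpectra ch p)
    (hV : capacity ch p = l₁ * ch.P₁ + l₂ * ch.P₂ + c * ch.W) :
    capacity ch p = overlapCapacity ch := by
  obtain ⟨x, y, q₁, q₂, hb, -⟩ := optimalBands_of_le_capacity hl₁ hl₂ hc h hp hV.ge
  rw [hV, hb.overlapCapacity_eq_of_S₁_S₂_eq_zero (real_volume_eq_zero hpe.1)
    (real_volume_eq_zero hpe.2)]

lemma disjointCapacity_eq_or_exists_of_partiallyOverlapping (hl₁ : 0 < l₁) (hl₂ : 0 < l₂)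
    (hc : 0 < c) (h : AffineMajorant (rate ch) l₁ l₂ c) {p : PSDPair} (hp : Feasible ch p)
    (hpp : PartiallyOverlapping ch p)
    (hV : capacity ch p = l₁ * ch.P₁ + l₂ * ch.P₂ + c * ch.W) :
    capacity ch p = disjointCapacity ch ∨
      ∃ t ∈ PartialSolutions ch, t.σ₂ < sigmaBound ch ∧ bandCapacity ch t = capacity ch p := by
  obtain ⟨x, y, q₁, q₂, hb, -⟩ := optimalBands_of_le_capacity hl₁ hl₂ hc h hp hV.ge
  have hS : 0 < volume.real (excl₁ ch p) ∨ 0 < volume.real (excl₂ ch p) := by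
    by_cases h1 : volume (excl₁ ch p) = 0
    · exact Or.inr (real_volume_pos (W := ch.W) (fun x hx => hx.1.1) fun h2 => hpp.2 ⟨h1, h2⟩)
    · exact Or.inl (real_volume_pos (W := ch.W) (fun x hx => hx.1.1) h1)
  rw [hV]
  exact (hb.disjointCapacity_eq_or_exists h hl₂
    (real_volume_pos (W := ch.W) (fun x hx => hx.1.1) hpp.1) hS).imp_left Eq.symm

end Partial

end TwoUserSAPD
theorem mainTheorem2 (ch : FlatChannel) :
    -- an optimal solution exists, and it is of one of the three kinds
    (∃ p, IsOptimal ch p ∧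
      (p = layout (disjointBands ch) ∨ p = layout (overlapBands ch) ∨
        PartiallyOverlapping ch p ∧
          ∃ t ∈ PartialSolutions ch, t.σ₂ < sigmaBound ch ∧ p = layout t)) ∧
    -- the optimal value is the best of the three cases, the third one being a maximum over `σ₂`
    (∀ p, IsOptimal ch p →
      IsGreatest ({disjointCapacity ch, overlapCapacity ch} ∪
        reducedCapacity ch '' sigmaDomain ch) (capacity ch p)) ∧
    -- disjoint spectra
    (IsOptimalAmong ch (DisjointSpectra ch) (layout (disjointBands ch)) ∧
      capacity ch (layout (disjointBands ch)) = disjointCapacity ch) ∧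
    -- fully overlapping spectra
    (Feasible ch (layout (overlapBands ch)) ∧ EqualSpectra ch (layout (overlapBands ch)) ∧
      capacity ch (layout (overlapBands ch)) = overlapCapacity ch ∧
      ∀ p, IsOptimalAmong ch (EqualSpectra ch) p → capacity ch p = overlapCapacity ch) ∧
    -- partially overlapping spectra: three contiguous bands and the equations
    (∀ p, IsOptimalAmong ch (PartiallyOverlapping ch) p →
      (volume (excl₁ ch p) ≠ 0 → volume (excl₂ ch p) ≠ 0 →
        ∃ t ∈ ThreeBand ch, DescribedBy ch p t ∧ t.σ₂ < sigmaBound ch) ∧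
      (volume (excl₁ ch p) = 0 →
        ∃ t ∈ NoExclusive₁ ch, DescribedBy ch p t ∧ t.σ₂ < sigmaBound ch) ∧
      (volume (excl₂ ch p) = 0 →
        ∃ t ∈ NoExclusive₂ ch, DescribedBy ch p t ∧ t.σ₂ < sigmaBound ch)) ∧
    -- the bound on `σ₂` follows from the six equations
    (∀ t ∈ ThreeBand ch, t.σ₂ < sigmaBound ch) ∧
    -- solutions of the equations are partially overlapping solutions with capacity `B`
    (∀ t ∈ ThreeBand ch ∪ NoExclusive₁ ch ∪ NoExclusive₂ ch,
      Feasible ch (layout t) ∧ PartiallyOverlapping ch (layout t) ∧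
        capacity ch (layout t) = bandCapacity ch t) ∧
    -- elimination of all variables but `σ₂`
    (EliminatesToσ₂ (RegularThreeBand ch) ∧ EliminatesToσ₂ (NoExclusive₁ ch) ∧
      EliminatesToσ₂ (NoExclusive₂ ch)) ∧
    (∀ s : ℝ, 0 < s → {t ∈ PartialSolutions ch | t.σ₂ = s}.encard ≤ 16) ∧
    -- the partially overlapping optimum as a maximum over `σ₂`
    (∀ p, IsOptimalAmong ch (PartiallyOverlapping ch) p →
      capacity ch p = disjointCapacity ch ∨
        IsGreatest (reducedCapacity ch '' sigmaDomain ch) (capacity ch p)) := by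
  obtain ⟨l₁, l₂, c, hl₁, hl₂, hc, h, S₁, S₂, S₁₂, x, y, q₁, q₂, hb⟩ := exists_optimalBands ch
  -- The dual value `V` bounds all capacities and is attained. Hence every optimum, also one among
  -- equal or among partially overlapping spectra, has capacity `V` and touches the same majorant.
  obtain ⟨V, hVdef⟩ : ∃ V, V = l₁ * ch.P₁ + l₂ * ch.P₂ + c * ch.W := ⟨_, rfl⟩
  have hV : ∀ p, Feasible ch p → capacity ch p ≤ V := fun p hp =>
    (capacity_le hl₁ hl₂ h hp).trans_eq hVdef.symm
  have hdis := isBandSolution_disjointBands ch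
  have hove := isBandSolution_overlapBands ch
  have cdis : capacity ch (layout (disjointBands ch)) = disjointCapacity ch :=
    hdis.capacity_layout.trans (bandCapacity_disjointBands ch)
  have cove : capacity ch (layout (overlapBands ch)) = overlapCapacity ch :=
    hove.capacity_layout.trans (bandCapacity_overlapBands ch)
  have hcases := hb.value_cases h hl₂
  rw [← hVdef] at hcases
  have hex : ∃ p, IsOptimal ch p ∧ capacity ch p = V ∧
      (p = layout (disjointBands ch) ∨ p = layout (overlapBands ch) ∨
        PartiallyOverlapping ch p ∧
          ∃ t ∈ PartialSolutions ch, t.σ₂ < sigmaBound ch ∧ p = layout t) := by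
    have key : ∀ p, Feasible ch p → capacity ch p = V → IsOptimal ch p := fun p hp e =>
      ⟨⟨hp, trivial⟩, fun q hq _ => (hV q hq).trans_eq e.symm⟩
    rcases hcases with e | e | ⟨t, ht, hσ, e⟩
    · exact ⟨_, key _ hdis.feasible (cdis.trans e), cdis.trans e, Or.inl rfl⟩
    · exact ⟨_, key _ hove.feasible (cove.trans e), cove.trans e, Or.inr (Or.inl rfl)⟩
    · obtain ⟨ht1, ht2⟩ := isBandSolution_and_partiallyOverlapping (partialSolutions_subset ch ht)
      have e' := ht1.capacity_layout.trans e
      exact ⟨_, key _ ht1.feasible e', e', Or.inr (Or.inr ⟨ht2, t, ht, hσ, rfl⟩)⟩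
  obtain ⟨p₀, hp₀, hp₀V, hp₀k⟩ := hex
  have hVp : ∀ p, Feasible ch p → (∀ q, Feasible ch q → capacity ch q ≤ capacity ch p) →
      capacity ch p = V := fun p hp hq =>
    le_antisymm (hV p hp) (hp₀V.symm.trans_le (hq p₀ hp₀.1.1))
  have hpart : ∀ p, IsOptimalAmong ch (PartiallyOverlapping ch) p → capacity ch p = V := fun p hp =>
    hVp p hp.1.1 fun _ => hp.capacity_le_of_partiallyOverlapping
  refine ⟨⟨p₀, hp₀, hp₀k⟩, fun p hp => ?_, ⟨⟨⟨hdis.feasible, disjointSpectra_disjointBands ch⟩,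
    fun q hq hd => (capacity_le_disjointCapacity hq hd).trans_eq cdis.symm⟩, cdis⟩,
    ⟨hove.feasible, equalSpectra_overlapBands ch, cove, fun p hp => ?_⟩, fun p hp => ?_,
    fun t => lt_sigmaBound_of_mem_threeBand, fun t ht => ?_,
    ⟨eliminatesToσ₂_regularThreeBand ch, eliminatesToσ₂_noExclusive₁ ch,
      eliminatesToσ₂_noExclusive₂ ch⟩, fun s => encard_partialSolutions_le ch, fun p hp => ?_⟩
  · rw [hVp p hp.1.1 fun q hq => hp.2 q hq trivial]
    constructor
    · rcases hcases with e | e | ⟨t, ht, hσ, e⟩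
      · exact Or.inl (Or.inl e.symm)
      · exact Or.inl (Or.inr e.symm)
      · exact Or.inr (mem_reducedCapacity hV ht hσ e)
    · rintro v ((rfl | rfl) | hv)
      · exact cdis ▸ hV _ hdis.feasible
      · exact cove ▸ hV _ hove.feasible
      · exact mem_upperBounds_reducedCapacity hV hv
  · exact overlapCapacity_eq_of_equalSpectra hl₁ hl₂ hc h hp.1.1 hp.1.2
      ((hVp p hp.1.1 fun _ => hp.capacity_le_of_equalSpectra).trans hVdef)
  · obtain ⟨t, hd, hσ, m3, m1, m2⟩ := exists_describedBy hl₁ hl₂ hc h hp.1.1 hp.1.2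
      ((hpart p hp).trans hVdef)
    exact ⟨fun k1 k2 => ⟨t, m3 k1 k2, hd, hσ⟩, fun k => ⟨t, m1 k, hd, hσ⟩,
      fun k => ⟨t, m2 k, hd, hσ⟩⟩
  · obtain ⟨ht1, ht2⟩ := isBandSolution_and_partiallyOverlapping ht
    exact ⟨ht1.feasible, ht2, ht1.capacity_layout⟩
  · refine (disjointCapacity_eq_or_exists_of_partiallyOverlapping hl₁ hl₂ hc h hp.1.1 hp.1.2
      ((hpart p hp).trans hVdef)).imp_right ?_
    rintro ⟨t, ht, hσ, e⟩
    rw [hpart p hp] at e ⊢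
    exact ⟨mem_reducedCapacity hV ht hσ e, mem_upperBounds_reducedCapacity hV⟩
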